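/- **Setting.** Let $Y=m(D,X,\varepsilon)$ and $D=h(Z,X,\eta)$, where $Y,D,Z,\eta$ are real random variables, $X$ is an $\mathbb R^k$-valued random vector, $\varepsilon$ takes values in a standard Borel space, $m,h$ are measurable, and $m(d,x,e)$ is continuously differentiable in $d$. Write $F_W$ for the distribution function of $W$, $\operatorname{supp}W$ for the support of its law and $H^{-1}(\tau)=\inf\{d:H(d)\ge\tau\}$. Assume that $(\varepsilon,\eta)$ is independent of $Z$ given $X$; that almost surely $p\mapsto h(Z,X,p)$ is strictly monotone on $\mathbb R$, in a direction which depends at most (measurably) on $X$; and that for almost every $x$ the conditional distribution function $F_{\eta|X}(\cdot|x)$ is continuous, and strictly increasing on its support. Let $V=F_{D|Z,X}(D|Z,X)$ be the control variable, and assume that the law of $(D,V,X)$ is absolutely continuous with respect to the product of Lebesgue measure and the law of $(V,X)$. **Policy.** For a family of functions $H_t:\mathbb R\to\mathbb R$, $t\in[0,1]$, put $\pi_t(d)=H_t^{-1}(F_D(d))$, $D^t=\pi_t(D)$ and $Y^t=m(D^t,X,\varepsilon)$. Assume: at every $d$ with $0<F_D(d)<1$, $\pi_0(d)=d$ and $t\mapsto\pi_t(d)$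 has a right derivative $\dot\pi(d)$ at $t=0$, which is bounded in $d$; for every $t\in[0,1]$, $\operatorname{supp}D^t\subseteq\operatorname{supp}D$ and $H_t$ is continuous; and $D$ has a density $f_D$ with $f_D>0$ on $\operatorname{supp}D$. **Regularity.** With $\dot m(d,x,e)=\dot\pi(d)\,\partial_dm(d,x,e)$, assume that $\dot m$ is measurable, that for every $\nu>0$ $$P\big(|m(\pi_t(D),X,\varepsilon)-m(D,X,\varepsilon)-t\,\dot m(D,X,\varepsilon)|\ge\nu t\big)=o(t)\qquad(t\downarrow0),$$ and that $(Y,\dot m(D,X,\varepsilon))$ has a density $f(y,y')$ on $\mathbb R^2$ which is uniformly continuous in $y\in\mathbb R$ for each $y'$ and satisfies $f(y,y')\le C|g(y')|$ for all $(y,y')$, with $C>0$, $\int|g|<\infty$ and $\int|y'g(y')|\,dy'<\infty$. Fix a version of the conditional law of $\varepsilon$ given $(D,V,X)$ that satisfies the following; probabilities given $(D,V,X)=(d,v,x)$ refer to it, and $F_{Y|D,V,X}(y|d,v,x)=P(m(d,x,\varepsilon)\le y\mid D=d,V=v,X=x)$. (a) For all $v\in\operatorname{supp}V$, $x\in\operatorname{supp}X$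 and $y\in\mathbb R$, $d\mapsto F_{Y|D,V,X}(y|d,v,x)$ is continuously differentiable on $\operatorname{supp}D$. (b) For all $(d,v,x)\in\operatorname{supp}D\times\operatorname{supp}V\times\operatorname{supp}X$ and $\nu>0$, $P(|m(d+\delta,x,\varepsilon)-m(d,x,\varepsilon)-\delta\,\partial_dm(d,x,\varepsilon)|\ge\nu\delta\mid D=d,V=v,X=x)=o(\delta)$ as $\delta\downarrow0$. (c) There are $g,C$ with $\int|g|<\infty$ and $\int|y'g(y')|\,dy'<\infty$ such that for all these $(d,v,x)$ the conditional law of $(m(d,x,\varepsilon),\partial_dm(d,x,\varepsilon))$ given $(D,V,X)=(d,v,x)$ has a density on $\mathbb R^2$ that is continuous in $y\in\mathbb R$ for each $y'$ and at most $C|g(y')|$ at every $(y,y')$. **Functional.** Let $B$ be a real Banach space (for example $\ell^\infty(\mathbb R)$) and let $\Gamma$ be a $B$-valued functional on a set of functions on $\mathbb R$ that contains $F_{Y^t}$ for all $t\in[0,1]$ (for example the set of all distribution functions). Let $\Gamma$ be Hadamard-differentiable at $F_Y$ with respect to the supremum norm, tangentially to the space $C_b(\mathbb R)$ of bounded continuous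 functions, with (linear, continuous) derivative $\Gamma'_{F_Y}:C_b(\mathbb R)\to B$. Put $\theta_\Gamma=\lim_{t\downarrow0}\big(\Gamma(F_{Y^t})-\Gamma(F_Y)\big)/t$. **Claim (i).** Suppose that $H_t(d)=F_D(d)+t\,(G_D(d)-F_D(d))$ for all $t\in[0,1]$ and $d$, where $G_D$ is the distribution function of a probability measure on $\mathbb R$, and let $F_{V,X|D}$ be a version of the conditional distribution function. Then $\theta_\Gamma$ exists, and $$\theta_\Gamma=\int\Gamma'_{F_Y}\big(F_{Y|D,V,X}(\cdot|d,v,x)\big)\,d\big(F_{V,X|D}(v,x|d)\,(G_D(d)-F_D(d))\big)$$ whenever this integral is defined, that is, whenever the integrator is the distribution function of a finite signed measure (the integral, a Bochner integral against this measure, then converges). Moreover, if a copula $C$ on $[0,1]^{2+k}$ is a copula of $(D^t,V,X)$ for every $t\in[0,1]$, in the sense that $C(H_t(d),F_V(v),F_X(x))=P(D^t\le d,V\le v,X\le x)$ for all $(d,v,x)$, where $F_X(x)=(F_{X_1}(x_1),\dots,F_{X_k}(x_k))$, and if $C$ is partially differentiable in its first component on $(0,1)\times[0,1]^{1+k}$,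 then $\partial_tC(H_t(d),F_V(v),F_X(x))|_{t=0}$ exists for all $(d,v,x)$, it is the distribution function of a finite signed measure if the integrator above is (namely of the same one), and whenever it is, $$\theta_\Gamma=\int\Gamma'_{F_Y}\big(F_{Y|D,V,X}(\cdot|d,v,x)\big)\,d\big(\partial_tC(H_t(d),F_V(v),F_X(x))|_{t=0}\big).$$ **Claim (ii).** Suppose that $H_t(d)=F_D(d-t)$ for all $t\in[0,1]$ and $d$ (a location shift). Then $\partial_dF_{Y|D,V,X}(y|D,V,X)$ is integrable for every $y$, $\theta_\Gamma$ exists, and $$\theta_\Gamma=\Gamma'_{F_Y}\big(\mathbb E[\partial_dF_{Y|D,V,X}(\cdot|D,V,X)]\big).$$ -/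

import Mathlib

open MeasureTheory ProbabilityTheory Filter Set Topology Asymptotics

namespace PolicyEffect

/-! ### Distribution functions, quantiles, conditional independence -/

/-- The distribution function `w ↦ P[W ≤ w]` of a real random variable. -/
noncomputable def cdfOf {Ω : Type*} [MeasurableSpace Ω] (P : Measure Ω) (W : Ω → ℝ) (w : ℝ) : ℝ :=
  P.real {ω | W ω ≤ w}

/-- The support of the law of a random element. -/
def suppOf {Ω α : Type*} [MeasurableSpace Ω] [TopologicalSpace α] [MeasurableSpace α]
    (P : Measure Ω) (W : Ω → α) : Set α :=
  (P.map W).support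

/-- The generalized inverse `H⁻¹(τ) = inf {d : H d ≥ τ}`. -/
noncomputable def quantile (H : ℝ → ℝ) (τ : ℝ) : ℝ := sInf {d | τ ≤ H d}

/-- Conditional independence of `A` and `B` given `W`:
`P[A ∈ s, B ∈ u | W] = P[A ∈ s | W] P[B ∈ u | W]` almost surely, for all measurable `s`, `u`. -/
def CondIndepGiven {Ω α β γ : Type*} [MeasurableSpace Ω] [MeasurableSpace α] [MeasurableSpace β]
    [mγ : MeasurableSpace γ] (P : Measure Ω) (A : Ω → α) (B : Ω → β) (W : Ω → γ) : Prop :=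
  ∀ (s : Set α) (u : Set β), MeasurableSet s → MeasurableSet u →
    P⟦A ⁻¹' s ∩ B ⁻¹' u | mγ.comap W⟧ =ᵐ[P]
      fun ω => (P⟦A ⁻¹' s | mγ.comap W⟧) ω * (P⟦B ⁻¹' u | mγ.comap W⟧) ω

/-! ### The triangular system and the control variable -/

/-- The outcome `m(D, X, ε)`. -/
def outcome {Ω E 𝓔 : Type*} (m : ℝ → E → 𝓔 → ℝ) (D : Ω → ℝ) (X : Ω → E) (ε : Ω → 𝓔) (ω : Ω) : ℝ :=
  m (D ω) (X ω) (ε ω)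

/-- The control variable `V = F_{D|Z,X}(D | Z, X)`. -/
noncomputable def controlVar {Ω : Type*} [MeasurableSpace Ω] (P : Measure Ω) [IsFiniteMeasure P]
    {k : ℕ} (D Z : Ω → ℝ) (X : Ω → Fin k → ℝ) (ω : Ω) : ℝ :=
  (condDistrib D (fun ω => (Z ω, X ω)) P (Z ω, X ω)).real (Iic (D ω))

/-- The structural derivative `∂_d m (d, x, e)`. -/
noncomputable def structDeriv {E 𝓔 : Type*} (m : ℝ → E → 𝓔 → ℝ) (d : ℝ) (x : E) (e : 𝓔) : ℝ :=
  deriv (fun s => m s x e) d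

/-- The triangular system `Y = m(D, X, ε)`, `D = h(Z, X, η)`, with a measurable `m` that is
continuously differentiable in its first argument. -/
structure IsTriangularSystem {Ω 𝓔 : Type*} [MeasurableSpace Ω] [MeasurableSpace 𝓔]
    (P : Measure Ω) {k : ℕ} (Y D Z η : Ω → ℝ) (X : Ω → Fin k → ℝ) (ε : Ω → 𝓔)
    (m : ℝ → (Fin k → ℝ) → 𝓔 → ℝ) (h : ℝ → (Fin k → ℝ) → ℝ → ℝ) : Prop where
  meas_D : Measurable D
  meas_Z : Measurable Z
  meas_η : Measurable η
  meas_X : Measurable X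
  meas_ε : Measurable ε
  meas_m : Measurable fun p : ℝ × (Fin k → ℝ) × 𝓔 => m p.1 p.2.1 p.2.2
  meas_h : Measurable fun p : ℝ × (Fin k → ℝ) × ℝ => h p.1 p.2.1 p.2.2
  outcome_eq : ∀ ω, Y ω = outcome m D X ε ω
  selection_eq : ∀ ω, D ω = h (Z ω) (X ω) (η ω)
  smooth_m : ∀ x e, ContDiff ℝ 1 fun d => m d x e

/-- The conditions under which `controlVar` is a control variable: `(ε, η)` is independent of `Z`
given `X`; almost surely `p ↦ h(Z, X, p)` is strictly monotone, in a direction that may depend on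
the value of `X` only; and given `X = x` the distribution function of `η` is continuous, and
strictly increasing on the support. -/
structure ControlConditions {Ω 𝓔 : Type*} [MeasurableSpace Ω] [MeasurableSpace 𝓔]
    (P : Measure Ω) [IsFiniteMeasure P] {k : ℕ} (Z η : Ω → ℝ) (X : Ω → Fin k → ℝ) (ε : Ω → 𝓔)
    (h : ℝ → (Fin k → ℝ) → ℝ → ℝ) : Prop where
  indep : CondIndepGiven P (fun ω => (ε ω, η ω)) Z X
  monotone : ∃ S : Set (Fin k → ℝ), MeasurableSet S ∧ ∀ᵐ ω ∂P,
    (X ω ∈ S → StrictMono (h (Z ω) (X ω))) ∧ (X ω ∉ S → StrictAnti (h (Z ω) (X ω)))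
  cond_cdf : ∀ᵐ x ∂(P.map X), Continuous (cdf (condDistrib η X P x)) ∧
    StrictMonoOn (cdf (condDistrib η X P x)) (condDistrib η X P x).support

/-! ### The rank-preserving policy -/

/-- The policy function `π_t(d) = H_t⁻¹(F_D(d))`. -/
noncomputable def policy (F : ℝ → ℝ) (H : ℝ → ℝ → ℝ) (t d : ℝ) : ℝ := quantile (H t) (F d)

/-- The (right) derivative of `t ↦ π_t(d)` at `t = 0`. -/
noncomputable def policyDeriv (π : ℝ → ℝ → ℝ) (d : ℝ) : ℝ :=
  derivWithin (fun t => π t d) (Icc 0 1) 0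

/-- `ṁ(d, x, e) = (d/dt) m(π_t(d), x, e) at t = 0`, that is, `π̇(d) ∂_d m(d, x, e)`. -/
noncomputable def mDot {E 𝓔 : Type*} (m : ℝ → E → 𝓔 → ℝ) (π : ℝ → ℝ → ℝ) (d : ℝ) (x : E) (e : 𝓔) :
    ℝ :=
  policyDeriv π d * structDeriv m d x e

/-- The distribution function of the counterfactual outcome `Y^t = m(π_t(D), X, ε)`. -/
noncomputable def counterfactualCdf {Ω E 𝓔 : Type*} [MeasurableSpace Ω] (P : Measure Ω)
    (D : Ω → ℝ) (X : Ω → E) (ε : Ω → 𝓔) (m : ℝ → E → 𝓔 → ℝ) (π : ℝ → ℝ → ℝ) (t : ℝ) : ℝ → ℝ :=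
  cdfOf P (outcome m (fun ω => π t (D ω)) X ε)

/-- The conditions on the policy `π_t(d) = H_t⁻¹(F_D(d))`: it is the identity at `t = 0` and
differentiable in `t` at `t = 0` with a bounded derivative (at the points `d` where
`0 < F_D(d) < 1`, so that the quantile is a genuine one); the support of `D^t` is contained in the
support of `D`; every `H_t` is continuous; `D` has a density that is positive on its support. -/
structure PolicyConditions {Ω : Type*} [MeasurableSpace Ω] (P : Measure Ω) (D : Ω → ℝ)
    (H : ℝ → ℝ → ℝ) : Prop where
  at_zero : ∀ d, 0 < cdfOf P D d → cdfOf P D d < 1 → policy (cdfOf P D) H 0 d = d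
  differentiable : ∀ d, 0 < cdfOf P D d → cdfOf P D d < 1 →
    DifferentiableWithinAt ℝ (fun t => policy (cdfOf P D) H t d) (Icc 0 1) 0
  bounded : ∃ M : ℝ, ∀ d, 0 < cdfOf P D d → cdfOf P D d < 1 →
    |policyDeriv (policy (cdfOf P D) H) d| ≤ M
  supp_subset : ∀ t ∈ Icc (0 : ℝ) 1,
    suppOf P (fun ω => policy (cdfOf P D) H t (D ω)) ⊆ suppOf P D
  continuous_H : ∀ t ∈ Icc (0 : ℝ) 1, Continuous (H t)
  pos_density : ∃ fD : ℝ → ℝ, Measurable fD ∧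
    P.map D = volume.withDensity (fun d => ENNReal.ofReal (fD d)) ∧ ∀ d ∈ suppOf P D, 0 < fD d

/-! ### Regularity -/

/-- `f` is a density of `ρ`, a measure on `ℝ²`, with `f(y, y') ≤ C |g(y')|` everywhere. -/
structure IsDominatedDensity (ρ : Measure (ℝ × ℝ)) (f : ℝ → ℝ → ℝ) (g : ℝ → ℝ) (C : ℝ) : Prop where
  meas : Measurable fun p : ℝ × ℝ => f p.1 p.2
  nonneg : ∀ y z, 0 ≤ f y z
  density : ρ = volume.withDensity fun p => ENNReal.ofReal (f p.1 p.2)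
  le : ∀ y z, f y z ≤ C * |g z|

/-- An integrable function `g` with `∫ |z g(z)| dz < ∞`. -/
def IsDominating (g : ℝ → ℝ) : Prop := Integrable g ∧ Integrable fun z => z * g z

/-- Unconditional regularity: `ṁ` is measurable, `m(π_t(D), X, ε)` is linearized by `t ṁ` up to
an event of probability `o(t)`, and `(Y, ṁ(D, X, ε))` has a dominated density that is
uniformly continuous in its first argument for each value of the second. -/
structure UnconditionalRegularity {Ω 𝓔 : Type*} [MeasurableSpace Ω] [MeasurableSpace 𝓔]
    (P : Measure Ω) {k : ℕ} (Y D : Ω → ℝ) (X : Ω → Fin k → ℝ) (ε : Ω → 𝓔)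
    (m : ℝ → (Fin k → ℝ) → 𝓔 → ℝ) (π : ℝ → ℝ → ℝ) : Prop where
  meas_mDot : Measurable fun p : ℝ × (Fin k → ℝ) × 𝓔 => mDot m π p.1 p.2.1 p.2.2
  linearization : ∀ ν : ℝ, 0 < ν →
    (fun t : ℝ => P.real {ω | ν * t ≤
      |m (π t (D ω)) (X ω) (ε ω) - m (D ω) (X ω) (ε ω) - t * mDot m π (D ω) (X ω) (ε ω)|})
        =o[𝓝[>] 0] fun t => t
  density : ∃ (f : ℝ → ℝ → ℝ) (g : ℝ → ℝ) (C : ℝ), 0 < C ∧ IsDominating g ∧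
    IsDominatedDensity (P.map fun ω => (Y ω, mDot m π (D ω) (X ω) (ε ω))) f g C ∧
    ∀ z, UniformContinuous fun y => f y z

/-- `F_{Y|D,V,X}(y | d, v, x)`, where `κ (d, v, x)` is the law of `ε` given
`(D, V, X) = (d, v, x)`, and `Y = m(d, x, ε)` on this event. -/
noncomputable def condCdf {𝓔 : Type*} [MeasurableSpace 𝓔] {k : ℕ}
    (κ : Kernel (ℝ × ℝ × (Fin k → ℝ)) 𝓔) (m : ℝ → (Fin k → ℝ) → 𝓔 → ℝ)
    (d v : ℝ) (x : Fin k → ℝ) (y : ℝ) : ℝ :=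
  (κ (d, v, x)).real {e | m d x e ≤ y}

/-- Regularity of the conditional law `κ` of `ε` given `(D, V, X)`, at all points of
`supp D × supp V × supp X`: the conditional distribution function of `Y` is continuously
differentiable in `d`; the linearization of `m` in `d` holds up to an event of conditional
probability `o(δ)`; and the conditional law of `(Y, ∂_d m(d, x, ε))` has a density that is
continuous in its first argument, with one dominating function for all these points. -/
structure ConditionalRegularity {Ω 𝓔 : Type*} [MeasurableSpace Ω] [MeasurableSpace 𝓔]
    (P : Measure Ω) {k : ℕ} (D V : Ω → ℝ) (X : Ω → Fin k → ℝ)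
    (m : ℝ → (Fin k → ℝ) → 𝓔 → ℝ) (κ : Kernel (ℝ × ℝ × (Fin k → ℝ)) 𝓔) : Prop where
  smooth : ∀ v ∈ suppOf P V, ∀ x ∈ suppOf P X, ∀ y,
    ContDiffOn ℝ 1 (fun d => condCdf κ m d v x y) (suppOf P D)
  linearization : ∀ d ∈ suppOf P D, ∀ v ∈ suppOf P V, ∀ x ∈ suppOf P X, ∀ ν : ℝ, 0 < ν →
    (fun δ : ℝ => (κ (d, v, x)).real {e | ν * δ ≤
      |m (d + δ) x e - m d x e - δ * structDeriv m d x e|}) =o[𝓝[>] 0] fun δ => δ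
  density : ∃ (g : ℝ → ℝ) (C : ℝ), IsDominating g ∧
    ∀ d ∈ suppOf P D, ∀ v ∈ suppOf P V, ∀ x ∈ suppOf P X, ∃ f : ℝ → ℝ → ℝ,
      IsDominatedDensity ((κ (d, v, x)).map fun e => (m d x e, structDeriv m d x e)) f g C ∧
      ∀ z, Continuous fun y => f y z

/-- `∂_d F_{Y|D,V,X}(y | d, v, x)`, the derivative being taken within the support of `D`. -/
noncomputable def condCdfDeriv {𝓔 : Type*} [MeasurableSpace 𝓔] {k : ℕ} (SD : Set ℝ)
    (κ : Kernel (ℝ × ℝ × (Fin k → ℝ)) 𝓔) (m : ℝ → (Fin k → ℝ) → 𝓔 → ℝ)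
    (d v : ℝ) (x : Fin k → ℝ) (y : ℝ) : ℝ :=
  derivWithin (fun s => condCdf κ m s v x y) SD d

/-! ### Functionals of distribution functions -/

/-- The space of bounded continuous functions, as a subspace of the functions on `ℝ`. -/
def boundedContinuous : Submodule ℝ (ℝ → ℝ) where
  carrier := {f | Continuous f ∧ ∃ M : ℝ, ∀ y, |f y| ≤ M}
  zero_mem' := ⟨continuous_const, 0, fun y => by simp⟩
  add_mem' := by
    rintro f g ⟨hf, M, hM⟩ ⟨hg, N, hN⟩
    exact ⟨hf.add hg, M + N, fun y => (abs_add_le _ _).trans (add_le_add (hM y) (hN y))⟩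
  smul_mem' := by
    rintro c f ⟨hf, M, hM⟩
    refine ⟨hf.const_smul c, |c| * M, fun y => ?_⟩
    simpa [abs_mul] using mul_le_mul_of_nonneg_left (hM y) (abs_nonneg c)

/-- `Γ`, with domain `𝓓`, is Hadamard-differentiable at `F`, in the space of bounded functions on
`ℝ` with the supremum norm, tangentially to the space `D₀` of bounded functions, with derivative
`dΓ`. Only the values of `Γ` on `𝓓` and of `dΓ` on `D₀` matter. -/
structure HasHadamardDerivAt {B : Type*} [NormedAddCommGroup B] [NormedSpace ℝ B]
    (Γ : (ℝ → ℝ) → B) (𝓓 : Set (ℝ → ℝ)) (F : ℝ → ℝ) (D₀ : Submodule ℝ (ℝ → ℝ))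
    (dΓ : (ℝ → ℝ) → B) : Prop where
  map_add : ∀ f ∈ D₀, ∀ g ∈ D₀, dΓ (f + g) = dΓ f + dΓ g
  map_smul : ∀ (a : ℝ), ∀ f ∈ D₀, dΓ (a • f) = a • dΓ f
  continuous : ∃ L : ℝ, ∀ f ∈ D₀, ∀ M : ℝ, (∀ y, |f y| ≤ M) → ‖dΓ f‖ ≤ L * M
  tendsto : ∀ (h : ℝ → ℝ) (t : ℕ → ℝ) (hn : ℕ → ℝ → ℝ), h ∈ D₀ →
    (∀ n, 0 < t n) → Tendsto t atTop (𝓝 0) →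
    (∀ n, ∃ M : ℝ, ∀ y, |hn n y| ≤ M) → TendstoUniformly hn h atTop →
    (∀ n, F + t n • hn n ∈ 𝓓) →
    Tendsto (fun n => (t n)⁻¹ • (Γ (F + t n • hn n) - Γ F)) atTop (𝓝 (dΓ h))

/-- `θ` is the marginal policy effect `lim_{t ↓ 0} (Γ(F_t) - Γ(F)) / t`. -/
def IsMarginalPolicyEffect {B : Type*} [NormedAddCommGroup B] [NormedSpace ℝ B]
    (Γ : (ℝ → ℝ) → B) (F : ℝ → ℝ) (Ft : ℝ → ℝ → ℝ) (θ : B) : Prop :=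
  Tendsto (fun t : ℝ => t⁻¹ • (Γ (Ft t) - Γ F)) (𝓝[>] 0) (𝓝 θ)

/-! ### Stieltjes integrals and copulas -/

/-- `A` is the distribution function of the finite signed measure `ν`: integration against
`dA(d, v, x)` means integration against `ν`, which is determined by `A`. -/
def IsDistributionFunction {k : ℕ} (A : ℝ → ℝ → (Fin k → ℝ) → ℝ)
    (ν : SignedMeasure (ℝ × ℝ × (Fin k → ℝ))) : Prop :=
  ∀ d v x, ν (Iic d ×ˢ Iic v ×ˢ Iic x) = A d v x

/-- The Stieltjes integral of `Φ` against the signed measure `ν` converges and equals `θ`. -/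
def HasIntegral {k : ℕ} {B : Type*} [NormedAddCommGroup B] [NormedSpace ℝ B]
    (Φ : ℝ → ℝ → (Fin k → ℝ) → B) (ν : SignedMeasure (ℝ × ℝ × (Fin k → ℝ))) (θ : B) : Prop :=
  VectorMeasure.Integrable ν (fun p => Φ p.1 p.2.1 p.2.2) ∧
    ∫ᵛ p, Φ p.1 p.2.1 p.2.2 ∂<•ν = θ

/-- The integrator `F_{V,X|D}(v, x | d) (G_D(d) - F_D(d))`, where `K d` is the law of `(V, X)`
given `D = d`. -/
noncomputable def marginalIntegrator {k : ℕ} (K : Kernel ℝ (ℝ × (Fin k → ℝ))) (F G : ℝ → ℝ)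
    (d v : ℝ) (x : Fin k → ℝ) : ℝ :=
  (K d).real (Iic v ×ˢ Iic x) * (G d - F d)

/-- `C : [0,1]^(2+k) → [0,1]` is a copula: on the unit cube it is the distribution function of a
probability measure all of whose one-dimensional marginals are uniform on `[0,1]`. -/
def IsCopula {k : ℕ} (C : ℝ → ℝ → (Fin k → ℝ) → ℝ) : Prop :=
  ∃ Q : Measure (ℝ × ℝ × (Fin k → ℝ)), IsProbabilityMeasure Q ∧
    Q.map (fun p => p.1) = volume.restrict (Icc 0 1) ∧
    Q.map (fun p => p.2.1) = volume.restrict (Icc 0 1) ∧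
    (∀ j, Q.map (fun p => p.2.2 j) = volume.restrict (Icc 0 1)) ∧
    ∀ u ∈ Icc (0 : ℝ) 1, ∀ v ∈ Icc (0 : ℝ) 1, ∀ w : Fin k → ℝ, (∀ j, w j ∈ Icc (0 : ℝ) 1) →
      C u v w = Q.real (Iic u ×ˢ Iic v ×ˢ Iic w)

/-- `C(F_W(d), F_V(v), F_X(x)) = P[W ≤ d, V ≤ v, X ≤ x]`, with `F_W` given as `FW` and with
`F_X(x)` the vector of the marginal distribution functions of `X`. -/
def IsCopulaOf {Ω : Type*} [MeasurableSpace Ω] (P : Measure Ω) {k : ℕ}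
    (C : ℝ → ℝ → (Fin k → ℝ) → ℝ) (FW : ℝ → ℝ) (W V : Ω → ℝ) (X : Ω → Fin k → ℝ) : Prop :=
  ∀ d v x, C (FW d) (cdfOf P V v) (fun j => cdfOf P (fun ω => X ω j) (x j)) =
    P.real {ω | W ω ≤ d ∧ V ω ≤ v ∧ X ω ≤ x}

/-- `C` is partially differentiable with respect to its first component. -/
def PartiallyDifferentiable {k : ℕ} (C : ℝ → ℝ → (Fin k → ℝ) → ℝ) : Prop :=
  ∀ u ∈ Ioo (0 : ℝ) 1, ∀ v ∈ Icc (0 : ℝ) 1, ∀ w : Fin k → ℝ, (∀ j, w j ∈ Icc (0 : ℝ) 1) →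
    DifferentiableAt ℝ (fun s => C s v w) u

/-- The path `t ↦ C(H_t(d), F_V(v), F_X(x))`. -/
noncomputable def copulaPath {Ω : Type*} [MeasurableSpace Ω] (P : Measure Ω) {k : ℕ}
    (C : ℝ → ℝ → (Fin k → ℝ) → ℝ) (H : ℝ → ℝ → ℝ) (V : Ω → ℝ) (X : Ω → Fin k → ℝ)
    (d v : ℝ) (x : Fin k → ℝ) (t : ℝ) : ℝ :=
  C (H t d) (cdfOf P V v) (fun j => cdfOf P (fun ω => X ω j) (x j))

/-- The integrator `∂_t C(H_t(d), F_V(v), F_X(x))` at `t = 0`. -/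
noncomputable def copulaIntegrator {Ω : Type*} [MeasurableSpace Ω] (P : Measure Ω) {k : ℕ}
    (C : ℝ → ℝ → (Fin k → ℝ) → ℝ) (H : ℝ → ℝ → ℝ) (V : Ω → ℝ) (X : Ω → Fin k → ℝ)
    (d v : ℝ) (x : Fin k → ℝ) : ℝ :=
  derivWithin (copulaPath P C H V X d v x) (Icc 0 1) 0

end PolicyEffect

/-! Along the policy the outcome is Y + t ṁ up to errors that are negligible outside an event of
probability o(t). With a dominated density for (Y, ṁ), the quotients (F_{Y^t} - F_Y) / t therefore
converge, uniformly in y, to -∫ z f(y, z) dz (`tendsto_cdf_quotient`). Hadamard differentiability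
then gives θ = Γ'(-∫ z f(·, z) dz) (`isMarginalPolicyEffect_density`). The rest of the proof
expresses this function through F_{Y|D,V,X}.

Given X, the rank V determines η up to null events, and ε is independent of Z given (X, η). Hence
the law of ε given (D, V, X) does not depend on D (`exists_kernel_control`). For the fixed version κ
this holds only almost everywhere; absolute continuity in d ensures that κ returns to its value at
(d, v, x) at points d + δ with δ ↓ 0 (`ae_frequently_kernel_eq`). Along such δ the increments of
F_{Y|D,V,X} in d are those of a linearized path under one fixed measure, so ∂_d F_{Y|D,V,X} = -∫ z
f_{d,v,x}(y, z) dz (`condCdfDeriv_eq`). Both this integral and the unconditional one are limits of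
averages over thin strips y < Y ≤ y + r, and such averages disintegrate over (D, V, X). Consequently
-∫ z f(y, z) dz = E[π̇(D) ∂_d F_{Y|D,V,X}(y | D, V, X)] (`integral_condCdfDeriv`). For the location
shift π̇ = 1, which is claim (ii).

In claim (i), differentiating H_t(π_t(d)) = F_D(d) gives π̇ = (F_D - G_D) / f_D
(`policyDeriv_perturbation`). The Stieltjes formula is then an integration by parts in d: the Jordan
parts of the signed measure differ, on almost every slice (-∞, d] × ·, by (G_D - F_D)(d) times the
law of (V, X) given D = d, and Fubini moves the derivative onto F_{Y|D,V,X}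
(`HasLowerSlices.integral_sub_integral_eq`). No boundary term survives, because G_D - F_D vanishes
at infinity. To take Γ' out of the integral, conditional distribution functions are extended to [-∞,
∞], whose space of continuous functions is separable (`HasHadamardDerivAt.integral_sub_integral`).

For the copula, the chain rule for C(F_D(d), ·, ·) = P[D ≤ d, ·, ·] identifies ∂_1 C with F_{V,X|D}
at almost every d (`ae_copulaIntegrator_eq`), which is enough for the integral formula. If the
marginal integrator is a distribution function, its right continuity upgrades the identity to every
d (`copulaIntegrator_eq_marginalIntegrator`). -/

namespace PolicyEffect

/-! ### Half-plane probabilities under a dominated density -/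

section Density

variable {ρ : Measure (ℝ × ℝ)} {f : ℝ → ℝ → ℝ} {g : ℝ → ℝ} {C : ℝ}

namespace IsDominatedDensity

lemma measurable_left (hf : IsDominatedDensity ρ f g C) (z : ℝ) : Measurable fun y => f y z :=
  hf.meas.comp (measurable_id.prodMk measurable_const)

lemma measurable_right (hf : IsDominatedDensity ρ f g C) (y : ℝ) : Measurable fun z => f y z :=
  hf.meas.comp (measurable_const.prodMk measurable_id)

lemma abs_le (hf : IsDominatedDensity ρ f g C) (y z : ℝ) : |f y z| ≤ |C| * |g z| := by
  rw [abs_of_nonneg (hf.nonneg y z)]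
  exact (hf.le y z).trans (mul_le_mul_of_nonneg_right (le_abs_self C) (abs_nonneg _))

lemma integrable_mul (hf : IsDominatedDensity ρ f g C) {b : ℝ → ℝ} (hb : Measurable b)
    (hbg : Integrable fun z => b z * g z) (y : ℝ) : Integrable fun z => b z * f y z := by
  refine (hbg.norm.const_mul |C|).mono' (hb.mul (hf.measurable_right y)).aestronglyMeasurable
    (Eventually.of_forall fun z => ?_)
  have := mul_le_mul_of_nonneg_left (hf.abs_le y z) (abs_nonneg (b z))
  simp only [Real.norm_eq_abs, abs_mul] at *
  linarith

lemma abs_integral_mul_le (hf : IsDominatedDensity ρ f g C) {b : ℝ → ℝ}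
    (hbg : Integrable fun z => b z * g z) (y : ℝ) :
    |∫ z, b z * f y z| ≤ |C| * ∫ z, |b z * g z| := by
  rw [← integral_const_mul, ← Real.norm_eq_abs]
  refine norm_integral_le_of_norm_le (hbg.norm.const_mul |C|) (Eventually.of_forall fun z => ?_)
  have := mul_le_mul_of_nonneg_left (hf.abs_le y z) (abs_nonneg (b z))
  simp only [Real.norm_eq_abs, abs_mul] at *
  linarith

lemma continuous_integral_mul (hf : IsDominatedDensity ρ f g C)
    (hc : ∀ z, Continuous fun y => f y z) {b : ℝ → ℝ} (hb : Measurable b)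
    (hbg : Integrable fun z => b z * g z) : Continuous fun y => ∫ z, b z * f y z := by
  refine continuous_of_dominated (bound := fun z => |C| * |b z * g z|)
    (fun y => (hb.mul (hf.measurable_right y)).aestronglyMeasurable)
    (fun y => Eventually.of_forall fun z => ?_) (hbg.norm.const_mul |C|)
    (Eventually.of_forall fun z => continuous_const.mul (hc z))
  have := mul_le_mul_of_nonneg_left (hf.abs_le y z) (abs_nonneg (b z))
  simp only [Real.norm_eq_abs, abs_mul] at *
  linarith

lemma integrable [IsFiniteMeasure ρ] (hf : IsDominatedDensity ρ f g C) :
    Integrable (fun p : ℝ × ℝ => f p.1 p.2) := by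
  refine ⟨hf.meas.aestronglyMeasurable, ?_⟩
  rw [hasFiniteIntegral_iff_ofReal (Eventually.of_forall fun p => hf.nonneg _ _)]
  have h := measure_lt_top ρ univ
  rwa [hf.density, withDensity_apply _ MeasurableSet.univ, setLIntegral_univ] at h

lemma integrable_iff (hf : IsDominatedDensity ρ f g C) {φ : ℝ × ℝ → ℝ} :
    Integrable φ ρ ↔ Integrable fun p => f p.1 p.2 * φ p := by
  rw [hf.density, integrable_withDensity_iff_integrable_smul' hf.meas.ennreal_ofReal
    (Eventually.of_forall fun p => ENNReal.ofReal_lt_top)]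
  simp [ENNReal.toReal_ofReal, hf.nonneg]

lemma integral_eq (hf : IsDominatedDensity ρ f g C) (φ : ℝ × ℝ → ℝ) :
    ∫ p, φ p ∂ρ = ∫ p : ℝ × ℝ, f p.1 p.2 * φ p := by
  rw [hf.density, integral_withDensity_eq_integral_toReal_smul hf.meas.ennreal_ofReal
    (Eventually.of_forall fun p => ENNReal.ofReal_lt_top)]
  simp [ENNReal.toReal_ofReal, hf.nonneg]

/-- The probability of the half-plane `{u + t z ≤ c}`. -/
lemma measureReal_halfPlane [IsFiniteMeasure ρ] (hf : IsDominatedDensity ρ f g C) (t c : ℝ) :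
    Integrable (fun z => ∫ u in Iic (c - t * z), f u z) ∧
    ρ.real {p | p.1 + t * p.2 ≤ c} = ∫ z, ∫ u in Iic (c - t * z), f u z := by
  have hS : MeasurableSet {p : ℝ × ℝ | p.1 + t * p.2 ≤ c} :=
    measurableSet_le (by fun_prop) measurable_const
  have h1 : ρ.real {p | p.1 + t * p.2 ≤ c}
      = ∫ p : ℝ × ℝ, {p : ℝ × ℝ | p.1 + t * p.2 ≤ c}.indicator (fun p => f p.1 p.2) p := by
    rw [← integral_indicator_one hS, hf.integral_eq]
    refine integral_congr_ae (Eventually.of_forall fun p => ?_)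
    by_cases hp : p.1 + t * p.2 ≤ c <;> simp [indicator, hp]
  have h2 := hf.integrable.indicator hS
  have h3 : ∀ z, (∫ u, {p : ℝ × ℝ | p.1 + t * p.2 ≤ c}.indicator (fun p => f p.1 p.2) (u, z))
      = ∫ u in Iic (c - t * z), f u z := by
    intro z
    rw [← integral_indicator measurableSet_Iic]
    refine integral_congr_ae (Eventually.of_forall fun u => ?_)
    by_cases hp : u + t * z ≤ c
    · have : u ≤ c - t * z := by linarith
      simp [indicator, hp, this]
    · have : ¬ u ≤ c - t * z := by intro; apply hp; linarith
      simp [indicator, hp, this]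
  rw [Measure.volume_eq_prod] at h1 h2
  have h4 := h2.integral_prod_right
  simp only [h3] at h4
  refine ⟨h4, ?_⟩
  rw [h1, integral_prod_symm _ h2]
  simp only [h3]

lemma measureReal_halfPlane_sub [IsFiniteMeasure ρ] (hf : IsDominatedDensity ρ f g C)
    (t c c' : ℝ) :
    ρ.real {p | p.1 + t * p.2 ≤ c'} - ρ.real {p | p.1 ≤ c} = ∫ z, ∫ u in c..(c' - t * z), f u z := by
  have h0 := hf.measureReal_halfPlane 0 c
  have h1 := hf.measureReal_halfPlane t c'
  simp only [zero_mul, add_zero, sub_zero] at h0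
  rw [h0.2, h1.2, ← integral_sub h1.1 h0.1]
  have h2 := hf.integrable
  rw [Measure.volume_eq_prod] at h2
  refine integral_congr_ae ?_
  filter_upwards [h2.prod_left_ae] with z hz
  exact intervalIntegral.integral_Iic_sub_Iic hz.integrableOn hz.integrableOn

/-- Rescaling to the unit interval pulls out the factor `t` that the difference quotient divides by.
The remaining average is bounded by |C| |g z| whatever `t` is. -/
lemma interval_eq_avg (y t b z : ℝ) :
    ∫ u in y..(y + t * b), f u z = (t * b) * ∫ s in (0 : ℝ)..1, f (y + (t * b) * s) z := by
  have := intervalIntegral.mul_integral_comp_add_mul (a := 0) (b := 1) (t * b) y (f := fun u => f u z)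
  rw [this]; simp

lemma stronglyMeasurable_avg (hf : IsDominatedDensity ρ f g C) {b : ℝ → ℝ} (hb : Measurable b)
    (y : ℝ) : StronglyMeasurable fun z => ∫ s in (0 : ℝ)..1, f (y + b z * s) z := by
  simp_rw [intervalIntegral.integral_of_le zero_le_one]
  refine StronglyMeasurable.integral_prod_right' (ν := volume.restrict (Ioc (0 : ℝ) 1))
    (f := fun p : ℝ × ℝ => f (y + b p.1 * p.2) p.1) ?_
  exact (hf.meas.comp (f := fun p : ℝ × ℝ => (y + b p.1 * p.2, p.1)) (by fun_prop)).stronglyMeasurable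

lemma abs_avg_le (hf : IsDominatedDensity ρ f g C) (y b z : ℝ) :
    |∫ s in (0 : ℝ)..1, f (y + b * s) z| ≤ |C| * |g z| := by
  have := intervalIntegral.norm_integral_le_of_norm_le_const (a := 0) (b := 1)
    (f := fun s => f (y + b * s) z) (C := |C| * |g z|) (fun s _ => by simpa using hf.abs_le _ _)
  simpa using this

/-- Averages over short intervals converge, integrated against a weight. -/
lemma tendsto_integral_avg (hf : IsDominatedDensity ρ f g C) {ι : Type*} {l : Filter ι}
    [l.IsCountablyGenerated] {y t : ι → ℝ} (ht : Tendsto t l (𝓝 0))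
    (hc : ∀ z, Tendsto (fun q : ℝ × ι => f (y q.2 + q.1) z - f (y q.2) z) (𝓝 0 ×ˢ l) (𝓝 0))
    {a b : ℝ → ℝ} (ha : Measurable a) (hb : Measurable b)
    (hag : Integrable fun z => a z * g z) :
    Tendsto (fun i => (∫ z, a z * ∫ s in (0 : ℝ)..1, f (y i + (t i * b z) * s) z)
      - ∫ z, a z * f (y i) z) l (𝓝 0) := by
  have hmeas : ∀ i, StronglyMeasurable
      fun z => ∫ s in (0 : ℝ)..1, f (y i + (t i * b z) * s) z := fun i =>
    hf.stronglyMeasurable_avg (hb.const_mul (t i)) (y i)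
  have hint : ∀ i, Integrable fun z => a z * ∫ s in (0 : ℝ)..1, f (y i + (t i * b z) * s) z := by
    intro i
    refine (hag.norm.const_mul |C|).mono'
      (ha.stronglyMeasurable.mul (hmeas i)).aestronglyMeasurable (Eventually.of_forall fun z => ?_)
    have := mul_le_mul_of_nonneg_left (hf.abs_avg_le (y i) (t i * b z) z) (abs_nonneg (a z))
    simp only [Real.norm_eq_abs, abs_mul] at *
    linarith
  have heq : ∀ i, (∫ z, a z * ∫ s in (0 : ℝ)..1, f (y i + (t i * b z) * s) z)
      - ∫ z, a z * f (y i) z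
      = ∫ z, a z * ((∫ s in (0 : ℝ)..1, f (y i + (t i * b z) * s) z) - f (y i) z) := by
    intro i
    rw [← integral_sub (hint i) (hf.integrable_mul ha hag (y i))]
    simp only [mul_sub]
  simp only [heq]
  suffices h : Tendsto (fun i => ∫ z, a z * ((∫ s in (0 : ℝ)..1,
      f (y i + (t i * b z) * s) z) - f (y i) z)) l (𝓝 (∫ _ : ℝ, (0 : ℝ))) by simpa using h
  -- The average and the value at `y i` are each at most |C| |g z|, hence the factor 2.
  refine tendsto_integral_filter_of_dominated_convergence (fun z => 2 * |C| * |a z * g z|)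
    (Eventually.of_forall fun i => (ha.stronglyMeasurable.mul ((hmeas i).sub
      (hf.measurable_right _).stronglyMeasurable)).aestronglyMeasurable)
    (Eventually.of_forall fun i => Eventually.of_forall fun z => ?_)
    (hag.norm.const_mul _) (Eventually.of_forall fun z => ?_)
  · have h1 := hf.abs_avg_le (y i) (t i * b z) z
    have h2 := hf.abs_le (y i) z
    have h3 := (abs_sub _ _).trans (add_le_add h1 h2)
    have := mul_le_mul_of_nonneg_left h3 (abs_nonneg (a z))
    simp only [Real.norm_eq_abs, abs_mul] at *
    linarith
  · suffices h : Tendsto (fun i => (∫ s in (0 : ℝ)..1,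
        f (y i + (t i * b z) * s) z) - f (y i) z) l (𝓝 0) by simpa using h.const_mul (a z)
    rw [Metric.tendsto_nhds]
    intro ε hε
    have h1 := (Metric.tendsto_nhds.1 (hc z)) (ε / 2) (half_pos hε)
    obtain ⟨pa, hpa, pb, hpb, hab⟩ := eventually_prod_iff.1 h1
    obtain ⟨δ, hδ, hball⟩ := Metric.eventually_nhds_iff.1 hpa
    have htb : Tendsto (fun i => t i * b z) l (𝓝 0) := by simpa using ht.mul_const (b z)
    filter_upwards [hpb, (Metric.tendsto_nhds.1 htb) δ hδ] with i hi hti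
    have hsub : (∫ s in (0 : ℝ)..1, f (y i + (t i * b z) * s) z) - f (y i) z
        = ∫ s in (0 : ℝ)..1, (f (y i + (t i * b z) * s) z - f (y i) z) := by
      rw [intervalIntegral.integral_sub _ (by simp)]
      · simp
      · refine (intervalIntegrable_const (c := |C| * |g z|)).mono_fun'
          ((hf.measurable_left z).comp (by fun_prop)).aestronglyMeasurable
          (Eventually.of_forall fun u => ?_)
        simpa using hf.abs_le _ z
    rw [hsub, dist_zero_right]
    have hb := intervalIntegral.norm_integral_le_of_norm_le_const (a := 0) (b := 1)
      (f := fun s => f (y i + (t i * b z) * s) z - f (y i) z) (C := ε / 2) (fun s hs => ?_)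
    · simp only [sub_zero, abs_one, mul_one] at hb
      linarith
    · rw [uIoc_of_le zero_le_one] at hs
      have hs' : dist (t i * b z * s) 0 < δ := by
        rw [dist_zero_right, norm_mul] at *
        have : ‖s‖ ≤ 1 := by rw [Real.norm_eq_abs, abs_of_pos hs.1]; exact hs.2
        calc _ ≤ ‖t i * b z‖ * 1 := mul_le_mul_of_nonneg_left this (norm_nonneg _)
          _ < δ := by simpa using hti
      have := hab (hball hs') hi
      simp only [dist_zero_right] at this
      exact this.le

end IsDominatedDensity

/-! ### Difference quotients of distribution functions along a linearized path -/

section Linearization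

variable {Ω : Type*} [MeasurableSpace Ω] {μ : Measure Ω} [IsFiniteMeasure μ] {U M : Ω → ℝ}

/-- Difference quotients of the distribution functions of a linearized path `U_t`, with
`U_t = U + t M + o(t)`. -/
lemma tendsto_cdf_quotient (hU : Measurable U) (hM : Measurable M)
    (hf : IsDominatedDensity (μ.map fun ω => (U ω, M ω)) f g C) (hg : IsDominating g)
    {Ut : ℝ → Ω → ℝ}
    (hlin : ∀ ν : ℝ, 0 < ν →
      (fun t : ℝ => μ.real {ω | ν * t ≤ |Ut t ω - U ω - t * M ω|}) =o[𝓝[>] 0] fun t => t)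
    {l : Filter ℝ} [l.IsCountablyGenerated]
    (hc : ∀ z, Tendsto (fun q : ℝ × ℝ => f (q.2 + q.1) z - f q.2 z) (𝓝 0 ×ˢ l) (𝓝 0)) :
    Tendsto (fun q : ℝ × ℝ => q.1⁻¹ * (μ.real {ω | Ut q.1 ω ≤ q.2} - μ.real {ω | U ω ≤ q.2})
      + ∫ z, z * f q.2 z) (𝓝[>] 0 ×ˢ l) (𝓝 0) := by
  set ρ := μ.map fun ω => (U ω, M ω) with hρ
  have hUM : Measurable fun ω => (U ω, M ω) := hU.prodMk hM
  have hmap : ∀ t c, μ.real {ω | U ω + t * M ω ≤ c} = ρ.real {p | p.1 + t * p.2 ≤ c} := by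
    intro t c
    rw [hρ, map_measureReal_apply hUM (measurableSet_le (by fun_prop) measurable_const)]
    rfl
  have hmap0 : ∀ c, μ.real {ω | U ω ≤ c} = ρ.real {p | p.1 ≤ c} := by
    intro c
    rw [hρ, map_measureReal_apply hUM (measurableSet_le (by fun_prop) measurable_const)]
    rfl
  have hg1 : ∀ a : ℝ, Integrable fun z => (a - z) * g z := by
    intro a
    simp only [sub_mul]
    exact (hg.1.const_mul a).sub hg.2
  -- A threshold moved by `t * a` changes the weight from -z to a - z. The values a = ±ν sandwich
  -- the true path between two linear ones.
  have hquot : ∀ a t y : ℝ, 0 < t →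
      t⁻¹ * (μ.real {ω | U ω + t * M ω ≤ y + t * a} - μ.real {ω | U ω ≤ y})
        = ∫ z, (a - z) * ∫ s in (0 : ℝ)..1, f (y + (t * (a - z)) * s) z := by
    intro a t y ht
    rw [hmap, hmap0, hf.measureReal_halfPlane_sub, ← integral_const_mul]
    refine integral_congr_ae (Eventually.of_forall fun z => ?_)
    have := IsDominatedDensity.interval_eq_avg (f := f) y t (a - z) z
    simp only
    rw [show y + t * a - t * z = y + t * (a - z) by ring, this]
    field_simp
  have hT : ∀ a : ℝ, Tendsto (fun q : ℝ × ℝ =>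
      (∫ z, (a - z) * ∫ s in (0 : ℝ)..1, f (q.2 + (q.1 * (a - z)) * s) z)
        - ∫ z, (a - z) * f q.2 z) (𝓝[>] 0 ×ˢ l) (𝓝 0) := by
    intro a
    refine hf.tendsto_integral_avg (y := Prod.snd) (t := Prod.fst)
      (tendsto_fst.mono_right nhdsWithin_le_nhds) (fun z => ?_) (by fun_prop) (by fun_prop) (hg1 a)
    have h2 : Tendsto (fun q : ℝ × (ℝ × ℝ) => (q.1, q.2.2)) (𝓝 0 ×ˢ (𝓝[>] 0 ×ˢ l)) (𝓝 0 ×ˢ l) :=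
      tendsto_fst.prodMk (tendsto_snd.comp tendsto_snd)
    exact (hc z).comp h2
  have hsplit : ∀ a y : ℝ, ∫ z, (a - z) * f y z = a * (∫ z, f y z) - ∫ z, z * f y z := by
    intro a y
    have i1 : Integrable fun z => a * f y z :=
      hf.integrable_mul measurable_const (hg.1.const_mul a) y
    have i2 : Integrable fun z => z * f y z := hf.integrable_mul measurable_id hg.2 y
    rw [← integral_const_mul, ← integral_sub i1 i2]
    simp only [sub_mul]
  set A : ℝ := |C| * (∫ z, |g z|) with hA
  have hA0 : 0 ≤ A := mul_nonneg (abs_nonneg _) (integral_nonneg fun z => abs_nonneg _)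
  have hfA : ∀ y, |∫ z, f y z| ≤ A := by
    intro y
    have := hf.abs_integral_mul_le (b := fun _ => 1) (by simpa using hg.1) y
    simpa using this
  rw [Metric.tendsto_nhds]
  intro ε hε
  -- Moving the threshold by ν t changes the limit by ν ∫ f ≤ ν A ≤ ε/4. Together with ε/4 for the
  -- linear quotient and ε/4 for the bad event this stays below ε; the `+ 1` covers A = 0.
  set ν : ℝ := ε / (4 * (A + 1)) with hν
  have hν0 : 0 < ν := by positivity
  have hνA : ν * A ≤ ε / 4 := by
    rw [hν, div_mul_eq_mul_div, div_le_div_iff₀ (by positivity) (by positivity)]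
    nlinarith
  have hbad := (hlin ν hν0).def (by positivity : 0 < ε / 4)
  have hbad' := hbad.and self_mem_nhdsWithin
  have e1 := (Metric.tendsto_nhds.1 (hT ν)) (ε / 4) (by positivity)
  have e2 := (Metric.tendsto_nhds.1 (hT (-ν))) (ε / 4) (by positivity)
  filter_upwards [e1, e2, hbad'.prod_inl l] with q h1 h2 h3
  obtain ⟨t, y⟩ := q
  obtain ⟨h3, ht⟩ := h3
  have ht : 0 < t := ht
  simp only at h1 h2 h3 ⊢
  rw [← hquot _ t y ht, dist_zero_right, Real.norm_eq_abs, abs_lt, hsplit] at h1 h2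
  rw [Real.norm_of_nonneg measureReal_nonneg, Real.norm_of_nonneg ht.le] at h3
  set Bad := {ω | ν * t ≤ |Ut t ω - U ω - t * M ω|} with hBad
  have up : μ.real {ω | Ut t ω ≤ y} ≤ μ.real {ω | U ω + t * M ω ≤ y + t * ν} + μ.real Bad := by
    refine (measureReal_mono ?_).trans (measureReal_union_le _ _)
    intro ω hω
    by_cases hb : ω ∈ Bad
    · exact Or.inr hb
    · left
      have hb' : |Ut t ω - U ω - t * M ω| < ν * t := not_le.1 hb
      have hω' : Ut t ω ≤ y := hω
      have := (abs_lt.1 hb').1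
      show U ω + t * M ω ≤ y + t * ν
      linarith
  have lo : μ.real {ω | U ω + t * M ω ≤ y + t * -ν} ≤ μ.real {ω | Ut t ω ≤ y} + μ.real Bad := by
    refine (measureReal_mono ?_).trans (measureReal_union_le _ _)
    intro ω hω
    by_cases hb : ω ∈ Bad
    · exact Or.inr hb
    · left
      have hb' : |Ut t ω - U ω - t * M ω| < ν * t := not_le.1 hb
      have hω' : U ω + t * M ω ≤ y + t * -ν := hω
      have := (abs_lt.1 hb').2
      show Ut t ω ≤ y
      linarith
  have hti : 0 < t⁻¹ := inv_pos.2 ht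
  have up' := mul_le_mul_of_nonneg_left up hti.le
  have lo' := mul_le_mul_of_nonneg_left lo hti.le
  have h3' : t⁻¹ * μ.real Bad ≤ ε / 4 := by
    have := mul_le_mul_of_nonneg_left h3 hti.le
    calc _ ≤ _ := this
      _ = ε / 4 := by field_simp
  have hm1 : ν * ∫ z, f y z ≤ ε / 4 :=
    (mul_le_mul_of_nonneg_left ((le_abs_self _).trans (hfA y)) hν0.le).trans hνA
  have hm2 : -(ν * ∫ z, f y z) ≤ ε / 4 := by
    rw [← mul_neg]
    exact (mul_le_mul_of_nonneg_left ((neg_le_abs _).trans (hfA y)) hν0.le).trans hνA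
  rw [dist_zero_right, Real.norm_eq_abs, abs_lt]
  simp only [mul_add, mul_sub] at *
  constructor <;> nlinarith [h1.1, h1.2, h2.1, h2.2]

end Linearization

/-! ### Averages over thin strips -/

section Strip

variable {Ω : Type*} [MeasurableSpace Ω] {μ : Measure Ω} {U M : Ω → ℝ}

/-- The number ∫ z f(y, z) dz depends on a density and cannot be conditioned directly, whereas an
average of `M` over y < U ≤ y + r is an ordinary expectation and can. The formula links the two
through Fubini. -/
lemma strip_formula (hU : Measurable U) (hM : Measurable M)
    (hf : IsDominatedDensity (μ.map fun ω => (U ω, M ω)) f g C) (hg : IsDominating g)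
    (y : ℝ) {r : ℝ} (hr : 0 < r) :
    Integrable ((U ⁻¹' Ioc y (y + r)).indicator M) μ ∧
    r⁻¹ * ∫ ω, (U ⁻¹' Ioc y (y + r)).indicator M ω ∂μ
      = ∫ z, z * ∫ s in (0 : ℝ)..1, f (y + (r * 1) * s) z := by
  have hUM : Measurable fun ω => (U ω, M ω) := hU.prodMk hM
  set φ : ℝ × ℝ → ℝ := fun p => (Ioc y (y + r)).indicator 1 p.1 * p.2 with hφ
  have hφm : Measurable φ :=
    ((measurable_one.indicator measurableSet_Ioc).comp measurable_fst).mul measurable_snd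
  have hcomp : (U ⁻¹' Ioc y (y + r)).indicator M = fun ω => φ (U ω, M ω) := by
    ext ω
    by_cases h : U ω ∈ Ioc y (y + r)
    · have h' : ω ∈ U ⁻¹' Ioc y (y + r) := h
      simp [φ, indicator_of_mem h, indicator_of_mem h']
    · have h' : ω ∉ U ⁻¹' Ioc y (y + r) := h
      simp [φ, indicator_of_notMem h, indicator_of_notMem h']
  have hI : Integrable (fun p : ℝ × ℝ => f p.1 p.2 * φ p) (volume.prod volume) := by
    have h1 : Integrable ((Ioc y (y + r)).indicator (1 : ℝ → ℝ)) :=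
      (integrable_indicator_iff measurableSet_Ioc).2 
        (integrableOn_const (by simp) (by simp))
    have h2 := h1.mul_prod (hg.2.norm.const_mul |C|)
    refine h2.mono' (hf.meas.mul hφm).aestronglyMeasurable (Eventually.of_forall fun p => ?_)
    have := hf.abs_le p.1 p.2
    by_cases h : p.1 ∈ Ioc y (y + r)
    · simp only [φ, indicator_of_mem h, Pi.one_apply, one_mul, norm_mul, Real.norm_eq_abs]
      nlinarith [abs_nonneg p.2]
    · simp [φ, indicator_of_notMem h]
  have hIρ : Integrable φ (μ.map fun ω => (U ω, M ω)) := hf.integrable_iff.2 hI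
  rw [hcomp]
  refine ⟨(integrable_map_measure hφm.aestronglyMeasurable hUM.aemeasurable).1 hIρ, ?_⟩
  rw [← integral_map hUM.aemeasurable hφm.aestronglyMeasurable, hf.integral_eq,
    Measure.volume_eq_prod, integral_prod_symm _ hI, ← integral_const_mul]
  refine integral_congr_ae (Eventually.of_forall fun z => ?_)
  simp only
  have h1 : ∫ u, f u z * φ (u, z) = z * ∫ u in y..(y + r * 1), f u z := by
    rw [intervalIntegral.integral_of_le (by linarith), ← integral_indicator measurableSet_Ioc,
      ← integral_const_mul]
    refine integral_congr_ae (Eventually.of_forall fun u => ?_)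
    by_cases h : u ∈ Ioc y (y + r)
    · simp [φ, indicator_of_mem h, mul_comm]
    · simp [φ, indicator_of_notMem h]
  rw [h1, IsDominatedDensity.interval_eq_avg]
  field_simp

/-- The bound is independent of `y`, of `r` and of the measure, as long as `g` and `C` are shared;
this gives domination over all (d, v, x) at once. -/
lemma abs_strip_le (hU : Measurable U) (hM : Measurable M)
    (hf : IsDominatedDensity (μ.map fun ω => (U ω, M ω)) f g C) (hg : IsDominating g)
    (y : ℝ) {r : ℝ} (hr : 0 < r) :
    |r⁻¹ * ∫ ω, (U ⁻¹' Ioc y (y + r)).indicator M ω ∂μ| ≤ |C| * ∫ z, |z * g z| := by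
  rw [(strip_formula hU hM hf hg y hr).2, ← integral_const_mul, ← Real.norm_eq_abs]
  refine norm_integral_le_of_norm_le (hg.2.norm.const_mul |C|) (Eventually.of_forall fun z => ?_)
  have := mul_le_mul_of_nonneg_left (hf.abs_avg_le y (r * 1) z) (abs_nonneg z)
  simp only [Real.norm_eq_abs, abs_mul] at *
  linarith

lemma tendsto_strip (hU : Measurable U) (hM : Measurable M)
    (hf : IsDominatedDensity (μ.map fun ω => (U ω, M ω)) f g C) (hg : IsDominating g)
    (hc : ∀ z, Continuous fun y => f y z) (y : ℝ) :
    Tendsto (fun n : ℕ => ((1 : ℝ) / (n + 1))⁻¹ *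
      ∫ ω, (U ⁻¹' Ioc y (y + 1 / (n + 1))).indicator M ω ∂μ) atTop (𝓝 (∫ z, z * f y z)) := by
  have h := hf.tendsto_integral_avg (l := (atTop : Filter ℕ)) (y := fun _ => y)
    (t := fun n : ℕ => (1 : ℝ) / (n + 1)) tendsto_one_div_add_atTop_nhds_zero_nat (fun z => ?_)
    measurable_id (b := fun _ => 1) measurable_const hg.2
  · have h' := h.add_const (∫ z, z * f y z)
    simp only [id_eq, sub_add_cancel, zero_add] at h'
    refine h'.congr fun n => ?_
    rw [(strip_formula hU hM hf hg y (by positivity : (0 : ℝ) < 1 / (n + 1))).2]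
  · have h1 : Tendsto (fun r : ℝ => f (y + r) z - f y z) (𝓝 0) (𝓝 0) := by
      have : Continuous fun r : ℝ => f (y + r) z - f y z :=
        ((hc z).comp (continuous_const.add continuous_id)).sub continuous_const
      simpa using this.tendsto 0
    exact h1.comp tendsto_fst

end Strip

end Density

end PolicyEffect

namespace PolicyEffect

/-! ### Conditional independence in terms of kernels -/

section ConditionalIndependence

variable {Ω α β γ : Type*} [MeasurableSpace Ω] [MeasurableSpace α] [MeasurableSpace β]
  [mγ : MeasurableSpace γ] {P : Measure Ω} [IsProbabilityMeasure P]

/-- If `A` and `B` are independent given `W`, then the law of `A` given `(B, W)` is the law of `A`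
given `W`. -/
lemma CondIndepGiven.hasCondDistrib [StandardBorelSpace α] [Nonempty α] {A : Ω → α} {B : Ω → β}
    {W : Ω → γ} (h : CondIndepGiven P A B W) (hA : Measurable A) (hB : Measurable B)
    (hW : Measurable W) :
    HasCondDistrib A (fun ω => (B ω, W ω)) ((condDistrib A W P).prodMkLeft β) P := by
  refine ⟨by fun_prop, ?_⟩
  refine Measure.ext_prod₃_iff'.2 fun {u w s} hu hw hs => ?_
  have hle : mγ.comap W ≤ ‹MeasurableSpace Ω› := hW.comap_le
  have hWw : MeasurableSet[mγ.comap W] (W ⁻¹' w) := ⟨w, hw, rfl⟩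
  have hcs := condDistrib_ae_eq_condExp (μ := P) hW hA hs
  set a : Ω → ℝ := fun ω => (condDistrib A W P (W ω)).real s with ha
  have ha_meas : StronglyMeasurable[mγ.comap W] a := by
    have : Measurable fun x => (condDistrib A W P x).real s :=
      (Kernel.measurable_coe _ hs).ennreal_toReal
    exact (this.comp (comap_measurable W)).stronglyMeasurable
  have ha_bdd : ∀ ω, ‖a ω‖ ≤ 1 := fun ω => by
    rw [Real.norm_of_nonneg measureReal_nonneg]; exact measureReal_le_one
  have hBu : MeasurableSet (B ⁻¹' u) := hB hu
  have hind : Integrable ((B ⁻¹' u).indicator fun _ : Ω => (1 : ℝ)) P :=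
    (integrable_const _).indicator hBu
  have hmul : Integrable (a * (B ⁻¹' u).indicator fun _ : Ω => (1 : ℝ)) P :=
    hind.bdd_mul (ha_meas.mono hle).aestronglyMeasurable (Eventually.of_forall ha_bdd)
  have hpull := condExp_mul_of_stronglyMeasurable_left ha_meas hmul hind
  -- On events of `W` both sides are integrals of the product of the two conditional probabilities:
  -- the left by conditional independence, the right by pulling the `W`-measurable `a` out of the
  -- conditional expectation.
  have key : P.real (A ⁻¹' s ∩ B ⁻¹' u ∩ W ⁻¹' w) = ∫ ω in B ⁻¹' u ∩ W ⁻¹' w, a ω ∂P := by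
    have h1 : ∫ ω in W ⁻¹' w, (A ⁻¹' s ∩ B ⁻¹' u).indicator (fun _ => (1 : ℝ)) ω ∂P
        = P.real (A ⁻¹' s ∩ B ⁻¹' u ∩ W ⁻¹' w) := by
      rw [setIntegral_indicator ((hA hs).inter hBu), inter_comm]
      simp
    have h2 : ∫ ω in W ⁻¹' w, (a * (B ⁻¹' u).indicator fun _ : Ω => (1 : ℝ)) ω ∂P
        = ∫ ω in B ⁻¹' u ∩ W ⁻¹' w, a ω ∂P := by
      have : (a * (B ⁻¹' u).indicator fun _ : Ω => (1 : ℝ)) = (B ⁻¹' u).indicator a := by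
        ext ω
        by_cases hω : ω ∈ B ⁻¹' u
        · rw [Pi.mul_apply, indicator_of_mem hω, indicator_of_mem hω, mul_one]
        · rw [Pi.mul_apply, indicator_of_notMem hω, indicator_of_notMem hω, mul_zero]
      rw [this, setIntegral_indicator hBu, inter_comm]
    rw [← h1, ← h2, ← setIntegral_condExp hle
      ((integrable_const _).indicator ((hA hs).inter hBu)) hWw, ← setIntegral_condExp hle hmul hWw]
    refine setIntegral_congr_ae (hle _ hWw) ?_
    filter_upwards [h s u hs hu, hpull, hcs] with ω e1 e2 e3 _
    rw [e1, e2, Pi.mul_apply, ← e3]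
  have hpair : Measurable fun ω => (B ω, W ω) := hB.prodMk hW
  rw [Measure.map_apply (by fun_prop) ((hu.prod hw).prod hs),
    Measure.compProd_apply_prod (hu.prod hw) hs,
    setLIntegral_map (hu.prod hw) (Kernel.measurable_coe _ hs) hpair]
  have hset : (fun ω => ((B ω, W ω), A ω)) ⁻¹' ((u ×ˢ w) ×ˢ s) = A ⁻¹' s ∩ B ⁻¹' u ∩ W ⁻¹' w := by
    ext ω; simp; tauto
  have hset' : (fun ω => (B ω, W ω)) ⁻¹' (u ×ˢ w) = B ⁻¹' u ∩ W ⁻¹' w := by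
    ext ω; simp
  rw [hset, hset', ← ENNReal.ofReal_toReal (measure_ne_top P _), ← measureReal_def, key,
    ofReal_integral_eq_lintegral_ofReal
      ((Integrable.of_bound (C := 1) (ha_meas.mono hle).aestronglyMeasurable
        (Eventually.of_forall ha_bdd)).integrableOn)
      (Eventually.of_forall fun ω => measureReal_nonneg)]
  refine lintegral_congr fun ω => ?_
  simp [a, measureReal_def]

end ConditionalIndependence

/-- A finite measure on the line puts no mass on the points of `(e, ∞)` that no mass separates
from `e`. -/
lemma measure_setOf_Ioc_eq_zero (q : Measure ℝ) (e : ℝ) : q {r | e < r ∧ q (Ioc e r) = 0} = 0 := by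
  -- Near `x` the set is null for one of two reasons: a point x' > x still has no mass between e and
  -- x', or `x` is the largest point of the set and all of it lies in the null interval `Ioc e x`.
  refine measure_null_of_locally_null _ fun x hx => ?_
  by_cases h : ∃ x', x < x' ∧ q (Ioc e x') = 0
  · obtain ⟨x', hxx', h0⟩ := h
    exact ⟨Ioc e x', mem_nhdsWithin_of_mem_nhds (Ioc_mem_nhds hx.1 hxx'), h0⟩
  · push Not at h
    refine ⟨Ioc e x, mem_nhdsWithin.2 ⟨univ, isOpen_univ, mem_univ _, fun r hr => ?_⟩, hx.2⟩
    refine ⟨hr.2.1, le_of_not_gt fun hlt => h r hlt hr.2.2⟩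

lemma nullSingletonClass_of_continuous_cdf {q : Measure ℝ} [IsProbabilityMeasure q]
    (h : Continuous (cdf q)) : NullSingletonClass q := by
  refine ⟨fun x => ?_⟩
  rw [← measure_cdf q, StieltjesFunction.measure_singleton]
  have : Function.leftLim (cdf q) x = cdf q x := h.continuousAt.continuousWithinAt.leftLim_eq
  simp [this]

/-! ### The control variable -/

section Triangular

variable {Ω 𝓔 : Type*} [MeasurableSpace Ω] [MeasurableSpace 𝓔] {P : Measure Ω}
  [IsProbabilityMeasure P] {k : ℕ} {Y D Z η V : Ω → ℝ} {X : Ω → Fin k → ℝ} {ε : Ω → 𝓔}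
  {m : ℝ → (Fin k → ℝ) → 𝓔 → ℝ} {h : ℝ → (Fin k → ℝ) → ℝ → ℝ}

/-- The conditional distribution function `F_{D|Z,X}` as a function of all its arguments. -/
noncomputable def selectionCdf (P : Measure Ω) [IsFiniteMeasure P] (D Z : Ω → ℝ)
    (X : Ω → Fin k → ℝ) (p : (ℝ × (Fin k → ℝ)) × ℝ) : ℝ :=
  (condDistrib D (fun ω => (Z ω, X ω)) P p.1).real (Iic p.2)

lemma measurable_selectionCdf : Measurable (selectionCdf P D Z X) := by
  have hS : MeasurableSet {q : ((ℝ × (Fin k → ℝ)) × ℝ) × ℝ | q.2 ≤ q.1.2} :=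
    measurableSet_le (by fun_prop) (by fun_prop)
  have := Kernel.measurable_kernel_prodMk_left
    (κ := (condDistrib D (fun ω => (Z ω, X ω)) P).comap Prod.fst measurable_fst) hS
  exact this.ennreal_toReal

lemma measurable_controlVar (hS : IsTriangularSystem P Y D Z η X ε m h) :
    Measurable (controlVar P D Z X) := by
  have hD := hS.meas_D
  have hZ := hS.meas_Z
  have hX := hS.meas_X
  exact measurable_selectionCdf.comp (f := fun ω => ((Z ω, X ω), D ω)) (by fun_prop)

/-- If `η` has the law `Q x` given `(Z, X) = (z, x)`, then `F_{D|Z,X}(d | z, x)` is the `Q x`-mass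
of `{e | h z x e ≤ d}`. -/
lemma controlVar_ae_eq (hS : IsTriangularSystem P Y D Z η X ε m h)
    {Q : Kernel (Fin k → ℝ) ℝ} [IsMarkovKernel Q]
    (hQ : HasCondDistrib η (fun ω => (Z ω, X ω)) (Q.prodMkLeft ℝ) P) :
    ∀ᵐ ω ∂P, controlVar P D Z X ω = (Q (X ω)).real {e | h (Z ω) (X ω) e ≤ D ω} := by
  have hD := hS.meas_D
  have hZ := hS.meas_Z
  have hX := hS.meas_X
  have hη := hS.meas_η
  have hh := hS.meas_h
  have hhm : Measurable fun q : (ℝ × (Fin k → ℝ)) × ℝ => h q.1.1 q.1.2 q.2 :=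
    hh.comp (f := fun q : (ℝ × (Fin k → ℝ)) × ℝ => (q.1.1, q.1.2, q.2)) (by fun_prop)
  -- The law of D given (Z, X) = (z, x) is the image of `Q x` under h(z, x, ·).
  set J : Kernel (ℝ × (Fin k → ℝ)) ℝ :=
    (Kernel.id ×ₖ Q.prodMkLeft ℝ).map fun q => h q.1.1 q.1.2 q.2 with hJ
  have hJapp : ∀ p {s : Set ℝ}, MeasurableSet s → J p s = Q p.2 {e | h p.1 p.2 e ∈ s} := by
    intro p s hs
    rw [hJ, Kernel.map_apply' _ hhm _ hs, Kernel.id_prod_apply' _ _ (hhm hs)]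
    rfl
  have : IsMarkovKernel J := by rw [hJ]; exact Kernel.IsMarkovKernel.map _ hhm
  have hmap : P.map (fun ω => ((Z ω, X ω), D ω)) = P.map (fun ω => (Z ω, X ω)) ⊗ₘ J := by
    ext s hs
    have hT : Measurable fun q : (ℝ × (Fin k → ℝ)) × ℝ => (q.1, h q.1.1 q.1.2 q.2) :=
      measurable_fst.prodMk hhm
    have e1 : P.map (fun ω => ((Z ω, X ω), D ω)) s
        = P.map (fun ω => ((Z ω, X ω), η ω))
          ((fun q : (ℝ × (Fin k → ℝ)) × ℝ => (q.1, h q.1.1 q.1.2 q.2)) ⁻¹' s) := by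
      rw [Measure.map_apply (by fun_prop) hs, Measure.map_apply (by fun_prop) (hT hs)]
      congr 1
      ext ω
      simp [hS.selection_eq ω]
    rw [e1, hQ.map_eq, Measure.compProd_apply (hT hs), Measure.compProd_apply hs]
    refine lintegral_congr fun p => ?_
    rw [hJapp p (measurable_prodMk_left hs)]
    rfl
  have hae := condDistrib_ae_eq_of_measure_eq_compProd (fun ω => (Z ω, X ω)) hD.aemeasurable hmap
  have hZX : AEMeasurable (fun ω => (Z ω, X ω)) P := by fun_prop
  filter_upwards [ae_of_ae_map hZX hae] with ω hω
  rw [controlVar, hω, measureReal_def, hJapp _ measurableSet_Iic, measureReal_def]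
  rfl

/-- The sublevel events of `η` are, up to null events, events of `(V, X)`. -/
lemma ae_le_iff_mem (hS : IsTriangularSystem P Y D Z η X ε m h)
    (hC : ControlConditions P Z η X ε h) {Q : Kernel (Fin k → ℝ) ℝ} [IsMarkovKernel Q]
    (hQ : HasCondDistrib η (fun ω => (Z ω, X ω)) (Q.prodMkLeft ℝ) P) (e : ℝ) :
    ∃ T : Set (ℝ × (Fin k → ℝ)), MeasurableSet T ∧
      ∀ᵐ ω ∂P, η ω ≤ e ↔ (controlVar P D Z X ω, X ω) ∈ T := by
  have hZ := hS.meas_Z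
  have hX := hS.meas_X
  have hη := hS.meas_η
  have hQX : HasCondDistrib η X Q P :=
    HasCondDistrib.comp_right (f := Prod.snd) (hf := measurable_snd) hQ
  -- The absence of atoms matters in the decreasing case, where the intervals that arise are closed
  -- on the other side.
  have hQc : ∀ᵐ x ∂(P.map X), NullSingletonClass (Q x) := by
    have := condDistrib_ae_eq_of_measure_eq_compProd X hη.aemeasurable hQX.map_eq
    filter_upwards [this, hC.cond_cdf] with x hx hc
    rw [← hx]
    exact nullSingletonClass_of_continuous_cdf hc.1
  -- Almost surely η does not exceed `e` across a `Q`-null gap, so that comparing ranks is the same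
  -- as comparing η with `e`.
  have hnull : ∀ᵐ ω ∂P, ¬ (e < η ω ∧ Q (X ω) (Ioc e (η ω)) = 0) := by
    have hmeas : Measurable fun p : (Fin k → ℝ) × ℝ => Q p.1 (Ioc e p.2) := by
      have hS : MeasurableSet {q : ((Fin k → ℝ) × ℝ) × ℝ | e < q.2 ∧ q.2 ≤ q.1.2} :=
        (measurableSet_lt measurable_const measurable_snd).inter
          (measurableSet_le measurable_snd measurable_fst.snd)
      exact Kernel.measurable_kernel_prodMk_left (κ := Q.comap Prod.fst measurable_fst) hS
    have hN : MeasurableSet {p : (Fin k → ℝ) × ℝ | e < p.2 ∧ Q p.1 (Ioc e p.2) = 0} :=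
      (measurableSet_lt measurable_const measurable_snd).inter (hmeas (measurableSet_singleton 0))
    have h0 : P.map (fun ω => (X ω, η ω)) {p | e < p.2 ∧ Q p.1 (Ioc e p.2) = 0} = 0 := by
      rw [hQX.map_eq, Measure.compProd_apply hN]
      refine (lintegral_congr fun x => ?_).trans lintegral_zero
      exact measure_setOf_Ioc_eq_zero (Q x) e
    rw [Measure.map_apply (by fun_prop) hN] at h0
    exact measure_eq_zero_iff_ae_notMem.1 h0
  obtain ⟨S, hSm, hmono⟩ := hC.monotone
  -- If h increases in η then V is the mass of (-∞, η]; if it decreases, V is the mass of [η, ∞).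
  -- The comparison with the rank of `e` reverses accordingly.
  refine ⟨{p | (p.2 ∈ S ∧ p.1 ≤ (Q p.2).real (Iic e)) ∨ (p.2 ∉ S ∧ (Q p.2).real (Ici e) ≤ p.1)},
    ?_, ?_⟩
  · have m1 : Measurable fun p : ℝ × (Fin k → ℝ) => (Q p.2).real (Iic e) :=
      ((Kernel.measurable_coe Q measurableSet_Iic).comp measurable_snd).ennreal_toReal
    have m2 : Measurable fun p : ℝ × (Fin k → ℝ) => (Q p.2).real (Ici e) :=
      ((Kernel.measurable_coe Q measurableSet_Ici).comp measurable_snd).ennreal_toReal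
    exact ((measurable_snd hSm).inter (measurableSet_le measurable_fst m1)).union
      ((measurable_snd hSm).compl.inter (measurableSet_le m2 measurable_fst))
  · filter_upwards [controlVar_ae_eq hS hQ, hnull, hmono, ae_of_ae_map hX.aemeasurable hQc]
      with ω hV hn hm ha
    by_cases hxS : X ω ∈ S
    · have hV' : controlVar P D Z X ω = (Q (X ω)).real (Iic (η ω)) := by
        rw [hV, hS.selection_eq ω]
        simp only [(hm.1 hxS).le_iff_le]
        rfl
      simp only [hxS, true_and, not_true_eq_false, false_and, or_false, hV']
      refine ⟨fun hle => measureReal_mono (Iic_subset_Iic.2 hle), fun hle => ?_⟩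
      by_contra hlt
      push Not at hlt
      refine hn ⟨hlt, ?_⟩
      have hun : Iic e ∪ Ioc e (η ω) = Iic (η ω) := Iic_union_Ioc_eq_Iic hlt.le
      have := measureReal_union (μ := Q (X ω)) (s₁ := Iic e) (s₂ := Ioc e (η ω))
        (Set.disjoint_left.2 fun r hr hr' => not_lt.2 hr hr'.1) measurableSet_Ioc
      rw [hun] at this
      have h0 : (Q (X ω)).real (Ioc e (η ω)) = 0 :=
        le_antisymm (by linarith) measureReal_nonneg
      exact (measureReal_eq_zero_iff).1 h0
    · have hV' : controlVar P D Z X ω = (Q (X ω)).real (Ici (η ω)) := by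
        rw [hV, hS.selection_eq ω]
        simp only [(hm.2 hxS).le_iff_ge]
        rfl
      simp only [hxS, false_and, not_false_eq_true, true_and, false_or, hV']
      refine ⟨fun hle => measureReal_mono (Ici_subset_Ici.2 hle), fun hle => ?_⟩
      by_contra hlt
      push Not at hlt
      refine hn ⟨hlt, ?_⟩
      have hun : Ico e (η ω) ∪ Ici (η ω) = Ici e := Ico_union_Ici_eq_Ici hlt.le
      have := measureReal_union (μ := Q (X ω)) (s₁ := Ico e (η ω)) (s₂ := Ici (η ω))
        (Set.disjoint_left.2 fun r hr hr' => not_lt.2 hr' hr.2) measurableSet_Ici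
      rw [hun] at this
      have h0 : (Q (X ω)).real (Ico e (η ω)) = 0 :=
        le_antisymm (by linarith) measureReal_nonneg
      rw [← measure_congr (Ico_ae_eq_Ioc (μ := Q (X ω)))]
      exact (measureReal_eq_zero_iff).1 h0

omit [IsProbabilityMeasure P] in
/-- A real random variable whose sublevel events at the rationals are events of `W` up to null
events is almost surely a measurable function of `W`. -/
lemma exists_measurable_eq_comp {β : Type*} [MeasurableSpace β] {W : Ω → β}
    (hT : ∀ e : ℚ, ∃ T : Set β, MeasurableSet T ∧ ∀ᵐ ω ∂P, η ω ≤ e ↔ W ω ∈ T) :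
    ∃ ψ : β → ℝ, Measurable ψ ∧ ∀ᵐ ω ∂P, ψ (W ω) = η ω := by
  classical
  choose T hTm hTae using hT
  -- Off a null event the infimum runs over the rationals at or above η. Values in `EReal` make it
  -- meaningful, and measurable, at every `w`.
  set φ : β → EReal := fun w => ⨅ e : ℚ, if w ∈ T e then ((e : ℝ) : EReal) else ⊤ with hφ
  have hφm : Measurable φ := by
    refine Measurable.iInf fun e => ?_
    exact Measurable.ite (hTm e) measurable_const measurable_const
  refine ⟨fun w => (φ w).toReal, measurable_ereal_toReal.comp hφm, ?_⟩
  filter_upwards [ae_all_iff.2 hTae] with ω hω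
  have : φ (W ω) = (η ω : EReal) := by
    refine le_antisymm ?_ ?_
    · refine le_of_forall_gt fun c hc => ?_
      obtain ⟨r, hr1, hr2⟩ := EReal.exists_rat_btwn_of_lt hc
      have : η ω ≤ r := by exact_mod_cast hr1.le
      refine lt_of_le_of_lt (iInf_le _ r) ?_
      rw [if_pos ((hω r).1 this)]
      exact hr2
    · refine le_iInf fun e => ?_
      split_ifs with he
      · exact_mod_cast (hω e).2 he
      · exact le_top
  simp [this]

/-- `V` is a control variable: the law of `ε` given `(D, V, X)` does not depend on `D`. -/
lemma exists_kernel_control [StandardBorelSpace 𝓔]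
    (hS : IsTriangularSystem P Y D Z η X ε m h) (hC : ControlConditions P Z η X ε h)
    (κ : Kernel (ℝ × ℝ × (Fin k → ℝ)) 𝓔) [IsMarkovKernel κ]
    (hκ : HasCondDistrib ε (fun ω => (D ω, controlVar P D Z X ω, X ω)) κ P) :
    ∃ κ' : Kernel (ℝ × (Fin k → ℝ)) 𝓔,
      ∀ᵐ p ∂(P.map fun ω => (D ω, controlVar P D Z X ω, X ω)), κ p = κ' p.2 := by
  have hD := hS.meas_D
  have hZ := hS.meas_Z
  have hX := hS.meas_X
  have hη := hS.meas_η
  have hε := hS.meas_ε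
  have hh := hS.meas_h
  have hVm := measurable_controlVar hS
  obtain ⟨ω₀⟩ : Nonempty Ω := nonempty_of_isProbabilityMeasure P
  have : Nonempty 𝓔 := ⟨ε ω₀⟩
  -- With η as first coordinate, the joint law given X disintegrates into the law of η followed by
  -- that of ε given η.
  set L := (condDistrib (fun ω => (ε ω, η ω)) X P).map Prod.swap with hL
  have : IsMarkovKernel L := Kernel.IsMarkovKernel.map _ measurable_swap
  have h1 : HasCondDistrib (fun ω => (η ω, ε ω)) (fun ω => (Z ω, X ω)) (L.prodMkLeft ℝ) P := by
    have h0 := hC.indep.hasCondDistrib (hε.prodMk hη) hZ hX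
    have h0' : HasCondDistrib (fun ω => (η ω, ε ω)) (fun ω => (Z ω, X ω))
        (((condDistrib (fun ω => (ε ω, η ω)) X P).prodMkLeft ℝ).map Prod.swap) P :=
      h0.comp_left (f := Prod.swap) measurable_swap
    rwa [Kernel.map_prodMkLeft] at h0'
  have hQ : HasCondDistrib η (fun ω => (Z ω, X ω)) (L.fst.prodMkLeft ℝ) P := by
    have := h1.fst
    rwa [Kernel.fst_prodMkLeft] at this
  set N := L.condKernel with hN
  have hdis : L.prodMkLeft ℝ = (L.fst.prodMkLeft ℝ) ⊗ₖ
      (N.comap (fun q : (ℝ × (Fin k → ℝ)) × ℝ => (q.1.2, q.2)) (by fun_prop)) := by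
    ext p s hs
    conv_lhs => rw [← L.disintegrate L.condKernel]
    rw [Kernel.prodMkLeft_apply, Kernel.compProd_apply hs, Kernel.compProd_apply hs]
    rfl
  rw [hdis] at h1
  have h2 := h1.of_compProd
  choose T hT using fun e : ℚ => ae_le_iff_mem hS hC hQ (e : ℝ)
  obtain ⟨ψ, hψm, hψ⟩ := exists_measurable_eq_comp
    (W := fun ω => (controlVar P D Z X ω, X ω)) fun e => ⟨T e, hT e⟩
  -- The law of ε given (X, η), evaluated at the value of η recovered from (V, X).
  set κ' : Kernel (ℝ × (Fin k → ℝ)) 𝓔 :=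
    N.comap (fun p => (p.2, ψ p)) (measurable_snd.prodMk hψm) with hκ'
  have hhm : Measurable fun q : (ℝ × (Fin k → ℝ)) × ℝ => h q.1.1 q.1.2 q.2 :=
    hh.comp (f := fun q : (ℝ × (Fin k → ℝ)) × ℝ => (q.1.1, q.1.2, q.2)) (by fun_prop)
  -- (D, V, X) is a function of ((Z, X), η). Since the law of ε given the finer variable already
  -- factors through this function, it is also the law given the coarser one.
  set F : (ℝ × (Fin k → ℝ)) × ℝ → ℝ × ℝ × (Fin k → ℝ) := fun q =>
    (h q.1.1 q.1.2 q.2, selectionCdf P D Z X (q.1, h q.1.1 q.1.2 q.2), q.1.2) with hF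
  have hFm : Measurable F :=
    hhm.prodMk ((measurable_selectionCdf.comp (measurable_fst.prodMk hhm)).prodMk
      measurable_fst.snd)
  have hFω : (F ∘ fun ω => ((Z ω, X ω), η ω)) = fun ω => (D ω, controlVar P D Z X ω, X ω) := by
    ext ω : 1
    simp only [F, Function.comp, ← hS.selection_eq ω]
    rfl
  have hZXη : Measurable fun ω => ((Z ω, X ω), η ω) := by fun_prop
  have h3 : HasCondDistrib ε (fun ω => ((Z ω, X ω), η ω))
      ((κ'.prodMkLeft ℝ).comap F hFm) P := by
    refine ⟨by fun_prop, ?_⟩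
    rw [h2.map_eq]
    refine Measure.compProd_congr ?_
    have hset : MeasurableSet {q : (ℝ × (Fin k → ℝ)) × ℝ | ψ (F q).2 = q.2} :=
      measurableSet_eq_fun (hψm.comp hFm.snd) measurable_snd
    have : ∀ᵐ q ∂(P.map fun ω => ((Z ω, X ω), η ω)), ψ (F q).2 = q.2 := by
      rw [ae_map_iff hZXη.aemeasurable hset]
      filter_upwards [hψ] with ω hω
      have := congrFun hFω ω
      simp only [Function.comp] at this
      rw [this]
      exact hω
    filter_upwards [this] with q hq
    simp only [Kernel.comap_apply, Kernel.prodMkLeft_apply, κ']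
    rw [hq]
  have h4 : HasCondDistrib ε (fun ω => (D ω, controlVar P D Z X ω, X ω)) (κ'.prodMkLeft ℝ) P := by
    rw [← hFω]
    exact HasCondDistrib.comp_right (hf := hFm) h3
  exact ⟨κ', Kernel.ae_eq_of_compProd_eq (hκ.map_eq.symm.trans h4.map_eq)⟩

end Triangular

end PolicyEffect

namespace PolicyEffect

/-! ### Return points of the conditional law -/

section Accumulation

variable {β 𝓔 : Type*} [MeasurableSpace β] [MeasurableSpace 𝓔]

/-- If the law of `(d, b)` is absolutely continuous in `d`, then a kernel that does not depend on
`d` almost surely takes the value it has at `(d, b)` at points `(d + δ, b)` with arbitrarily small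
`δ > 0`. -/
lemma ae_frequently_kernel_eq {ρ : Measure (ℝ × β)} {ν : Measure β} [SFinite ν]
    (hac : ρ ≪ volume.prod ν) (κ : Kernel (ℝ × β) 𝓔) {κ' : Kernel β 𝓔}
    (h : ∀ᵐ p ∂ρ, κ p = κ' p.2) :
    ∀ᵐ p ∂ρ, ∃ᶠ δ in 𝓝[>] (0 : ℝ), κ (p.1 + δ, p.2) = κ p := by
  obtain ⟨N, hN, hNm, hN0⟩ := exists_measurable_superset_of_null (ae_iff.1 h)
  have hE : ∀ p, p ∉ N → κ p = κ' p.2 := fun p hp => by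
    by_contra hne
    exact hp (hN hne)
  set G : ℝ → Set ((ℝ × β) × ℝ) := fun r => {q | q.1.1 < q.2 ∧ q.2 < r ∧ (q.2, q.1.2) ∉ N} with hG
  have hGm : ∀ r, MeasurableSet (G r) := by
    intro r
    have e1 : MeasurableSet {q : (ℝ × β) × ℝ | q.1.1 < q.2} :=
      measurableSet_lt measurable_fst.fst measurable_snd
    have e2 : MeasurableSet {q : (ℝ × β) × ℝ | q.2 < r} :=
      measurableSet_lt measurable_snd measurable_const
    have e3 : Measurable fun q : (ℝ × β) × ℝ => (q.2, q.1.2) :=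
      measurable_snd.prodMk measurable_fst.snd
    exact e1.inter (e2.inter (e3 hNm.compl))
  -- The points of the good set `Nᶜ` for which almost no good point with the same `b` has its first
  -- coordinate between d and r.
  set U : ℝ → Set (ℝ × β) := fun r =>
    {p | p ∉ N ∧ p.1 < r ∧ volume (Prod.mk p ⁻¹' G r) = 0} with hU
  have hUm : ∀ r, MeasurableSet (U r) := by
    intro r
    have e2 : MeasurableSet {p : ℝ × β | p.1 < r} := measurableSet_lt measurable_fst measurable_const
    have e3 : Measurable fun p : ℝ × β => (volume : Measure ℝ) (Prod.mk p ⁻¹' G r) :=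
      measurable_measure_prodMk_left (hGm r)
    exact hNm.compl.inter (e2.inter (e3 (measurableSet_singleton 0)))
  have hU0 : ∀ r, ρ (U r) = 0 := by
    intro r
    refine hac ?_
    rw [Measure.prod_apply_symm (hUm r)]
    refine (lintegral_congr fun b => ?_).trans lintegral_zero
    -- In a fixed section, either some point x' < x lies in `U r`, and the section to the right of
    -- x' sits in the null set of good points after x'; or `x` is leftmost, and the section sits in
    -- {x} together with the null set after x.
    refine measure_null_of_locally_null _ fun x hx => ?_
    have hx' : (x, b) ∈ U r := hx
    by_cases hex : ∃ x', x' < x ∧ (x', b) ∈ U r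
    · obtain ⟨x', hlt, hx'U⟩ := hex
      refine ⟨Prod.mk (x', b) ⁻¹' G r, ?_, hx'U.2.2⟩
      rw [mem_nhdsWithin]
      refine ⟨Ioi x', isOpen_Ioi, hlt, fun s hs => ?_⟩
      have hsU : (s, b) ∈ U r := hs.2
      exact ⟨hs.1, hsU.2.1, hsU.1⟩
    · push Not at hex
      refine ⟨{x} ∪ Prod.mk (x, b) ⁻¹' G r, ?_, ?_⟩
      · rw [mem_nhdsWithin]
        refine ⟨univ, isOpen_univ, mem_univ _, fun s hs => ?_⟩
        have hsU : (s, b) ∈ U r := hs.2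
        rcases lt_trichotomy s x with hlt | heq | hgt
        · exact absurd hsU (hex s hlt)
        · exact Or.inl heq
        · exact Or.inr ⟨hgt, hsU.2.1, hsU.1⟩
      · exact measure_union_null (by simp) hx'.2.2
  have hall : ∀ᵐ p ∂ρ, ∀ r : ℚ, p ∉ U r :=
    ae_all_iff.2 fun r => measure_eq_zero_iff_ae_notMem.1 (hU0 r)
  filter_upwards [hall, measure_eq_zero_iff_ae_notMem.1 hN0] with p hp hpN
  rw [(nhdsGT_basis (0 : ℝ)).frequently_iff]
  intro a ha
  obtain ⟨r, hr1, hr2⟩ := exists_rat_btwn (show p.1 < p.1 + a by linarith)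
  have hne : volume (Prod.mk p ⁻¹' G r) ≠ 0 := fun h0 => hp r ⟨hpN, hr1, h0⟩
  obtain ⟨s, hs⟩ := nonempty_of_measure_ne_zero hne
  have hs' : p.1 < s ∧ s < r ∧ (s, p.2) ∉ N := hs
  refine ⟨s - p.1, ⟨by linarith [hs'.1], by linarith [hs'.2.1]⟩, ?_⟩
  rw [show p.1 + (s - p.1) = s by ring, hE _ hs'.2.2, hE p hpN]

end Accumulation

/-! ### Measurability of the structural derivative -/

section StructuralDerivative

variable {E 𝓔 : Type*} [MeasurableSpace E] [MeasurableSpace 𝓔] {m : ℝ → E → 𝓔 → ℝ}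

lemma tendsto_seq_slope {f : ℝ → ℝ} {f' d : ℝ} (hf : HasDerivAt f f' d) :
    Tendsto (fun n : ℕ => ((1 : ℝ) / (n + 1))⁻¹ * (f (d + 1 / (n + 1)) - f d)) atTop (𝓝 f') := by
  have h1 := hf.tendsto_slope_zero_right
  have h2 : Tendsto (fun n : ℕ => (1 : ℝ) / (n + 1)) atTop (𝓝[>] 0) :=
    tendsto_nhdsWithin_iff.2 ⟨tendsto_one_div_add_atTop_nhds_zero_nat,
      Eventually.of_forall fun n => by
        show (0 : ℝ) < _
        positivity⟩
  exact h1.comp h2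

lemma measurable_structDeriv (hm : Measurable fun p : ℝ × E × 𝓔 => m p.1 p.2.1 p.2.2)
    (hs : ∀ x e, ContDiff ℝ 1 fun d => m d x e) :
    Measurable fun p : ℝ × E × 𝓔 => structDeriv m p.1 p.2.1 p.2.2 := by
  refine measurable_of_tendsto_metrizable
    (f := fun (n : ℕ) (p : ℝ × E × 𝓔) =>
      ((1 : ℝ) / (n + 1))⁻¹ * (m (p.1 + 1 / (n + 1)) p.2.1 p.2.2 - m p.1 p.2.1 p.2.2))
    (fun n => ?_) (tendsto_pi_nhds.2 fun p => ?_)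
  · have : Measurable fun p : ℝ × E × 𝓔 => (p.1 + 1 / ((n : ℝ) + 1), p.2.1, p.2.2) := by fun_prop
    exact ((hm.comp this).sub hm).const_mul _
  · exact tendsto_seq_slope (((hs p.2.1 p.2.2).differentiable one_ne_zero).differentiableAt
      |>.hasDerivAt)

end StructuralDerivative

/-! ### The derivative of the conditional distribution function -/

section ConditionalDerivative

variable {𝓔 : Type*} [MeasurableSpace 𝓔] {k : ℕ} {m : ℝ → (Fin k → ℝ) → 𝓔 → ℝ}
  {κ : Kernel (ℝ × ℝ × (Fin k → ℝ)) 𝓔} [IsMarkovKernel κ]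

/-- The derivative of `F_{Y|D,V,X}` at a point to which the conditional law of `ε` returns. -/
lemma condCdfDeriv_eq (hm : Measurable fun p : ℝ × (Fin k → ℝ) × 𝓔 => m p.1 p.2.1 p.2.2)
    (hs : ∀ x e, ContDiff ℝ 1 fun d => m d x e) {SD : Set ℝ} {d v : ℝ} {x : Fin k → ℝ} {y : ℝ}
    (hSD : SD ∈ 𝓝 d) (hdiff : DifferentiableWithinAt ℝ (fun s => condCdf κ m s v x y) SD d)
    (hfreq : ∃ᶠ δ in 𝓝[>] (0 : ℝ), κ (d + δ, v, x) = κ (d, v, x))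
    (hlin : ∀ ν : ℝ, 0 < ν → (fun δ : ℝ => (κ (d, v, x)).real {e | ν * δ ≤
      |m (d + δ) x e - m d x e - δ * structDeriv m d x e|}) =o[𝓝[>] 0] fun δ => δ)
    {f : ℝ → ℝ → ℝ} {g : ℝ → ℝ} {C : ℝ}
    (hf : IsDominatedDensity ((κ (d, v, x)).map fun e => (m d x e, structDeriv m d x e)) f g C)
    (hg : IsDominating g) (hc : ∀ z, Continuous fun y => f y z) :
    condCdfDeriv SD κ m d v x y = -∫ z, z * f y z := by
  have hme : Measurable fun e : 𝓔 => (d, x, e) := by fun_prop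
  have hU : Measurable fun e => m d x e := hm.comp hme
  have hM : Measurable fun e => structDeriv m d x e := (measurable_structDeriv hm hs).comp hme
  -- At a single threshold, with the filter `pure y`, continuity of the density in y replaces
  -- uniform continuity.
  have h1 := tendsto_cdf_quotient (μ := κ (d, v, x)) hU hM hf hg
    (Ut := fun δ e => m (d + δ) x e) hlin (l := pure y) (fun z => ?_)
  · have h2 : Tendsto (fun δ : ℝ => (δ, y)) (𝓝[>] 0) (𝓝[>] 0 ×ˢ pure y) :=
      tendsto_id.prodMk (tendsto_const_pure)
    have h3 := (h1.comp h2).sub_const (∫ z, z * f y z)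
    simp only [Function.comp_def, add_sub_cancel_right, zero_sub] at h3
    have h4 : HasDerivAt (fun s => condCdf κ m s v x y) (condCdfDeriv SD κ m d v x y) d :=
      hdiff.hasDerivWithinAt.hasDerivAt hSD
    have h5 := h4.tendsto_slope_zero_right
    -- The increments of F_{Y|D,V,X} also involve the change of κ. Since the derivative is known to
    -- exist, its value can be read off along those δ at which κ has returned.
    refine tendsto_nhds_unique_of_frequently_eq h5 h3 (hfreq.mono fun δ hδ => ?_)
    simp only [condCdf, hδ, smul_eq_mul]
  · have h1 : Tendsto (fun r : ℝ => f (y + r) z - f y z) (𝓝 0) (𝓝 0) := by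
      have : Continuous fun r : ℝ => f (y + r) z - f y z :=
        ((hc z).comp (continuous_const.add continuous_id)).sub continuous_const
      simpa using this.tendsto 0
    rw [prod_pure, tendsto_map'_iff]
    exact h1

end ConditionalDerivative

/-! ### The derivative of the outcome distribution as an expectation -/

section Expectation

variable {Ω 𝓔 : Type*} [MeasurableSpace Ω] [MeasurableSpace 𝓔] {P : Measure Ω}
  [IsProbabilityMeasure P] {k : ℕ} {D V : Ω → ℝ} {X : Ω → Fin k → ℝ} {ε : Ω → 𝓔}
  {m : ℝ → (Fin k → ℝ) → 𝓔 → ℝ} {κ : Kernel (ℝ × ℝ × (Fin k → ℝ)) 𝓔} [IsMarkovKernel κ]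

/-- The average of `∂_d m` over the event `y < m ≤ y + 1 / (n + 1)`, given `(D, V, X)`. -/
noncomputable def condStrip (κ : Kernel (ℝ × ℝ × (Fin k → ℝ)) 𝓔) (m : ℝ → (Fin k → ℝ) → 𝓔 → ℝ)
    (y : ℝ) (n : ℕ) (p : ℝ × ℝ × (Fin k → ℝ)) : ℝ :=
  ((1 : ℝ) / (n + 1))⁻¹ * ∫ e, ((fun e => m p.1 p.2.2 e) ⁻¹' Ioc y (y + 1 / (n + 1))).indicator
    (fun e => structDeriv m p.1 p.2.2 e) e ∂(κ p)

lemma measurable_stripIntegrand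
    (hm : Measurable fun p : ℝ × (Fin k → ℝ) × 𝓔 => m p.1 p.2.1 p.2.2)
    (hs : ∀ x e, ContDiff ℝ 1 fun d => m d x e) (y r : ℝ) :
    Measurable fun q : (ℝ × ℝ × (Fin k → ℝ)) × 𝓔 =>
      ((fun e => m q.1.1 q.1.2.2 e) ⁻¹' Ioc y r).indicator
        (fun e => structDeriv m q.1.1 q.1.2.2 e) q.2 := by
  have hq : Measurable fun q : (ℝ × ℝ × (Fin k → ℝ)) × 𝓔 => (q.1.1, q.1.2.2, q.2) := by fun_prop
  have h1 := hm.comp hq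
  have h2 := (measurable_structDeriv hm hs).comp hq
  exact h2.indicator (h1 measurableSet_Ioc)

lemma stronglyMeasurable_condStrip
    (hm : Measurable fun p : ℝ × (Fin k → ℝ) × 𝓔 => m p.1 p.2.1 p.2.2)
    (hs : ∀ x e, ContDiff ℝ 1 fun d => m d x e) (y : ℝ) (n : ℕ) :
    StronglyMeasurable (condStrip κ m y n) := by
  refine StronglyMeasurable.const_mul ?_ _
  exact StronglyMeasurable.integral_kernel_prod_right'
    (measurable_stripIntegrand hm hs y _).stronglyMeasurable

/-- At almost every `(d, v, x)`, the derivative `∂_d F_{Y|D,V,X}` is bounded by one constant, and is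
the limit of averages of `-∂_d m` over strips. -/
lemma ae_condCdfDeriv (hm : Measurable fun p : ℝ × (Fin k → ℝ) × 𝓔 => m p.1 p.2.1 p.2.2)
    (hs : ∀ x e, ContDiff ℝ 1 fun d => m d x e)
    (hDm : Measurable D) (hVm : Measurable V) (hXm : Measurable X)
    (hR : ConditionalRegularity P D V X m κ)
    (hac : P.map (fun ω => (D ω, V ω, X ω)) ≪ volume.prod (P.map (fun ω => (V ω, X ω))))
    {κ' : Kernel (ℝ × (Fin k → ℝ)) 𝓔}
    (hκ' : ∀ᵐ p ∂(P.map fun ω => (D ω, V ω, X ω)), κ p = κ' p.2)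
    (hI : ∀ᵐ ω ∂P, suppOf P D ∈ 𝓝 (D ω)) :
    ∃ A : ℝ, ∀ᵐ p ∂(P.map fun ω => (D ω, V ω, X ω)), ∀ y,
      (∀ n, |condStrip κ m y n p| ≤ A) ∧
      |condCdfDeriv (suppOf P D) κ m p.1 p.2.1 p.2.2 y| ≤ A ∧
      Tendsto (fun n => condStrip κ m y n p) atTop
        (𝓝 (-condCdfDeriv (suppOf P D) κ m p.1 p.2.1 p.2.2 y)) := by
  obtain ⟨g, C, hg, hdens⟩ := hR.density
  refine ⟨|C| * ∫ z, |z * g z|, ?_⟩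
  have hfreq := ae_frequently_kernel_eq hac κ hκ'
  have hDVX : Measurable fun ω => (D ω, V ω, X ω) := by fun_prop
  have hint : ∀ᵐ p ∂(P.map fun ω => (D ω, V ω, X ω)), p.1 ∈ interior (suppOf P D) := by
    rw [ae_map_iff hDVX.aemeasurable (measurable_fst isOpen_interior.measurableSet)]
    filter_upwards [hI] with ω hω using mem_interior_iff_mem_nhds.2 hω
  have hV : ∀ᵐ p ∂(P.map fun ω => (D ω, V ω, X ω)), p.2.1 ∈ suppOf P V := by
    have hset : MeasurableSet {p : ℝ × ℝ × (Fin k → ℝ) | p.2.1 ∈ suppOf P V} :=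
      measurable_snd.fst Measure.isClosed_support.measurableSet
    rw [ae_map_iff hDVX.aemeasurable hset]
    exact ae_of_ae_map hVm.aemeasurable Measure.support_mem_ae
  have hX : ∀ᵐ p ∂(P.map fun ω => (D ω, V ω, X ω)), p.2.2 ∈ suppOf P X := by
    have hset : MeasurableSet {p : ℝ × ℝ × (Fin k → ℝ) | p.2.2 ∈ suppOf P X} :=
      measurable_snd.snd Measure.isClosed_support.measurableSet
    rw [ae_map_iff hDVX.aemeasurable hset]
    exact ae_of_ae_map hXm.aemeasurable Measure.support_mem_ae
  filter_upwards [hfreq, hint, hV, hX] with p hp hpD hpV hpX y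
  obtain ⟨d, v, x⟩ := p
  have hSD : suppOf P D ∈ 𝓝 d := mem_interior_iff_mem_nhds.1 hpD
  have hd : d ∈ suppOf P D := mem_of_mem_nhds hSD
  obtain ⟨f, hf, hfc⟩ := hdens d hd v hpV x hpX
  have heq := condCdfDeriv_eq (y := y) hm hs hSD
    ((hR.smooth v hpV x hpX y).differentiableOn one_ne_zero d hd) hp
    (hR.linearization d hd v hpV x hpX) hf hg hfc
  have hme : Measurable fun e : 𝓔 => (d, x, e) := by fun_prop
  have hU : Measurable fun e => m d x e := hm.comp hme
  have hM : Measurable fun e => structDeriv m d x e := (measurable_structDeriv hm hs).comp hme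
  refine ⟨fun n => abs_strip_le hU hM hf hg y (by positivity), ?_, ?_⟩
  · rw [heq, abs_neg]
    exact hf.abs_integral_mul_le hg.2 y
  · rw [heq, neg_neg]
    exact tendsto_strip hU hM hf hg hfc y

/-- The derivative of the outcome distribution along the policy, as an expectation of
`π̇(D) ∂_d F_{Y|D,V,X}`. -/
lemma integral_condCdfDeriv (hm : Measurable fun p : ℝ × (Fin k → ℝ) × 𝓔 => m p.1 p.2.1 p.2.2)
    (hs : ∀ x e, ContDiff ℝ 1 fun d => m d x e)
    (hDm : Measurable D) (hVm : Measurable V) (hXm : Measurable X) (hεm : Measurable ε)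
    (hκ : HasCondDistrib ε (fun ω => (D ω, V ω, X ω)) κ P)
    {SD : Set ℝ} {A : ℝ} {y : ℝ} (hA : ∀ᵐ p ∂(P.map fun ω => (D ω, V ω, X ω)),
      (∀ n, |condStrip κ m y n p| ≤ A) ∧ |condCdfDeriv SD κ m p.1 p.2.1 p.2.2 y| ≤ A ∧
      Tendsto (fun n => condStrip κ m y n p) atTop
        (𝓝 (-condCdfDeriv SD κ m p.1 p.2.1 p.2.2 y)))
    {π : ℝ → ℝ → ℝ} (hπ : Measurable fun p : ℝ × (Fin k → ℝ) × 𝓔 => mDot m π p.1 p.2.1 p.2.2)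
    {w : ℝ → ℝ} (hw : Measurable w) {M : ℝ}
    (hwπ : ∀ᵐ ω ∂P, policyDeriv π (D ω) = w (D ω) ∧ |w (D ω)| ≤ M)
    {f : ℝ → ℝ → ℝ} {g : ℝ → ℝ} {C : ℝ} (hg : IsDominating g)
    (hf : IsDominatedDensity
      (P.map fun ω => (outcome m D X ε ω, mDot m π (D ω) (X ω) (ε ω))) f g C)
    (hc : ∀ z, Continuous fun y => f y z) :
    AEStronglyMeasurable (fun p : ℝ × ℝ × (Fin k → ℝ) => condCdfDeriv SD κ m p.1 p.2.1 p.2.2 y)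
      (P.map fun ω => (D ω, V ω, X ω)) ∧
    -∫ z, z * f y z = ∫ ω, w (D ω) * condCdfDeriv SD κ m (D ω) (V ω) (X ω) y ∂P := by
  have hDVX : Measurable fun ω => (D ω, V ω, X ω) := by fun_prop
  set ρ := P.map fun ω => (D ω, V ω, X ω) with hρ
  have : IsProbabilityMeasure ρ := Measure.isProbabilityMeasure_map hDVX.aemeasurable
  -- Joint measurability of ∂_d F in (d, v, x) is inherited from the strip averages, of which it is
  -- an almost everywhere limit.
  have hmeas : AEStronglyMeasurable
      (fun p : ℝ × ℝ × (Fin k → ℝ) => condCdfDeriv SD κ m p.1 p.2.1 p.2.2 y) ρ := by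
    have h1 := aestronglyMeasurable_of_tendsto_ae (μ := ρ) atTop
      (fun n => (stronglyMeasurable_condStrip (κ := κ) hm hs y n).aestronglyMeasurable)
      (hA.mono fun p hp => hp.2.2)
    refine h1.neg.congr (Eventually.of_forall fun p => ?_)
    simp
  refine ⟨hmeas, ?_⟩
  have hwρ : ∀ᵐ p ∂ρ, |w p.1| ≤ M := by
    have hset : MeasurableSet {p : ℝ × ℝ × (Fin k → ℝ) | |w p.1| ≤ M} :=
      measurableSet_le (hw.comp measurable_fst).abs measurable_const
    rw [hρ, ae_map_iff hDVX.aemeasurable hset]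
    exact hwπ.mono fun ω h => h.2
  have hU : Measurable (outcome m D X ε) :=
    hm.comp (f := fun ω => (D ω, X ω, ε ω)) (by fun_prop)
  have hM : Measurable fun ω => mDot m π (D ω) (X ω) (ε ω) :=
    hπ.comp (f := fun ω => (D ω, X ω, ε ω)) (by fun_prop)
  have hlim1 := tendsto_strip hU hM hf hg hc y
  -- At fixed strip width the unconditional average of ṁ = w ∂_d m disintegrates over (D, V, X);
  -- both sides then pass to the limit separately.
  have hstep : ∀ n : ℕ, ((1 : ℝ) / (n + 1))⁻¹ *
      ∫ ω, (outcome m D X ε ⁻¹' Ioc y (y + 1 / (n + 1))).indicator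
        (fun ω => mDot m π (D ω) (X ω) (ε ω)) ω ∂P
      = ∫ p, w p.1 * condStrip κ m y n p ∂ρ := by
    intro n
    set φ : (ℝ × ℝ × (Fin k → ℝ)) × 𝓔 → ℝ := fun q => w q.1.1 *
      ((fun e => m q.1.1 q.1.2.2 e) ⁻¹' Ioc y (y + 1 / (n + 1))).indicator
        (fun e => structDeriv m q.1.1 q.1.2.2 e) q.2 with hφ
    have hφm : Measurable φ :=
      (hw.comp measurable_fst.fst).mul (measurable_stripIntegrand hm hs y _)
    have hae : (outcome m D X ε ⁻¹' Ioc y (y + 1 / (n + 1))).indicator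
        (fun ω => mDot m π (D ω) (X ω) (ε ω))
        =ᵐ[P] fun ω => φ ((D ω, V ω, X ω), ε ω) := by
      filter_upwards [hwπ] with ω hω
      by_cases h : m (D ω) (X ω) (ε ω) ∈ Ioc y (y + 1 / ((n : ℝ) + 1))
      · have h1 : ω ∈ outcome m D X ε ⁻¹' Ioc y (y + 1 / ((n : ℝ) + 1)) := h
        have h2 : ε ω ∈ (fun e => m (D ω) (X ω) e) ⁻¹' Ioc y (y + 1 / ((n : ℝ) + 1)) := h
        simp only [φ]
        rw [indicator_of_mem h1, indicator_of_mem h2, mDot, hω.1]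
      · have h1 : ω ∉ outcome m D X ε ⁻¹' Ioc y (y + 1 / ((n : ℝ) + 1)) := h
        have h2 : ε ω ∉ (fun e => m (D ω) (X ω) e) ⁻¹' Ioc y (y + 1 / ((n : ℝ) + 1)) := h
        simp only [φ]
        rw [indicator_of_notMem h1, indicator_of_notMem h2, mul_zero]
    have hpair : Measurable fun ω => ((D ω, V ω, X ω), ε ω) := by fun_prop
    have hint := (strip_formula hU hM hf hg y (by positivity : (0 : ℝ) < 1 / ((n : ℝ) + 1))).1
    have hint' : Integrable φ (ρ ⊗ₘ κ) := by
      rw [← hκ.map_eq, integrable_map_measure hφm.aestronglyMeasurable hpair.aemeasurable]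
      exact (integrable_congr hae).1 hint
    rw [integral_congr_ae hae, ← integral_map (φ := fun ω => ((D ω, V ω, X ω), ε ω))
      hpair.aemeasurable hφm.aestronglyMeasurable, hκ.map_eq,
      Measure.integral_compProd hint', ← integral_const_mul]
    refine integral_congr_ae (Eventually.of_forall fun p => ?_)
    simp only [φ, condStrip]
    rw [integral_const_mul]
    ring
  have hlim2 : Tendsto (fun n => ∫ p, w p.1 * condStrip κ m y n p ∂ρ) atTop
      (𝓝 (∫ p, w p.1 * -condCdfDeriv SD κ m p.1 p.2.1 p.2.2 y ∂ρ)) := by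
    refine tendsto_integral_of_dominated_convergence (fun _ => M * A)
      (fun n => (hw.comp measurable_fst).stronglyMeasurable.mul
        (stronglyMeasurable_condStrip hm hs y n) |>.aestronglyMeasurable)
      (integrable_const _) (fun n => ?_) ?_
    · filter_upwards [hA, hwρ] with p hp hwp
      rw [norm_mul]
      exact mul_le_mul hwp (hp.1 n) (norm_nonneg _) ((abs_nonneg _).trans hwp)
    · filter_upwards [hA] with p hp using hp.2.2.const_mul _
  have heq := tendsto_nhds_unique hlim1 (hlim2.congr fun n => (hstep n).symm)
  have hwm : AEStronglyMeasurable
      (fun p : ℝ × ℝ × (Fin k → ℝ) => w p.1 * condCdfDeriv SD κ m p.1 p.2.1 p.2.2 y) ρ :=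
    (hw.comp measurable_fst).aestronglyMeasurable.mul hmeas
  rw [heq]
  simp only [mul_neg, integral_neg, neg_neg]
  rw [hρ, integral_map hDVX.aemeasurable hwm]

end Expectation

end PolicyEffect

namespace PolicyEffect

/-! ### From uniform quotients to the marginal policy effect -/

section MarginalEffect

variable {B : Type*} [NormedAddCommGroup B] [NormedSpace ℝ B]

/-- If `t⁻¹ (F_t - F)` converges uniformly to a bounded continuous `h`, then the marginal effect is
`Γ'_F(h)`. -/
lemma HasHadamardDerivAt.isMarginalPolicyEffect {Γ : (ℝ → ℝ) → B} {𝓓 : Set (ℝ → ℝ)}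
    {F : ℝ → ℝ} {dΓ : (ℝ → ℝ) → B} (hΓ : HasHadamardDerivAt Γ 𝓓 F boundedContinuous dΓ)
    {Ft : ℝ → ℝ → ℝ} (h𝓓 : ∀ t ∈ Icc (0 : ℝ) 1, Ft t ∈ 𝓓) {c : ℝ}
    (hbdd : ∀ t y, |Ft t y - F y| ≤ c) {h : ℝ → ℝ} (hh : h ∈ boundedContinuous)
    (hlim : Tendsto (fun q : ℝ × ℝ => q.1⁻¹ * (Ft q.1 q.2 - F q.2) - h q.2)
      (𝓝[>] 0 ×ˢ ⊤) (𝓝 0)) :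
    IsMarginalPolicyEffect Γ F Ft (dΓ h) := by
  refine tendsto_iff_seq_tendsto.2 fun u hu => ?_
  have hmem : Ioc (0 : ℝ) 1 ∈ 𝓝[>] (0 : ℝ) := Ioc_mem_nhdsGT zero_lt_one
  obtain ⟨N, hN⟩ := eventually_atTop.1 (hu.eventually_mem hmem)
  -- Dropping `N` terms puts the whole sequence into (0, 1], where the counterfactual distribution
  -- functions lie in the domain of Γ.
  rw [← tendsto_add_atTop_iff_nat N]
  set t : ℕ → ℝ := fun n => u (n + N) with ht
  have ht01 : ∀ n, t n ∈ Ioc (0 : ℝ) 1 := fun n => hN (n + N) (Nat.le_add_left _ _)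
  have htlim : Tendsto t atTop (𝓝[>] 0) := (tendsto_add_atTop_iff_nat N).2 hu
  have hpath : ∀ n, F + t n • ((t n)⁻¹ • (Ft (t n) - F)) = Ft (t n) := fun n => by
    rw [smul_smul, mul_inv_cancel₀ (ht01 n).1.ne', one_smul, add_sub_cancel]
  have key := hΓ.tendsto h t (fun n => (t n)⁻¹ • (Ft (t n) - F)) hh (fun n => (ht01 n).1)
    (htlim.mono_right nhdsWithin_le_nhds) (fun n => ⟨(t n)⁻¹ * c, fun y => ?_⟩) ?_
    (fun n => by rw [hpath]; exact h𝓓 _ (Ioc_subset_Icc_self (ht01 n)))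
  · simp only [hpath] at key
    exact key
  · have h0 := inv_pos.2 (ht01 n).1
    simp only [Pi.smul_apply, Pi.sub_apply, smul_eq_mul, abs_mul, abs_of_pos h0]
    exact mul_le_mul_of_nonneg_left (hbdd _ y) h0.le
  · rw [Metric.tendstoUniformly_iff]
    intro ε hε
    obtain ⟨pa, hpa, pb, hpb, hab⟩ := eventually_prod_iff.1 ((Metric.tendsto_nhds.1 hlim) ε hε)
    filter_upwards [htlim.eventually hpa] with n hn y
    have := hab hn (eventually_top.1 hpb y)
    rw [dist_zero_right] at this
    rw [dist_comm, Real.dist_eq]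
    simpa using this

variable {Ω 𝓔 : Type*} [MeasurableSpace Ω] [MeasurableSpace 𝓔] {P : Measure Ω}
  [IsProbabilityMeasure P] {k : ℕ} {Y D : Ω → ℝ} {X : Ω → Fin k → ℝ} {ε : Ω → 𝓔}
  {m : ℝ → (Fin k → ℝ) → 𝓔 → ℝ}

omit [MeasurableSpace 𝓔] in
/-- The marginal effect of a policy along which the outcome is linearized by `ṁ`. -/
lemma isMarginalPolicyEffect_density {Γ : (ℝ → ℝ) → B} {𝓓 : Set (ℝ → ℝ)} {dΓ : (ℝ → ℝ) → B}
    {π : ℝ → ℝ → ℝ} (hY : Measurable Y) (hYo : ∀ ω, Y ω = outcome m D X ε ω)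
    (hmDot : Measurable fun ω => mDot m π (D ω) (X ω) (ε ω))
    (hlin : ∀ ν : ℝ, 0 < ν → (fun t : ℝ => P.real {ω | ν * t ≤
      |m (π t (D ω)) (X ω) (ε ω) - m (D ω) (X ω) (ε ω) - t * mDot m π (D ω) (X ω) (ε ω)|})
        =o[𝓝[>] 0] fun t => t)
    {f : ℝ → ℝ → ℝ} {g : ℝ → ℝ} {C : ℝ} (hg : IsDominating g)
    (hf : IsDominatedDensity (P.map fun ω => (Y ω, mDot m π (D ω) (X ω) (ε ω))) f g C)
    (hc : ∀ z, UniformContinuous fun y => f y z)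
    (h𝓓 : ∀ t ∈ Icc (0 : ℝ) 1, counterfactualCdf P D X ε m π t ∈ 𝓓)
    (hΓ : HasHadamardDerivAt Γ 𝓓 (cdfOf P Y) boundedContinuous dΓ) :
    IsMarginalPolicyEffect Γ (cdfOf P Y) (counterfactualCdf P D X ε m π)
      (dΓ fun y => -∫ z, z * f y z) := by
  refine hΓ.isMarginalPolicyEffect h𝓓 (c := 1) (fun t y => ?_) ?_ ?_
  · have h1 : ∀ s : Set Ω, 0 ≤ P.real s ∧ P.real s ≤ 1 := fun s =>
      ⟨measureReal_nonneg, measureReal_le_one⟩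
    rw [abs_le]
    have := h1 {ω | outcome m (fun ω => π t (D ω)) X ε ω ≤ y}
    have := h1 {ω | Y ω ≤ y}
    simp only [counterfactualCdf, cdfOf]
    constructor <;> linarith
  · refine ⟨(hf.continuous_integral_mul (fun z => (hc z).continuous) measurable_id hg.2).neg,
      |C| * ∫ z, |z * g z|, fun y => ?_⟩
    rw [abs_neg]
    exact hf.abs_integral_mul_le hg.2 y
  · have := tendsto_cdf_quotient (U := Y) (M := fun ω => mDot m π (D ω) (X ω) (ε ω))
      (Ut := fun t ω => m (π t (D ω)) (X ω) (ε ω)) hY hmDot hf hg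
      (fun ν hν => by
        have := hlin ν hν
        simpa only [hYo, outcome] using this) (l := ⊤) (fun z => ?_)
    · simp only [sub_neg_eq_add]
      exact this
    -- Convergence along the filter `⊤` in y is uniform convergence; this is what uniform continuity
    -- of the density provides.
    · rw [Metric.tendsto_nhds]
      intro e he
      obtain ⟨δ, hδ, h⟩ := Metric.uniformContinuous_iff.1 (hc z) e he
      filter_upwards [(Metric.ball_mem_nhds (0 : ℝ) hδ : Metric.ball (0 : ℝ) δ ∈ 𝓝 0)
        |> fun hb => prod_mem_prod hb (univ_mem : (univ : Set ℝ) ∈ ⊤)] with q hq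
      rw [dist_zero_right, ← dist_eq_norm]
      refine h ?_
      rw [dist_eq_norm, add_sub_cancel_left, ← dist_zero_right]
      exact hq.1

end MarginalEffect

end PolicyEffect

namespace PolicyEffect

/-! ### Quantiles of continuous functions with limits 0 and 1 -/

section Quantile

lemma bddBelow_setOf_le {H : ℝ → ℝ} (hbot : Tendsto H atBot (𝓝 0)) {τ : ℝ} (h0 : 0 < τ) :
    BddBelow {d | τ ≤ H d} := by
  obtain ⟨a, ha⟩ := eventually_atBot.1 (hbot.eventually_lt_const h0)
  refine ⟨a, fun d hd => ?_⟩
  by_contra hlt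
  exact absurd (ha d (not_le.1 hlt).le) (not_lt.2 hd)

lemma nonempty_setOf_le {H : ℝ → ℝ} (htop : Tendsto H atTop (𝓝 1)) {τ : ℝ} (h1 : τ < 1) :
    {d | τ ≤ H d}.Nonempty := by
  obtain ⟨a, ha⟩ := (htop.eventually_const_lt h1).exists
  exact ⟨a, ha.le⟩

/-- The superlevel set is closed, so it contains its infimum, and every point to the left has a
value at most τ. Monotonicity of `H` plays no role. -/
lemma apply_quantile {H : ℝ → ℝ} (hc : Continuous H) (hbot : Tendsto H atBot (𝓝 0))
    (htop : Tendsto H atTop (𝓝 1)) {τ : ℝ} (h0 : 0 < τ) (h1 : τ < 1) : H (quantile H τ) = τ := by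
  have hb := bddBelow_setOf_le hbot h0
  have hcl : IsClosed {d | τ ≤ H d} := isClosed_le continuous_const hc
  refine le_antisymm ?_ (hcl.csInf_mem (nonempty_setOf_le htop h1) hb)
  refine le_of_tendsto ((hc.tendsto (quantile H τ)).mono_left
    (nhdsWithin_le_nhds (s := Iio (quantile H τ)))) ?_
  filter_upwards [self_mem_nhdsWithin] with e he
  by_contra hlt
  exact absurd (csInf_le hb (show e ∈ {d | τ ≤ H d} from (not_le.1 hlt).le)) (not_le.2 he)

lemma exists_apply_eq {H : ℝ → ℝ} (hc : Continuous H) (hbot : Tendsto H atBot (𝓝 0))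
    (htop : Tendsto H atTop (𝓝 1)) {τ : ℝ} (h0 : 0 < τ) (h1 : τ < 1) : ∃ d, H d = τ :=
  ⟨_, apply_quantile hc hbot htop h0 h1⟩

end Quantile

/-! ### The distribution function of D and its support -/

section Baseline

variable {Ω : Type*} [MeasurableSpace Ω] {P : Measure Ω} [IsProbabilityMeasure P] {D : Ω → ℝ}

lemma cdfOf_eq_cdf (hD : Measurable D) : cdfOf P D = cdf (P.map D) := by
  have := Measure.isProbabilityMeasure_map (μ := P) hD.aemeasurable
  ext d
  rw [cdf_eq_real, map_measureReal_apply hD measurableSet_Iic]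
  rfl

lemma monotone_cdfOf (hD : Measurable D) : Monotone (cdfOf P D) := by
  rw [cdfOf_eq_cdf hD]; exact monotone_cdf _

lemma tendsto_cdfOf_atBot (hD : Measurable D) : Tendsto (cdfOf P D) atBot (𝓝 0) := by
  rw [cdfOf_eq_cdf hD]; exact tendsto_cdf_atBot _

lemma tendsto_cdfOf_atTop (hD : Measurable D) : Tendsto (cdfOf P D) atTop (𝓝 1) := by
  rw [cdfOf_eq_cdf hD]; exact tendsto_cdf_atTop _

omit [IsProbabilityMeasure P] in
lemma cdfOf_nonneg (d : ℝ) : 0 ≤ cdfOf P D d := measureReal_nonneg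

lemma cdfOf_le_one (d : ℝ) : cdfOf P D d ≤ 1 := measureReal_le_one

/-- The points at which the distribution function of `D` takes a value in `(0, 1)`. -/
def interiorRange (P : Measure Ω) (D : Ω → ℝ) : Set ℝ := {d | 0 < cdfOf P D d ∧ cdfOf P D d < 1}

lemma eq_zero_or_one_of_notMem {d : ℝ} (hd : d ∉ interiorRange P D) :
    cdfOf P D d = 0 ∨ cdfOf P D d = 1 := by
  by_contra h
  push Not at h
  exact hd ⟨lt_of_le_of_ne (cdfOf_nonneg d) h.1.symm, lt_of_le_of_ne (cdfOf_le_one d) h.2⟩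

omit [IsProbabilityMeasure P] in
lemma isOpen_interiorRange (hc : Continuous (cdfOf P D)) : IsOpen (interiorRange P D) :=
  (isOpen_lt continuous_const hc).inter (isOpen_lt hc continuous_const)

lemma measureReal_Ioc_eq (hD : Measurable D) {a b : ℝ} (hab : a ≤ b) :
    (P.map D).real (Ioc a b) = cdfOf P D b - cdfOf P D a := by
  have := Measure.isProbabilityMeasure_map (μ := P) hD.aemeasurable
  rw [cdfOf_eq_cdf hD, cdf_eq_real, cdf_eq_real, ← Iic_union_Ioc_eq_Iic hab,
    measureReal_union (s₁ := Iic a) (s₂ := Ioc a b)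
      (Set.disjoint_left.2 fun r hr hr' => not_lt.2 hr hr'.1) measurableSet_Ioc]
  ring

lemma measure_Iic_eq_zero (hD : Measurable D) {d : ℝ} (hd : cdfOf P D d = 0) :
    P.map D (Iic d) = 0 := by
  have := Measure.isProbabilityMeasure_map (μ := P) hD.aemeasurable
  rw [cdfOf_eq_cdf hD, cdf_eq_real] at hd
  exact (measureReal_eq_zero_iff).1 hd

lemma measure_Ioi_eq_zero (hD : Measurable D) {d : ℝ} (hd : cdfOf P D d = 1) :
    P.map D (Ioi d) = 0 := by
  have := Measure.isProbabilityMeasure_map (μ := P) hD.aemeasurable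
  rw [cdfOf_eq_cdf hD, cdf_eq_real] at hd
  rw [← compl_Iic]
  refine (measureReal_eq_zero_iff).1 ?_
  rw [probReal_compl_eq_one_sub measurableSet_Iic, hd, sub_self]

/-- The sets where F_D is 0 or 1 are half-lines, locally null away from their endpoints. The
endpoint of {F_D = 0} lies in a null closed half-line; that of {F_D = 1} needs the absence of atoms.
-/
lemma ae_mem_interiorRange (hD : Measurable D) (hc : Continuous (cdfOf P D)) :
    ∀ᵐ d ∂(P.map D), d ∈ interiorRange P D := by
  have hP := Measure.isProbabilityMeasure_map (μ := P) hD.aemeasurable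
  have hna : NullSingletonClass (P.map D) :=
    nullSingletonClass_of_continuous_cdf (by rwa [← cdfOf_eq_cdf hD])
  have h0 : P.map D {d | cdfOf P D d = 0} = 0 := by
    refine measure_null_of_locally_null _ fun x hx => ?_
    by_cases h : ∃ x', x < x' ∧ cdfOf P D x' = 0
    · obtain ⟨x', hlt, h0⟩ := h
      exact ⟨Iic x', mem_nhdsWithin_of_mem_nhds (Iic_mem_nhds hlt), measure_Iic_eq_zero hD h0⟩
    · push Not at h
      refine ⟨Iic x, mem_nhdsWithin.2 ⟨univ, isOpen_univ, mem_univ _, fun s hs => ?_⟩,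
        measure_Iic_eq_zero hD hx⟩
      exact le_of_not_gt fun hlt => h s hlt hs.2
  have h1 : P.map D {d | cdfOf P D d = 1} = 0 := by
    refine measure_null_of_locally_null _ fun x hx => ?_
    by_cases h : ∃ x', x' < x ∧ cdfOf P D x' = 1
    · obtain ⟨x', hlt, h0⟩ := h
      exact ⟨Ioi x', mem_nhdsWithin_of_mem_nhds (Ioi_mem_nhds hlt), measure_Ioi_eq_zero hD h0⟩
    · push Not at h
      refine ⟨Ici x, mem_nhdsWithin.2 ⟨univ, isOpen_univ, mem_univ _, fun s hs => ?_⟩, ?_⟩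
      · exact le_of_not_gt fun hlt => h s hlt hs.2
      · rw [measure_congr (Ioi_ae_eq_Ici (μ := P.map D)).symm]
        exact measure_Ioi_eq_zero hD hx
  filter_upwards [measure_eq_zero_iff_ae_notMem.1 h0, measure_eq_zero_iff_ae_notMem.1 h1]
    with d h0 h1
  by_contra h
  exact (eq_zero_or_one_of_notMem h).elim h0 h1

/-- If F_D were constant on [e, d], the quantile at F_D(d) would be at most e. Thus π_0 = id forces
strict increase. -/
lemma cdfOf_lt_of_lt (hD : Measurable D)
    (hq : ∀ d ∈ interiorRange P D, quantile (cdfOf P D) (cdfOf P D d) = d) {e d : ℝ}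
    (hd : d ∈ interiorRange P D) (hed : e < d) : cdfOf P D e < cdfOf P D d := by
  by_contra hlt
  have := csInf_le (bddBelow_setOf_le (tendsto_cdfOf_atBot hD) hd.1)
    (show e ∈ {x | cdfOf P D d ≤ cdfOf P D x} from not_lt.1 hlt)
  have h2 := hq d hd
  rw [quantile] at h2
  linarith

/-- Strict increase gives every interval (e, x] ending in the open set `interiorRange` positive
mass, so that this whole open set lies in the support. -/
lemma suppOf_mem_nhds (hD : Measurable D) (hc : Continuous (cdfOf P D))
    (hq : ∀ d ∈ interiorRange P D, quantile (cdfOf P D) (cdfOf P D d) = d) {d : ℝ}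
    (hd : d ∈ interiorRange P D) : suppOf P D ∈ 𝓝 d := by
  have := Measure.isProbabilityMeasure_map (μ := P) hD.aemeasurable
  refine mem_of_superset ((isOpen_interiorRange hc).mem_nhds hd) fun x hx => ?_
  rw [suppOf, Measure.mem_support_iff_forall]
  intro U hU
  obtain ⟨e, he, hIoc⟩ := exists_Ioc_subset_of_mem_nhds hU ⟨x - 1, by linarith⟩
  refine lt_of_lt_of_le ?_ (measure_mono hIoc)
  rw [pos_iff_ne_zero, ← measureReal_ne_zero_iff, measureReal_Ioc_eq hD he.le]
  have := cdfOf_lt_of_lt hD hq hx he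
  linarith

lemma suppOf_subset_closure (hD : Measurable D) (hc : Continuous (cdfOf P D)) :
    suppOf P D ⊆ closure (interiorRange P D) :=
  Measure.support_subset_of_isClosed isClosed_closure
    (by filter_upwards [ae_mem_interiorRange hD hc] with d hd using subset_closure hd)

/-- Exhaustion of the support by compact intervals inside `interiorRange`. -/
lemma exists_clamp (hD : Measurable D) (hc : Continuous (cdfOf P D)) :
    ∃ a b : ℕ → ℝ, (∀ n, a n ≤ b n) ∧ (∀ n, Icc (a n) (b n) ⊆ interiorRange P D) ∧
      (∀ d ∈ interiorRange P D, ∀ᶠ n in atTop, a n < d ∧ d < b n) ∧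
      ∀ d ∈ suppOf P D, Tendsto (fun n => max (a n) (min d (b n))) atTop (𝓝 d) := by
  -- The endpoints are taken at levels 1/(n+3) and 1 - 1/(n+3); with 3 the two levels are already
  -- separated at n = 0.
  have hp : ∀ n : ℕ, (0 : ℝ) < 1 / (n + 3) ∧ (1 : ℝ) / (n + 3) ≤ 1 / 3 := fun n =>
    ⟨by positivity, one_div_le_one_div_of_le (by norm_num) (by linarith [n.cast_nonneg (α := ℝ)])⟩
  have hex := fun {τ : ℝ} => exists_apply_eq (τ := τ) hc (tendsto_cdfOf_atBot hD)
    (tendsto_cdfOf_atTop hD)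
  choose a ha using fun n : ℕ => hex (hp n).1 (by linarith [(hp n).2])
  choose b hb using fun n : ℕ => hex (τ := 1 - 1 / ((n : ℝ) + 3)) (by linarith [(hp n).2])
    (by linarith [(hp n).1])
  have hmono := monotone_cdfOf (P := P) hD
  have hlt : ∀ {x y : ℝ}, cdfOf P D x < cdfOf P D y → x < y := fun h => hmono.reflect_lt h
  have hab : ∀ n, a n < b n := fun n => hlt (by rw [ha, hb]; linarith [(hp n).2])
  have hsub : ∀ n, Icc (a n) (b n) ⊆ interiorRange P D := fun n x hx =>
    ⟨lt_of_lt_of_le (by rw [ha]; exact (hp n).1) (hmono hx.1),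
      lt_of_le_of_lt (hmono hx.2) (by rw [hb]; linarith [(hp n).1])⟩
  have hlim : Tendsto (fun n : ℕ => (1 : ℝ) / (n + 3)) atTop (𝓝 0) := by
    have := (tendsto_one_div_add_atTop_nhds_zero_nat (𝕜 := ℝ)).comp (tendsto_add_atTop_nat 2)
    refine this.congr fun n => ?_
    simp only [Function.comp]
    push_cast
    ring
  have hev : ∀ d ∈ interiorRange P D, ∀ᶠ n in atTop, a n < d ∧ d < b n := by
    intro d hd
    filter_upwards [hlim.eventually_lt_const hd.1,
      hlim.eventually_lt_const (sub_pos.2 hd.2)] with n h1 h2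
    exact ⟨hlt (by rw [ha]; exact h1), hlt (by rw [hb]; linarith)⟩
  refine ⟨a, b, fun n => (hab n).le, hsub, hev, fun d hd => ?_⟩
  rw [Metric.tendsto_nhds]
  intro r hr
  -- A support point may lie outside every interval. Once an interval contains a nearby x, clamping
  -- moves d by at most |d - x|.
  obtain ⟨x, hx, hdx⟩ := Metric.mem_closure_iff.1 (suppOf_subset_closure hD hc hd) r hr
  filter_upwards [hev x hx] with n hn
  refine lt_of_le_of_lt ?_ hdx
  rw [Real.dist_eq, Real.dist_eq]
  rcases le_total d (b n) with h1 | h1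
  · rw [min_eq_left h1]
    rcases le_total (a n) d with h2 | h2
    · rw [max_eq_right h2, sub_self, abs_zero]; exact abs_nonneg _
    · rw [max_eq_left h2, abs_of_nonneg (by linarith), abs_of_nonpos (by linarith)]; linarith
  · rw [min_eq_right h1, max_eq_right (hab n).le, abs_of_nonpos (by linarith),
      abs_of_nonneg (by linarith)]; linarith

end Baseline

/-! ### The policy derivative of a location shift -/

section Shift

variable {Ω : Type*} [MeasurableSpace Ω] {P : Measure Ω} [IsProbabilityMeasure P] {D : Ω → ℝ}
  {H : ℝ → ℝ → ℝ}

lemma policyDeriv_shift (hD : Measurable D)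
    (hq : ∀ d ∈ interiorRange P D, quantile (cdfOf P D) (cdfOf P D d) = d)
    (hH : ∀ t ∈ Icc (0 : ℝ) 1, ∀ d, H t d = cdfOf P D (d - t)) {d : ℝ}
    (hd : d ∈ interiorRange P D) : policyDeriv (policy (cdfOf P D) H) d = 1 := by
  have hset : ∀ t ∈ Icc (0 : ℝ) 1, policy (cdfOf P D) H t d = d + t := by
    intro t ht
    have : {x | cdfOf P D d ≤ H t x} = Ici (d + t) := by
      ext x
      change cdfOf P D d ≤ H t x ↔ d + t ≤ x
      rw [hH t ht]
      constructor
      · intro h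
        by_contra hlt
        exact absurd h (not_le.2 (cdfOf_lt_of_lt hD hq hd (by linarith)))
      · intro h
        exact monotone_cdfOf hD (by linarith)
    rw [policy, quantile, this, csInf_Ici]
  have hderiv : HasDerivWithinAt (fun t => policy (cdfOf P D) H t d) 1 (Icc 0 1) 0 :=
    (((hasDerivAt_id (0 : ℝ)).const_add d).hasDerivWithinAt).congr
      (fun t ht => by simpa using hset t ht) (by simpa using hset 0 (by simp))
  exact hderiv.derivWithin (uniqueDiffOn_Icc zero_lt_one 0 (by simp))

end Shift

/-! ### The policy derivative of a marginal perturbation -/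

section Perturbation

variable {Ω : Type*} [MeasurableSpace Ω] {P : Measure Ω} [IsProbabilityMeasure P] {D : Ω → ℝ}
  {H : ℝ → ℝ → ℝ} {γ : Measure ℝ}

/-- The perturbing distribution function agrees with `F_D` where `F_D ∈ {0, 1}`. -/
lemma cdf_eq_of_notMem (hD : Measurable D) (hc : Continuous (cdfOf P D))
    (hH1 : H 1 = cdf γ) (hγc : Continuous (cdf γ))
    (hsupp : suppOf P (fun ω => policy (cdfOf P D) H 1 (D ω)) ⊆ suppOf P D) {d : ℝ}
    (hd : d ∉ interiorRange P D) : cdf γ d = cdfOf P D d := by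
  have hP := Measure.isProbabilityMeasure_map (μ := P) hD.aemeasurable
  have hIm := (isOpen_interiorRange hc).measurableSet
  have hae := ae_mem_interiorRange hD hc
  have hmonoπ : MonotoneOn (policy (cdfOf P D) H 1) (interiorRange P D) := by
    intro x hx y hy hxy
    simp only [policy, quantile, hH1]
    exact csInf_le_csInf (bddBelow_setOf_le (tendsto_cdf_atBot γ) hx.1)
      (nonempty_setOf_le (tendsto_cdf_atTop γ) hy.2)
      fun z hz => (monotone_cdfOf hD hxy).trans hz
  -- Measurability is needed to conclude that D^1 almost surely lies in the support of its law.
  have hπm : AEMeasurable (fun ω => policy (cdfOf P D) H 1 (D ω)) P := by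
    have h1 := aemeasurable_restrict_of_monotoneOn (μ := P.map D) hIm hmonoπ
    rw [Measure.restrict_eq_self_of_ae_mem hae] at h1
    exact h1.comp_measurable hD
  have hmem : ∀ᵐ ω ∂P, D ω ∈ interiorRange P D ∧ policy (cdfOf P D) H 1 (D ω) ∈ suppOf P D := by
    filter_upwards [ae_of_ae_map hD.aemeasurable hae,
      ae_of_ae_map hπm Measure.support_mem_ae] with ω h1 h2 using ⟨h1, hsupp h2⟩
  rcases eq_zero_or_one_of_notMem hd with h0 | h1
  · rw [h0]
    by_contra hne
    have hpos : 0 < cdf γ d := lt_of_le_of_ne (cdf_nonneg γ d) (Ne.symm hne)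
    -- With positive probability F_D(D) ≤ τ < G_D(d). There D^1 = G_D⁻¹(F_D(D)) falls strictly below
    -- d, into a null open half-line, which contradicts the inclusion of supports.
    set τ := cdf γ d / 2 with hτ
    have hτ1 : τ < 1 := by linarith [cdf_le_one γ d]
    obtain ⟨s, hs⟩ := exists_apply_eq hc (tendsto_cdfOf_atBot hD) (tendsto_cdfOf_atTop hD)
      (by linarith : 0 < τ) hτ1
    have hPs : P {ω | D ω ≤ s} ≠ 0 := by
      rw [← measureReal_ne_zero_iff]
      have : P.real {ω | D ω ≤ s} = τ := hs
      rw [this]; linarith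
    have hfr := (frequently_ae_mem_iff.2 hPs).and_eventually hmem
    obtain ⟨ω, hωs, hωI, hωsupp⟩ := hfr.exists
    have hFτ : cdfOf P D (D ω) ≤ τ := hs ▸ monotone_cdfOf hD hωs
    have hlt : cdfOf P D (D ω) < cdf γ d := by linarith
    obtain ⟨d', hd', hdd'⟩ : ∃ d', cdfOf P D (D ω) < cdf γ d' ∧ d' < d :=
      (((hγc.tendsto d).mono_left nhdsWithin_le_nhds).eventually_const_lt hlt |>.and
        (self_mem_nhdsWithin (s := Iio d))).exists
    have hle : policy (cdfOf P D) H 1 (D ω) ≤ d' := by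
      rw [policy, quantile, hH1]
      exact csInf_le (bddBelow_setOf_le (tendsto_cdf_atBot γ) hωI.1) hd'.le
    have hnot := Measure.subset_compl_support_of_isOpen (μ := P.map D) isOpen_Iio
      (measure_mono_null Iio_subset_Iic_self (measure_Iic_eq_zero hD h0))
    exact hnot (show policy (cdfOf P D) H 1 (D ω) ∈ Iio d from lt_of_le_of_lt hle hdd') hωsupp
  · rw [h1]
    by_contra hne
    have hpos : cdf γ d < 1 := lt_of_le_of_ne (cdf_le_one γ d) hne
    -- The mirror image: with positive probability F_D(D) ≥ τ > G_D(d), which sends D^1 strictly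
    -- above d.
    set τ := (cdf γ d + 1) / 2 with hτ
    obtain ⟨s, hs⟩ := exists_apply_eq hc (tendsto_cdfOf_atBot hD) (tendsto_cdfOf_atTop hD)
      (by linarith [cdf_nonneg γ d] : 0 < τ) (by linarith)
    have hPs : P {ω | s < D ω} ≠ 0 := by
      intro h0
      have hall : P {ω | D ω ≤ s} = 1 := by
        rw [← mem_ae_iff_prob_eq_one (measurableSet_le hD measurable_const)]
        filter_upwards [measure_eq_zero_iff_ae_notMem.1 h0] with ω hω
        exact not_lt.1 hω
      have : cdfOf P D s = 1 := by
        rw [cdfOf, measureReal_def, hall]; rfl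
      linarith
    have hfr := (frequently_ae_mem_iff.2 hPs).and_eventually hmem
    obtain ⟨ω, hωs, hωI, hωsupp⟩ := hfr.exists
    have hωs' : s < D ω := hωs
    have hFτ : τ ≤ cdfOf P D (D ω) := hs ▸ monotone_cdfOf hD hωs'.le
    have hlt : cdf γ d < cdfOf P D (D ω) := by linarith
    obtain ⟨d', hd', hdd'⟩ : ∃ d', cdf γ d' < cdfOf P D (D ω) ∧ d < d' :=
      (((hγc.tendsto d).mono_left nhdsWithin_le_nhds).eventually_lt_const hlt |>.and
        (self_mem_nhdsWithin (s := Ioi d))).exists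
    have hle : d' ≤ policy (cdfOf P D) H 1 (D ω) := by
      rw [policy, quantile, hH1]
      refine le_csInf (nonempty_setOf_le (tendsto_cdf_atTop γ) hωI.2) fun e he => ?_
      by_contra hlt'
      exact absurd (hd'.trans_le (le_trans he (monotone_cdf γ (not_le.1 hlt').le))) (lt_irrefl _)
    have hnot := Measure.subset_compl_support_of_isOpen (μ := P.map D) isOpen_Ioi
      (measure_Ioi_eq_zero hD h1)
    exact hnot (show policy (cdfOf P D) H 1 (D ω) ∈ Ioi d from lt_of_lt_of_le hdd' hle) hωsupp

/-- The policy derivative of a marginal perturbation is `(F_D - G_D) / f_D`. -/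
lemma policyDeriv_perturbation (hD : Measurable D) (hc : Continuous (cdfOf P D))
    (hγc : Continuous (cdf γ))
    (hH : ∀ t ∈ Icc (0 : ℝ) 1, ∀ d, H t d = cdfOf P D d + t * (cdf γ d - cdfOf P D d))
    {d : ℝ} (hd : d ∈ interiorRange P D) (h0 : policy (cdfOf P D) H 0 d = d)
    (hdiff : DifferentiableWithinAt ℝ (fun t => policy (cdfOf P D) H t d) (Icc 0 1) 0)
    {F' : ℝ} (hF' : HasDerivAt (cdfOf P D) F' d) :
    F' * policyDeriv (policy (cdfOf P D) H) d = cdfOf P D d - cdf γ d := by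
  set p : ℝ → ℝ := fun t => policy (cdfOf P D) H t d with hp
  have hp' : HasDerivWithinAt p (policyDeriv (policy (cdfOf P D) H) d) (Icc 0 1) 0 :=
    hdiff.hasDerivWithinAt
  have hp0 : p 0 = d := h0
  -- The equation H_t(π_t(d)) = F_D(d), solved for F_D(π_t(d)). Its left side is differentiated by
  -- the chain rule; the slope of its right side at 0 is F_D - G_D at π_t(d), which needs only
  -- continuity.
  have heq : ∀ t ∈ Icc (0 : ℝ) 1, cdfOf P D (p t)
      = cdfOf P D d + t * (cdfOf P D (p t) - cdf γ (p t)) := by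
    intro t ht
    have hfun : H t = fun d => cdfOf P D d + t * (cdf γ d - cdfOf P D d) := funext (hH t ht)
    have hq := apply_quantile (H := H t) (by rw [hfun]; fun_prop)
      (by
        rw [hfun]
        simpa using (tendsto_cdfOf_atBot hD).add
          (((tendsto_cdf_atBot γ).sub (tendsto_cdfOf_atBot (P := P) hD)).const_mul t))
      (by
        rw [hfun]
        simpa using (tendsto_cdfOf_atTop hD).add
          (((tendsto_cdf_atTop γ).sub (tendsto_cdfOf_atTop (P := P) hD)).const_mul t)) hd.1 hd.2
    have : H t (p t) = cdfOf P D d := hq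
    rw [hH t ht] at this
    linarith
  have h1 : HasDerivWithinAt (fun t => cdfOf P D (p t))
      (F' * policyDeriv (policy (cdfOf P D) H) d) (Icc 0 1) 0 :=
    HasDerivAt.comp_hasDerivWithinAt (h₂ := cdfOf P D) (0 : ℝ) (by rw [hp0]; exact hF') hp'
  have h2 : HasDerivWithinAt (fun t => cdfOf P D (p t)) (cdfOf P D d - cdf γ d) (Icc 0 1) 0 := by
    rw [hasDerivWithinAt_iff_tendsto_slope]
    have hk : Tendsto (fun t => cdfOf P D (p t) - cdf γ (p t)) (𝓝[Icc 0 1] 0)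
        (𝓝 (cdfOf P D d - cdf γ d)) := by
      have := ((hc.sub hγc).tendsto (p 0)).comp hp'.continuousWithinAt
      rw [hp0] at this
      exact this
    refine (hk.mono_left (nhdsWithin_mono _ sdiff_subset)).congr' ?_
    filter_upwards [self_mem_nhdsWithin] with t ht
    have ht0 : t ≠ 0 := ht.2
    rw [slope_def_field, hp0]
    field_simp
    linarith [heq t ht.1]
  exact (uniqueDiffOn_Icc zero_lt_one 0 (by simp)).eq_deriv _ h1 h2

/-- Lebesgue differentiation. The density enters through `ENNReal.ofReal`, so only its positive part
is visible. -/
lemma ae_hasDerivAt_cdfOf (hD : Measurable D) {fD : ℝ → ℝ} (hfD : Measurable fD)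
    (hdens : P.map D = volume.withDensity (fun d => ENNReal.ofReal (fD d))) :
    ∀ᵐ d, HasDerivAt (cdfOf P D) (max (fD d) 0) d := by
  have hP := Measure.isProbabilityMeasure_map (μ := P) hD.aemeasurable
  have h1 := (cdf (P.map D)).ae_hasDerivAt
  rw [measure_cdf] at h1
  have h2 : (P.map D).rnDeriv volume =ᵐ[volume] fun d => ENNReal.ofReal (fD d) := by
    rw [hdens]
    exact Measure.rnDeriv_withDensity volume hfD.ennreal_ofReal
  filter_upwards [h1, h2] with d h1 h2
  rw [cdfOf_eq_cdf hD]
  rw [h2, ENNReal.toReal_ofReal'] at h1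
  exact h1

end Perturbation

end PolicyEffect

namespace PolicyEffect

/-! ### Measures determined by lower orthants -/

section Generate

variable {k : ℕ}

/-- Finite measures on `ℝ × ℝᵏ` which agree on the lower orthants with rational vertices
are equal. -/
lemma ext_of_Iic_prod_Iic {μ₁ μ₂ : Measure (ℝ × (Fin k → ℝ))} [IsFiniteMeasure μ₁]
    (h : ∀ (q : ℚ) (r : Fin k → ℚ), μ₁ (Iic (q : ℝ) ×ˢ Iic fun j => (r j : ℝ)) =
      μ₂ (Iic (q : ℝ) ×ˢ Iic fun j => (r j : ℝ))) : μ₁ = μ₂ := by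
  set C : Set (Set ℝ) := ⋃ a : ℚ, {Iic (a : ℝ)} with hC
  have hmem : ∀ n : ℕ, Iic (n : ℝ) ∈ C := fun n => mem_iUnion.2 ⟨n, by simp⟩
  have hspan : ⋃ n : ℕ, Iic (n : ℝ) = univ := by
    refine eq_univ_of_forall fun x => ?_
    obtain ⟨n, hn⟩ := exists_nat_ge x
    exact mem_iUnion.2 ⟨n, hn⟩
  have hCs : IsCountablySpanning C := ⟨fun n => Iic (n : ℝ), hmem, hspan⟩
  have hCg : MeasurableSpace.generateFrom C = (inferInstance : MeasurableSpace ℝ) := by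
    rw [← Real.borel_eq_generateFrom_Iic_rat]
    exact BorelSpace.measurable_eq.symm
  have hgen := generateFrom_eq_prod hCg (generateFrom_eq_pi (fun _ : Fin k => hCg) fun _ => hCs)
    hCs (IsCountablySpanning.pi fun _ => hCs)
  refine Measure.ext_of_generateFrom_of_iUnion _
    (fun n => Iic (n : ℝ) ×ˢ Iic fun _ : Fin k => (n : ℝ)) hgen.symm
    (Real.isPiSystem_Iic_rat.prod (IsPiSystem.pi fun _ => Real.isPiSystem_Iic_rat)) ?_ ?_
    (fun n => measure_ne_top _ _) ?_
  · refine eq_univ_of_forall fun p => ?_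
    obtain ⟨n, hn⟩ := exists_nat_ge (max p.1 ‖p.2‖)
    refine mem_iUnion.2 ⟨n, (le_max_left _ _).trans hn, fun j => ?_⟩
    exact ((le_abs_self _).trans (norm_le_pi_norm p.2 j)).trans ((le_max_right _ _).trans hn)
  · intro n
    exact ⟨_, hmem n, _, ⟨fun _ => Iic (n : ℝ), fun _ _ => hmem n, pi_univ_Iic _⟩, rfl⟩
  · rintro _ ⟨s, hs, _, ⟨t, ht, rfl⟩, rfl⟩
    obtain ⟨q, hq⟩ := mem_iUnion.1 hs
    have ht' : ∀ j, ∃ r : ℚ, t j = Iic (r : ℝ) := fun j => by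
      obtain ⟨r, hr⟩ := mem_iUnion.1 (ht j (mem_univ j))
      exact ⟨r, hr⟩
    choose r hr using ht'
    have h1 : s = Iic (q : ℝ) := hq
    have h2 : univ.pi t = Iic fun j => (r j : ℝ) := by
      rw [← pi_univ_Iic]; exact congrArg _ (funext hr)
    rw [h1, h2]
    exact h q r

end Generate

/-! ### Slices of a signed measure along the first variable -/

section Slices

variable {β : Type*} [MeasurableSpace β]

/-- The measure `B ↦ ν ((-∞, d] × B)`. -/
noncomputable def lowerSlice (ν : Measure (ℝ × β)) (d : ℝ) : Measure β :=
  (ν.restrict (Iic d ×ˢ univ)).map Prod.snd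

lemma lowerSlice_apply (ν : Measure (ℝ × β)) (d : ℝ) {B : Set β} (hB : MeasurableSet B) :
    lowerSlice ν d B = ν (Iic d ×ˢ B) := by
  rw [lowerSlice, Measure.map_apply measurable_snd hB,
    Measure.restrict_apply (measurable_snd hB)]
  congr 1
  ext p
  exact ⟨fun h => ⟨h.2.1, h.1⟩, fun h => ⟨h.2, h.1, mem_univ _⟩⟩

instance (ν : Measure (ℝ × β)) [IsFiniteMeasure ν] (d : ℝ) : IsFiniteMeasure (lowerSlice ν d) := by
  unfold lowerSlice; infer_instance

/-- `ν₁ - ν₂` has the lower slices `a d • K d`, for almost every `d`. -/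
def HasLowerSlices (ν₁ ν₂ : Measure (ℝ × β)) (K : Kernel ℝ β) (a : ℝ → ℝ) : Prop :=
  ∀ᵐ d, lowerSlice ν₁ d + ENNReal.ofReal (-a d) • K d =
    lowerSlice ν₂ d + ENNReal.ofReal (a d) • K d

/-- With the positive and negative parts of `a` on opposite sides, a signed identity becomes one
between nonnegative quantities, as `HasLowerSlices` requires. -/
lemma ofReal_eq_of_sub_eq {p q r a : ℝ} (hp : 0 ≤ p) (hq : 0 ≤ q) (hr : 0 ≤ r)
    (h : p - q = r * a) :
    ENNReal.ofReal p + ENNReal.ofReal (-a) * ENNReal.ofReal r =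
      ENNReal.ofReal q + ENNReal.ofReal a * ENNReal.ofReal r := by
  rw [← ENNReal.ofReal_mul' hr, ← ENNReal.ofReal_mul' hr]
  rcases le_total 0 a with ha | ha
  · rw [ENNReal.ofReal_of_nonpos (p := -a * r) (by nlinarith [mul_nonneg ha hr]), add_zero,
      ← ENNReal.ofReal_add hq (mul_nonneg ha hr)]
    congr 1; linarith
  · rw [ENNReal.ofReal_of_nonpos (p := a * r) (mul_nonpos_of_nonpos_of_nonneg ha hr), add_zero,
      ← ENNReal.ofReal_add hp (mul_nonneg (by linarith) hr)]
    congr 1; linarith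

/-- The lower slices of `ν₁ - ν₂` are determined by the values on the lower orthants. -/
lemma hasLowerSlices_of_Iic {k : ℕ} {ν₁ ν₂ : Measure (ℝ × ℝ × (Fin k → ℝ))} [IsFiniteMeasure ν₁]
    [IsFiniteMeasure ν₂] {K : Kernel ℝ (ℝ × (Fin k → ℝ))} [IsMarkovKernel K] {a : ℝ → ℝ}
    (h : ∀ v x, ∀ᵐ d, ν₁.real (Iic d ×ˢ Iic v ×ˢ Iic x) - ν₂.real (Iic d ×ˢ Iic v ×ˢ Iic x) =
      (K d).real (Iic v ×ˢ Iic x) * a d) : HasLowerSlices ν₁ ν₂ K a := by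
  have hall : ∀ᵐ d, ∀ (q : ℚ) (r : Fin k → ℚ),
      ν₁.real (Iic d ×ˢ Iic (q : ℝ) ×ˢ Iic fun j => (r j : ℝ)) -
        ν₂.real (Iic d ×ˢ Iic (q : ℝ) ×ˢ Iic fun j => (r j : ℝ)) =
      (K d).real (Iic (q : ℝ) ×ˢ Iic fun j => (r j : ℝ)) * a d := by
    rw [ae_all_iff]; intro q
    rw [ae_all_iff]; intro r
    exact h _ _
  filter_upwards [hall] with d hd
  have : IsFiniteMeasure (ENNReal.ofReal (-a d) • K d) :=
    Measure.smul_finite _ ENNReal.ofReal_ne_top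
  refine ext_of_Iic_prod_Iic fun q r => ?_
  have hB : MeasurableSet (Iic (q : ℝ) ×ˢ Iic fun j => (r j : ℝ)) :=
    measurableSet_Iic.prod measurableSet_Iic
  rw [Measure.add_apply, Measure.add_apply, Measure.smul_apply, Measure.smul_apply,
    lowerSlice_apply _ _ hB, lowerSlice_apply _ _ hB, smul_eq_mul, smul_eq_mul,
    ← ofReal_measureReal (μ := ν₁), ← ofReal_measureReal (μ := ν₂), ← ofReal_measureReal (μ := K d)]
  exact ofReal_eq_of_sub_eq measureReal_nonneg measureReal_nonneg measureReal_nonneg (hd q r)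

/-- Finite measures on `ℝ` whose distribution functions agree almost everywhere on an open set
agree on this set. -/
lemma restrict_eq_of_ae_Iic {τ₁ τ₂ : Measure ℝ} [IsFiniteMeasure τ₁] [IsFiniteMeasure τ₂]
    {O : Set ℝ} (hO : IsOpen O) (h : ∀ᵐ d, d ∈ O → τ₁ (Iic d) = τ₂ (Iic d)) :
    τ₁.restrict O = τ₂.restrict O := by
  have hright : ∀ (τ : Measure ℝ) [IsFiniteMeasure τ] (d : ℝ),
      Tendsto (fun s => τ (Iic s)) (𝓝[>] d) (𝓝 (τ (Iic d))) := by
    intro τ _ d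
    have := tendsto_measure_biInter_gt (μ := τ) (s := fun s : ℝ => Iic s) (a := d)
      (fun r _ => measurableSet_Iic.nullMeasurableSet) (fun i j _ hij => Iic_subset_Iic.2 hij)
      ⟨d + 1, by simp, measure_ne_top _ _⟩
    have hI : ⋂ r > d, Iic r = Iic d := by
      ext x
      simp only [mem_iInter, mem_Iic]
      exact ⟨fun hx => le_of_forall_gt_imp_ge_of_dense hx, fun hx r hr => hx.trans hr.le⟩
    rwa [hI] at this
  -- Points of equality accumulate at d from the right, and both distribution functions are right
  -- continuous.
  have hev : ∀ d ∈ O, τ₁ (Iic d) = τ₂ (Iic d) := by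
    intro d hd
    have hfr : ∃ᶠ s in 𝓝[>] d, τ₁ (Iic s) = τ₂ (Iic s) := by
      have hOd : ∀ᶠ s in 𝓝[>] d, s ∈ O := nhdsWithin_le_nhds (hO.mem_nhds hd)
      intro hcon
      obtain ⟨e, he, hsub⟩ := mem_nhdsGT_iff_exists_Ioo_subset.1 (hOd.and hcon)
      have hz : volume (Ioo d e) = 0 := by
        refine measure_mono_null (fun s hs => ?_) h
        exact fun hs' => (hsub hs).2 (hs' (hsub hs).1)
      rw [Real.volume_Ioo, ENNReal.ofReal_eq_zero] at hz
      have : d < e := he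
      linarith
    exact tendsto_nhds_unique_of_frequently_eq (hright τ₁ d) (hright τ₂ d) hfr
  have hIoc : ∀ p q : ℝ, Icc p q ⊆ O → τ₁.restrict (Ioc p q) = τ₂.restrict (Ioc p q) := by
    intro p q hpq
    refine Measure.ext_of_Iic _ _ fun x => ?_
    rw [Measure.restrict_apply measurableSet_Iic, Measure.restrict_apply measurableSet_Iic]
    rcases le_total p (min x q) with hp | hp
    · have hset : Iic x ∩ Ioc p q = Iic (min x q) \ Iic p := by
        ext s; simp only [mem_inter_iff, mem_Iic, mem_Ioc, Set.mem_sdiff, le_min_iff, not_le]; tauto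
      have hq : p ≤ q := hp.trans (min_le_right _ _)
      rw [hset, measure_sdiff (Iic_subset_Iic.2 hp) measurableSet_Iic.nullMeasurableSet
        (measure_ne_top _ _), measure_sdiff (Iic_subset_Iic.2 hp)
        measurableSet_Iic.nullMeasurableSet (measure_ne_top _ _),
        hev _ (hpq ⟨hp, min_le_right _ _⟩), hev _ (hpq ⟨le_rfl, hq⟩)]
    · have hset : Iic x ∩ Ioc p q = ∅ := by
        ext s
        simp only [mem_inter_iff, mem_Iic, mem_Ioc, mem_empty_iff_false, iff_false, not_and]
        intro h1 h2 h3
        exact absurd (le_min h1 h3) (not_le.2 (hp.trans_lt h2))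
      rw [hset, measure_empty, measure_empty]
  have hcov : O = ⋃ pq : {pq : ℚ × ℚ // Icc (pq.1 : ℝ) pq.2 ⊆ O}, Ioc (pq.1.1 : ℝ) pq.1.2 := by
    refine Subset.antisymm (fun x hx => ?_) (iUnion_subset fun pq =>
      Ioc_subset_Icc_self.trans pq.2)
    obtain ⟨r, hr, hball⟩ := Metric.isOpen_iff.1 hO x hx
    obtain ⟨p, hp1, hp2⟩ := exists_rat_btwn (show x - r < x by linarith)
    obtain ⟨q, hq1, hq2⟩ := exists_rat_btwn (show x < x + r by linarith)
    refine mem_iUnion.2 ⟨⟨(p, q), fun s hs => hball ?_⟩, hp2, hq1.le⟩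
    rw [Real.ball_eq_Ioo]
    exact ⟨hp1.trans_le hs.1, hs.2.trans_lt hq2⟩
  rw [hcov, Measure.restrict_iUnion_congr]
  exact fun pq => hIoc _ _ pq.2

/-- Mutually singular measures whose lower slices agree on `O × W` vanish there. -/
lemma measure_prod_eq_zero {ν₁ ν₂ : Measure (ℝ × β)} [IsFiniteMeasure ν₁] [IsFiniteMeasure ν₂]
    (hsing : ν₁ ⟂ₘ ν₂) {O : Set ℝ} (hO : IsOpen O) {W : Set β} (hW : MeasurableSet W)
    (h : ∀ᵐ d, d ∈ O → ∀ B, MeasurableSet B → B ⊆ W → lowerSlice ν₁ d B = lowerSlice ν₂ d B) :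
    ν₁ (O ×ˢ W) = 0 ∧ ν₂ (O ×ˢ W) = 0 := by
  have hOW : MeasurableSet (O ×ˢ W) := hO.measurableSet.prod hW
  have hfib : ∀ (ν : Measure (ℝ × β)) {t : Set β} {s : Set ℝ}, MeasurableSet t → MeasurableSet s →
      (ν.restrict (univ ×ˢ t)).map Prod.fst s = ν (s ×ˢ t) := by
    intro ν t s ht hs
    rw [Measure.map_apply measurable_fst hs, Measure.restrict_apply (measurable_fst hs)]
    congr 1
    ext p
    exact ⟨fun h => ⟨h.1, h.2.2⟩, fun h => ⟨h.1, mem_univ _, h.2⟩⟩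
  -- The restrictions coincide and remain mutually singular, so each is singular to itself and
  -- vanishes.
  have heq : ν₁.restrict (O ×ˢ W) = ν₂.restrict (O ×ˢ W) := by
    refine Measure.ext_prod fun {s t} hs ht => ?_
    rw [Measure.restrict_apply (hs.prod ht), Measure.restrict_apply (hs.prod ht),
      prod_inter_prod]
    have htW := ht.inter hW
    have := restrict_eq_of_ae_Iic (τ₁ := (ν₁.restrict (univ ×ˢ (t ∩ W))).map Prod.fst)
      (τ₂ := (ν₂.restrict (univ ×ˢ (t ∩ W))).map Prod.fst) hO (by
        filter_upwards [h] with d hd hdO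
        rw [hfib _ htW measurableSet_Iic, hfib _ htW measurableSet_Iic,
          ← lowerSlice_apply _ _ htW, ← lowerSlice_apply _ _ htW]
        exact hd hdO _ htW inter_subset_right)
    have h2 := congrArg (fun τ => τ s) this
    simp only [Measure.restrict_apply hs] at h2
    rwa [hfib _ htW (hs.inter hO.measurableSet), hfib _ htW (hs.inter hO.measurableSet)] at h2
  have hs1 : ν₁.restrict (O ×ˢ W) ⟂ₘ ν₂.restrict (O ×ˢ W) :=
    hsing.mono_ac Measure.restrict_le_self.absolutelyContinuous
      Measure.restrict_le_self.absolutelyContinuous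
  constructor
  · rw [← heq, Measure.MutuallySingular.self_iff] at hs1
    exact Measure.restrict_eq_zero.1 hs1
  · rw [heq, Measure.MutuallySingular.self_iff] at hs1
    exact Measure.restrict_eq_zero.1 hs1

variable {ν₁ ν₂ : Measure (ℝ × β)} [IsFiniteMeasure ν₁] [IsFiniteMeasure ν₂] {K : Kernel ℝ β}
  {a : ℝ → ℝ}

/-- If the integrator vanishes off `S` and `K` is concentrated on `W`, then so is the signed
measure on `S × W`. -/
lemma HasLowerSlices.measure_compl_eq_zero (hsl : HasLowerSlices ν₁ ν₂ K a)
    (hsing : ν₁ ⟂ₘ ν₂) {S : Set ℝ} (hS : IsClosed S) (haS : ∀ d, d ∉ S → a d = 0)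
    {W : Set β} (hW : MeasurableSet W) (hKW : ∀ᵐ d, a d ≠ 0 → K d Wᶜ = 0) :
    ν₁ (S ×ˢ W)ᶜ = 0 ∧ ν₂ (S ×ˢ W)ᶜ = 0 := by
  have h1 := measure_prod_eq_zero hsing isOpen_univ hW.compl (by
    filter_upwards [hsl, hKW] with d hd hdK _ B hB hBW
    have h := congrArg (fun μ => μ B) hd
    simp only [Measure.add_apply, Measure.smul_apply, smul_eq_mul] at h
    by_cases ha : a d = 0
    · simpa [ha] using h
    · simpa [measure_mono_null hBW (hdK ha)] using h)
  have h2 := measure_prod_eq_zero hsing hS.isOpen_compl MeasurableSet.univ (by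
    filter_upwards [hsl] with d hd hdS B hB _
    have h := congrArg (fun μ => μ B) hd
    simpa [haS d hdS] using h)
  have hsub : (S ×ˢ W)ᶜ ⊆ univ ×ˢ Wᶜ ∪ Sᶜ ×ˢ univ := by
    intro p hp
    by_cases hpW : p.2 ∈ W
    · exact Or.inr ⟨fun hpS => hp ⟨hpS, hpW⟩, mem_univ _⟩
    · exact Or.inl ⟨mem_univ _, hpW⟩
  exact ⟨measure_mono_null hsub (measure_union_null h1.1 h2.1),
    measure_mono_null hsub (measure_union_null h1.2 h2.2)⟩

/-- If the integrator vanishes at infinity, then the two measures have the same second marginal. -/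
lemma HasLowerSlices.map_snd_eq {ν₁ ν₂ : Measure (ℝ × β)} [IsMarkovKernel K] (hsl : HasLowerSlices ν₁ ν₂ K a)
    (ha : Tendsto a atTop (𝓝 0)) : ν₁.map Prod.snd = ν₂.map Prod.snd := by
  ext B hB
  rw [Measure.map_apply measurable_snd hB, Measure.map_apply measurable_snd hB]
  have hlim : ∀ ν : Measure (ℝ × β), Tendsto (fun d : ℝ => lowerSlice ν d B) atTop
      (𝓝 (ν (Prod.snd ⁻¹' B))) := by
    intro ν
    have hmono : Monotone fun d : ℝ => Iic d ×ˢ B := fun d e hde =>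
      prod_mono (Iic_subset_Iic.2 hde) le_rfl
    have := tendsto_measure_iUnion_atTop (μ := ν) hmono
    have hU : ⋃ d : ℝ, Iic d ×ˢ B = Prod.snd ⁻¹' B := by
      ext p
      simp only [mem_iUnion]
      exact ⟨fun ⟨d, hd⟩ => hd.2, fun hp => ⟨p.1, mem_Iic.2 le_rfl, hp⟩⟩
    rw [hU] at this
    exact this.congr fun d => (lowerSlice_apply ν d hB).symm
  have hK : ∀ b : ℝ → ℝ, Tendsto b atTop (𝓝 0) →
      Tendsto (fun d => ENNReal.ofReal (b d) * K d B) atTop (𝓝 0) := by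
    intro b hb
    have h0 : Tendsto (fun d => ENNReal.ofReal (b d)) atTop (𝓝 0) := by
      simpa using ENNReal.tendsto_ofReal hb
    refine tendsto_of_tendsto_of_tendsto_of_le_of_le tendsto_const_nhds h0 (fun _ => zero_le) fun d => ?_
    calc ENNReal.ofReal (b d) * K d B ≤ ENNReal.ofReal (b d) * 1 := by gcongr; exact prob_le_one
      _ = ENNReal.ofReal (b d) := mul_one _
  -- The slice identity holds only for almost every d, but a half-line has positive Lebesgue
  -- measure, so it holds at arbitrarily large d; that suffices to compare limits.
  have hfr : ∃ᶠ d in atTop, lowerSlice ν₁ d B + ENNReal.ofReal (-a d) * K d B =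
      lowerSlice ν₂ d B + ENNReal.ofReal (a d) * K d B := by
    intro hcon
    obtain ⟨d₀, hd₀⟩ := eventually_atTop.1 hcon
    have hz : volume (Ici d₀) = 0 := by
      refine measure_mono_null (fun s hs => ?_) hsl
      intro hs'
      refine hd₀ s hs ?_
      have h := congrArg (fun μ => μ B) hs'
      simpa using h
    simp at hz
  have hneg : Tendsto (fun d => -a d) atTop (𝓝 0) := by simpa using ha.neg
  have hfin := tendsto_nhds_unique_of_frequently_eq ((hlim ν₁).add (hK _ hneg))
    ((hlim ν₂).add (hK _ ha)) hfr
  simpa using hfin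

end Slices

end PolicyEffect

namespace PolicyEffect

/-! ### Integration by parts through Fubini -/

section Fubini

variable {β : Type*} [MeasurableSpace β] {ν₁ ν₂ : Measure (ℝ × β)} [IsFiniteMeasure ν₁]
  [IsFiniteMeasure ν₂] {K : Kernel ℝ β} {a : ℝ → ℝ}

lemma integral_lowerSlice (ν : Measure (ℝ × β)) (s : ℝ) {u : β → ℝ} (hu : Measurable u) :
    ∫ b, u b ∂(lowerSlice ν s) = ∫ p, (Ici p.1).indicator (fun _ => u p.2) s ∂ν := by
  rw [lowerSlice, integral_map measurable_snd.aemeasurable hu.aestronglyMeasurable,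
    ← integral_indicator (measurableSet_Iic.prod MeasurableSet.univ)]
  congr 1 with p
  by_cases h : p.1 ≤ s
  · rw [indicator_of_mem (show p ∈ Iic s ×ˢ univ from ⟨h, mem_univ _⟩), indicator_of_mem (mem_Ici.2 h)]
  · rw [indicator_of_notMem (show p ∉ Iic s ×ˢ univ from fun hp => h hp.1), indicator_of_notMem (mt mem_Ici.1 h)]

lemma integrable_lowerSlice_iff (ν : Measure (ℝ × β)) (s : ℝ) {u : β → ℝ} (hu : Measurable u) :
    Integrable u (lowerSlice ν s) ↔
      Integrable (fun p => (Ici p.1).indicator (fun _ => u p.2) s) ν := by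
  rw [lowerSlice, integrable_map_measure hu.aestronglyMeasurable measurable_snd.aemeasurable,
    ← IntegrableOn, ← integrable_indicator_iff (measurableSet_Iic.prod MeasurableSet.univ)]
  refine integrable_congr (Eventually.of_forall fun p => ?_)
  by_cases h : p.1 ≤ s
  · simp only [Function.comp_def]
    rw [indicator_of_mem (show p ∈ Iic s ×ˢ univ from ⟨h, mem_univ _⟩), indicator_of_mem (mem_Ici.2 h)]
  · simp only [Function.comp_def]
    rw [indicator_of_notMem (show p ∉ Iic s ×ˢ univ from fun hp => h hp.1), indicator_of_notMem (mt mem_Ici.1 h)]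

lemma integral_sub_eq_mul_of_add_eq {τ₁ τ₂ σ : Measure β} {a : ℝ}
    (h : τ₁ + ENNReal.ofReal (-a) • σ = τ₂ + ENNReal.ofReal a • σ) {u : β → ℝ}
    (h₁ : Integrable u τ₁) (h₂ : Integrable u τ₂) :
    ∫ b, u b ∂τ₁ - ∫ b, u b ∂τ₂ = a * ∫ b, u b ∂σ := by
  rcases le_total 0 a with ha | ha
  · rw [ENNReal.ofReal_of_nonpos (by linarith : -a ≤ 0), zero_smul, add_zero] at h
    rw [h] at h₁
    rw [h, integral_add_measure h₁.left_of_add_measure h₁.right_of_add_measure,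
      integral_smul_measure, ENNReal.toReal_ofReal ha, smul_eq_mul]
    ring
  · rw [ENNReal.ofReal_of_nonpos ha, zero_smul, add_zero] at h
    rw [← h] at h₂
    rw [← h, integral_add_measure h₂.left_of_add_measure h₂.right_of_add_measure,
      integral_smul_measure, ENNReal.toReal_ofReal (by linarith), smul_eq_mul]
    ring

/-- Integration by parts on a bounded interval. -/
lemma HasLowerSlices.integral_sub_integral (hsl : HasLowerSlices ν₁ ν₂ K a) {J : Set ℝ}
    {g : ℝ × β → ℝ} (hg : Measurable g) {N : ℝ}
    (hgi : ∀ b, IntegrableOn (fun s => g (s, b)) J) (hgN : ∀ b, ∫ s in J, |g (s, b)| ≤ N) :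
    ∫ p, (∫ s in J, (Ici p.1).indicator (fun s => g (s, p.2)) s) ∂ν₁ -
      ∫ p, (∫ s in J, (Ici p.1).indicator (fun s => g (s, p.2)) s) ∂ν₂ =
    ∫ s in J, a s * ∫ b, g (s, b) ∂(K s) := by
  have hgs : ∀ s, Measurable fun b => g (s, b) := fun s => hg.comp (by fun_prop)
  have hmeas : Measurable fun q : (ℝ × β) × ℝ =>
      (Ici q.1.1).indicator (fun s => g (s, q.1.2)) q.2 := by
    have hset : MeasurableSet {q : (ℝ × β) × ℝ | q.1.1 ≤ q.2} :=
      measurableSet_le (by fun_prop) (by fun_prop)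
    have h2 : Measurable fun q : (ℝ × β) × ℝ => g (q.2, q.1.2) := hg.comp (by fun_prop)
    exact h2.indicator hset
  have hint : ∀ (ν : Measure (ℝ × β)) [IsFiniteMeasure ν],
      Integrable (fun q : (ℝ × β) × ℝ => (Ici q.1.1).indicator (fun s => g (s, q.1.2)) q.2)
        (ν.prod (volume.restrict J)) := by
    intro ν _
    rw [integrable_prod_iff hmeas.aestronglyMeasurable]
    have hgp : ∀ p : ℝ × β, Integrable (fun s => (Ici p.1).indicator (fun s => g (s, p.2)) s)
        (volume.restrict J) := fun p => (hgi p.2).indicator measurableSet_Ici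
    refine ⟨Eventually.of_forall hgp, ?_⟩
    refine Integrable.of_bound (C := N)
      (hmeas.norm.stronglyMeasurable.integral_prod_right.aestronglyMeasurable)
      (Eventually.of_forall fun p => ?_)
    rw [Real.norm_of_nonneg (integral_nonneg fun _ => norm_nonneg _)]
    refine le_trans (integral_mono (hgp p).norm (hgi p.2).norm
      fun s => ?_) (hgN p.2)
    exact norm_indicator_le_norm_self _ _
  -- Interchanging the integrals turns the condition p.1 ≤ s into restriction to the slice at s,
  -- where the difference of the two measures is known.
  have hswap : ∀ (ν : Measure (ℝ × β)) [IsFiniteMeasure ν],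
      ∫ p, (∫ s in J, (Ici p.1).indicator (fun s => g (s, p.2)) s) ∂ν =
        ∫ s in J, ∫ b, g (s, b) ∂(lowerSlice ν s) := by
    intro ν _
    rw [integral_integral_swap (hint ν)]
    congr 1 with s
    rw [integral_lowerSlice ν s (hgs s)]
    rfl
  have hsi : ∀ (ν : Measure (ℝ × β)) [IsFiniteMeasure ν],
      ∀ᵐ s ∂(volume.restrict J), Integrable (fun b => g (s, b)) (lowerSlice ν s) := by
    intro ν _
    filter_upwards [(hint ν).prod_left_ae] with s hs
    rw [integrable_lowerSlice_iff ν s (hgs s)]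
    exact hs
  have hii : ∀ (ν : Measure (ℝ × β)) [IsFiniteMeasure ν],
      Integrable (fun s => ∫ b, g (s, b) ∂(lowerSlice ν s)) (volume.restrict J) := by
    intro ν _
    refine (hint ν).integral_prod_right.congr (Eventually.of_forall fun s => ?_)
    exact (integral_lowerSlice ν s
      (hgs s)).symm
  rw [hswap, hswap, ← integral_sub (hii ν₁) (hii ν₂)]
  refine integral_congr_ae ?_
  filter_upwards [hsi ν₁, hsi ν₂, ae_restrict_of_ae hsl] with s h1 h2 h3
  exact integral_sub_eq_mul_of_add_eq h3 h1 h2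

end Fubini

/-! ### Integration by parts on compact windows and their exhaustion -/

section Window

/-- The fundamental theorem of calculus, arranged so that d enters only through an indicator of s ≥
d over a fixed range of integration: the form needed for Fubini. -/
lemma apply_clamp {c e : ℝ} (hce : c ≤ e) {u u' : ℝ → ℝ}
    (hu : ∀ s ∈ Icc c e, HasDerivAt u (u' s) s) (hu' : ContinuousOn u' (Icc c e)) (d : ℝ) :
    u (max c (min d e)) = u e - ∫ s in Ioc c e, (Ici d).indicator u' s := by
  have hset : Ioc c e ∩ Ioi d = Ioc (max c (min d e)) e := by
    ext s
    simp only [mem_inter_iff, mem_Ioc, mem_Ioi, max_lt_iff, min_lt_iff]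
    constructor
    · rintro ⟨⟨h1, h2⟩, h3⟩; exact ⟨⟨h1, Or.inl h3⟩, h2⟩
    · rintro ⟨⟨h1, h2 | h2⟩, h3⟩
      · exact ⟨⟨h1, h3⟩, h2⟩
      · exact absurd h2 (not_lt.2 h3)
  have h1 : c ≤ max c (min d e) := le_max_left _ _
  have h2 : max c (min d e) ≤ e := max_le hce (min_le_right _ _)
  have hsub : uIcc (max c (min d e)) e ⊆ Icc c e := by
    rw [uIcc_of_le h2]; exact Icc_subset_Icc_left h1
  rw [setIntegral_indicator measurableSet_Ici,
    setIntegral_congr_set ((ae_eq_refl (Ioc c e)).inter (Ioi_ae_eq_Ici (a := d)).symm), hset,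
    ← intervalIntegral.integral_of_le h2,
    intervalIntegral.integral_eq_sub_of_hasDerivAt (fun s hs => hu s (hsub hs))
      (hu'.mono hsub).intervalIntegrable]
  ring

variable {β : Type*} [MeasurableSpace β] {ν₁ ν₂ : Measure (ℝ × β)} [IsFiniteMeasure ν₁]
  [IsFiniteMeasure ν₂] {K : Kernel ℝ β} [IsMarkovKernel K] {a : ℝ → ℝ}

/-- A weight `a = - w fD` turns the integral against `a(s) ds` into one against the law with
density `fD`. -/
lemma neg_setIntegral_eq {fD w : ℝ → ℝ} (hfD : Measurable fD)
    [IsFiniteMeasure (volume.withDensity fun d => ENNReal.ofReal (fD d))] {J : Set ℝ}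
    (hJ : MeasurableSet J) (haw : ∀ s ∈ J, 0 ≤ fD s ∧ a s = -(w s * fD s)) {g : ℝ × β → ℝ}
    (hg : Integrable (fun p : ℝ × β => J.indicator w p.1 * g p)
      ((volume.withDensity fun d => ENNReal.ofReal (fD d)) ⊗ₘ K)) :
    -∫ s in J, a s * ∫ b, g (s, b) ∂(K s) =
      ∫ p, J.indicator w p.1 * g p ∂((volume.withDensity fun d => ENNReal.ofReal (fD d)) ⊗ₘ K) := by
  rw [Measure.integral_compProd hg, integral_withDensity_eq_integral_toReal_smul
    (by fun_prop) (Eventually.of_forall fun _ => ENNReal.ofReal_lt_top), ← integral_neg,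
    ← integral_indicator hJ]
  congr 1 with s
  have hc : ∫ b, J.indicator w (s, b).1 * g (s, b) ∂(K s) =
      J.indicator w s * ∫ b, g (s, b) ∂(K s) := integral_const_mul (J.indicator w s) fun b => g (s, b)
  rw [hc]
  by_cases hs : s ∈ J
  · rw [indicator_of_mem hs, indicator_of_mem hs, (haw s hs).2,
      ENNReal.toReal_ofReal (haw s hs).1, smul_eq_mul]
    ring
  · rw [indicator_of_notMem hs, indicator_of_notMem hs]
    simp

/-- Integration by parts, after clamping the first variable to `[c, e]`. -/
lemma HasLowerSlices.integral_clamp (hsl : HasLowerSlices ν₁ ν₂ K a)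
    (hsnd : ν₁.map Prod.snd = ν₂.map Prod.snd) {W : Set β} (hW : MeasurableSet W)
    {φ g : ℝ × β → ℝ} (hφ : Measurable φ) (hφ1 : ∀ p, |φ p| ≤ 1) (hg : Measurable g) {c e : ℝ}
    (hce : c ≤ e) (hφg : ∀ b ∈ W, ∀ s ∈ Icc c e, HasDerivAt (fun s => φ (s, b)) (g (s, b)) s)
    (hgc : ∀ b ∈ W, ContinuousOn (fun s => g (s, b)) (Icc c e))
    {fD w : ℝ → ℝ} (hfD : Measurable fD) (hw : Measurable w)
    [IsFiniteMeasure (volume.withDensity fun d => ENNReal.ofReal (fD d))]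
    (haw : ∀ s ∈ Icc c e, 0 ≤ fD s ∧ a s = -(w s * fD s)) {A : ℝ}
    (hA : ∀ᵐ p ∂((volume.withDensity fun d => ENNReal.ofReal (fD d)) ⊗ₘ K),
      |w p.1 * g p| ≤ A) :
    ∫ p, W.indicator (fun b => φ (max c (min p.1 e), b)) p.2 ∂ν₁ -
      ∫ p, W.indicator (fun b => φ (max c (min p.1 e), b)) p.2 ∂ν₂ =
    ∫ p, (Ioc c e).indicator w p.1 * W.indicator (fun b => g (p.1, b)) p.2
      ∂((volume.withDensity fun d => ENNReal.ofReal (fD d)) ⊗ₘ K) := by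
  set μD := volume.withDensity fun d => ENNReal.ofReal (fD d) with hμD
  set J := Ioc c e with hJ
  -- the truncation
  have hTm : Measurable fun b => ∫ s in J, |g (s, b)| := by
    have : Measurable fun q : β × ℝ => |g (q.2, q.1)| := by fun_prop
    exact (this.stronglyMeasurable.integral_prod_right (ν := volume.restrict J)).measurable
  -- The integral of |g(·, b)| over the window is finite for each b in `W`, but without a uniform
  -- bound; Fubini is applied on `T N` and N → ∞ afterwards.
  set T : ℕ → Set β := fun N => W ∩ {b | ∫ s in J, |g (s, b)| ≤ N} with hT
  have hTmeas : ∀ N, MeasurableSet (T N) := fun N => hW.inter (measurableSet_le hTm measurable_const)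
  have hTW : ∀ N, T N ⊆ W := fun N => inter_subset_left
  have hTev : ∀ b ∈ W, ∀ᶠ N in atTop, b ∈ T N := by
    intro b hb
    obtain ⟨N₀, hN₀⟩ := exists_nat_ge (∫ s in J, |g (s, b)|)
    filter_upwards [eventually_ge_atTop N₀] with N hN
    exact ⟨hb, hN₀.trans (by exact_mod_cast hN)⟩
  have hclamp : Measurable fun p : ℝ × β => φ (max c (min p.1 e), p.2) := by fun_prop
  have hlimφ : ∀ (ν : Measure (ℝ × β)) [IsFiniteMeasure ν],
      Tendsto (fun N => ∫ p, (T N).indicator (fun b => φ (max c (min p.1 e), b)) p.2 ∂ν) atTop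
        (𝓝 (∫ p, W.indicator (fun b => φ (max c (min p.1 e), b)) p.2 ∂ν)) := by
    intro ν _
    refine tendsto_integral_of_dominated_convergence (fun _ => 1) (fun N => ?_)
      (integrable_const _) (fun N => Eventually.of_forall fun p => ?_)
      (Eventually.of_forall fun p => ?_)
    · exact (hclamp.indicator (measurable_snd (hTmeas N))).aestronglyMeasurable
    · exact (norm_indicator_le_norm_self _ _).trans (hφ1 _)
    · by_cases hp : p.2 ∈ W
      · refine tendsto_const_nhds.congr' ?_
        filter_upwards [hTev _ hp] with N hN
        rw [indicator_of_mem hN, indicator_of_mem hp]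
      · refine tendsto_const_nhds.congr fun N => ?_
        rw [indicator_of_notMem hp, indicator_of_notMem fun h => hp (hTW N h)]
  have hgm : ∀ {U : Set β}, MeasurableSet U →
      Measurable fun p : ℝ × β => U.indicator (fun b => g (p.1, b)) p.2 := fun {U} hU =>
    hg.indicator (measurable_snd hU)
  have hqm : ∀ {U : Set β}, MeasurableSet U → Measurable fun p : ℝ × β =>
      J.indicator w p.1 * U.indicator (fun b => g (p.1, b)) p.2 := fun {U} hU =>
    ((hw.indicator measurableSet_Ioc).comp measurable_fst).mul (hgm hU)
  have hqA : ∀ U : Set β, ∀ᵐ p ∂(μD ⊗ₘ K),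
      ‖J.indicator w p.1 * U.indicator (fun b => g (p.1, b)) p.2‖ ≤ A := by
    intro U
    filter_upwards [hA] with p hp
    refine le_trans ?_ hp
    rw [← Real.norm_eq_abs, norm_mul, norm_mul]
    exact mul_le_mul (norm_indicator_le_norm_self _ _) (norm_indicator_le_norm_self _ _)
      (norm_nonneg _) (norm_nonneg _)
  have hlimg : Tendsto (fun N => ∫ p, J.indicator w p.1 *
      (T N).indicator (fun b => g (p.1, b)) p.2 ∂(μD ⊗ₘ K)) atTop
      (𝓝 (∫ p, J.indicator w p.1 * W.indicator (fun b => g (p.1, b)) p.2 ∂(μD ⊗ₘ K))) := by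
    refine tendsto_integral_of_dominated_convergence (fun _ => A)
      (fun N => (hqm (hTmeas N)).aestronglyMeasurable)
      (integrable_const _) (fun N => hqA _) (Eventually.of_forall fun p => ?_)
    by_cases hp : p.2 ∈ W
    · refine tendsto_const_nhds.congr' ?_
      filter_upwards [hTev _ hp] with N hN
      rw [indicator_of_mem hN, indicator_of_mem hp]
    · refine tendsto_const_nhds.congr fun N => ?_
      rw [indicator_of_notMem hp, indicator_of_notMem fun h => hp (hTW N h)]
  refine tendsto_nhds_unique ((hlimφ ν₁).sub (hlimφ ν₂)) (hlimg.congr fun N => ?_)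
  -- the identity for the truncated functions
  set gN : ℝ × β → ℝ := fun p => (T N).indicator (fun b => g (p.1, b)) p.2 with hgN
  have hgi : ∀ b, IntegrableOn (fun s => gN (s, b)) J := by
    intro b
    by_cases hb : b ∈ T N
    · simp only [hgN, indicator_of_mem hb]
      exact ((hgc b (hTW N hb)).integrableOn_Icc).mono_set Ioc_subset_Icc_self
    · simp only [hgN, indicator_of_notMem hb]
      exact integrableOn_zero
  have hgb : ∀ b, ∫ s in J, |gN (s, b)| ≤ N := by
    intro b
    by_cases hb : b ∈ T N
    · simp only [hgN, indicator_of_mem hb]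
      exact hb.2
    · simp only [hgN, indicator_of_notMem hb]
      simp
  have hibp := hsl.integral_sub_integral (hgm (hTmeas N)) hgi hgb
  have hneg := neg_setIntegral_eq (a := a) (w := w) (K := K) hfD measurableSet_Ioc
    (fun s hs => haw s (Ioc_subset_Icc_self hs)) (g := gN)
    (Integrable.of_bound (hqm (hTmeas N)).aestronglyMeasurable A (hqA _))
  have hpt : ∀ p : ℝ × β, (T N).indicator (fun b => φ (max c (min p.1 e), b)) p.2 =
      (T N).indicator (fun b => φ (e, b)) p.2 -
        ∫ s in J, (Ici p.1).indicator (fun s => gN (s, p.2)) s := by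
    intro p
    by_cases hp : p.2 ∈ T N
    · simp only [hgN, indicator_of_mem hp]
      exact apply_clamp hce (hφg _ (hTW N hp)) (hgc _ (hTW N hp)) p.1
    · simp only [hgN, indicator_of_notMem hp]
      simp
  have hφe : Measurable ((T N).indicator fun b => φ (e, b)) :=
    (hφ.comp (by fun_prop : Measurable fun b : β => (e, b))).indicator (hTmeas N)
  have hexp : ∀ (ν : Measure (ℝ × β)) [IsFiniteMeasure ν],
      ∫ p, (T N).indicator (fun b => φ (max c (min p.1 e), b)) p.2 ∂ν =
      ∫ b, (T N).indicator (fun b => φ (e, b)) b ∂(ν.map Prod.snd) -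
        ∫ p, (∫ s in J, (Ici p.1).indicator (fun s => gN (s, p.2)) s) ∂ν := by
    intro ν _
    have i1 : Integrable (fun p : ℝ × β => (T N).indicator (fun b => φ (e, b)) p.2) ν :=
      Integrable.of_bound (hφe.comp measurable_snd).aestronglyMeasurable 1
        (Eventually.of_forall fun p => (norm_indicator_le_norm_self _ _).trans (hφ1 _))
    have i2 : Integrable (fun p : ℝ × β =>
        (T N).indicator (fun b => φ (max c (min p.1 e), b)) p.2) ν :=
      Integrable.of_bound (hclamp.indicator (measurable_snd (hTmeas N))).aestronglyMeasurable 1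
        (Eventually.of_forall fun p => (norm_indicator_le_norm_self _ _).trans (hφ1 _))
    rw [integral_map measurable_snd.aemeasurable hφe.aestronglyMeasurable, ← integral_sub i1]
    · exact integral_congr_ae (Eventually.of_forall hpt)
    · refine (i1.sub i2).congr (Eventually.of_forall fun p => ?_)
      simp only [Pi.sub_apply, hpt p]
      ring
  -- The boundary terms at e depend on `b` only and cancel, since the second marginals agree.
  rw [hexp ν₁, hexp ν₂, hsnd, ← hneg, ← hibp]
  ring

/-- Integration by parts for a signed measure `ν₁ - ν₂` with lower slices `a d • K d`, where
`a = - w fD` on the open set `I`. -/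
lemma HasLowerSlices.integral_sub_integral_eq (hsl : HasLowerSlices ν₁ ν₂ K a)
    (hsnd : ν₁.map Prod.snd = ν₂.map Prod.snd) {S I : Set ℝ} {W : Set β} (hW : MeasurableSet W)
    (hν₁ : ν₁ (S ×ˢ W)ᶜ = 0) (hν₂ : ν₂ (S ×ˢ W)ᶜ = 0)
    {φ g : ℝ × β → ℝ} (hφ : Measurable φ) (hφ1 : ∀ p, |φ p| ≤ 1) (hg : Measurable g)
    (hφS : ∀ b ∈ W, ContinuousOn (fun s => φ (s, b)) S)
    (hφg : ∀ b ∈ W, ∀ s ∈ I, HasDerivAt (fun s => φ (s, b)) (g (s, b)) s)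
    (hgc : ∀ b ∈ W, ContinuousOn (fun s => g (s, b)) I) (hIS : I ⊆ S)
    {c e : ℕ → ℝ} (hce : ∀ n, c n ≤ e n) (hceI : ∀ n, Icc (c n) (e n) ⊆ I)
    (hcev : ∀ d ∈ I, ∀ᶠ n in atTop, c n < d ∧ d < e n)
    (hclamp : ∀ d ∈ S, Tendsto (fun n => max (c n) (min d (e n))) atTop (𝓝 d))
    {fD w : ℝ → ℝ} (hfD : Measurable fD) (hw : Measurable w)
    [IsFiniteMeasure (volume.withDensity fun d => ENNReal.ofReal (fD d))]
    (haw : ∀ s ∈ I, 0 ≤ fD s ∧ a s = -(w s * fD s)) {A : ℝ}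
    (hA : ∀ᵐ p ∂((volume.withDensity fun d => ENNReal.ofReal (fD d)) ⊗ₘ K),
      |w p.1 * g p| ≤ A)
    (hmem : ∀ᵐ p ∂((volume.withDensity fun d => ENNReal.ofReal (fD d)) ⊗ₘ K), p ∈ I ×ˢ W) :
    ∫ p, φ p ∂ν₁ - ∫ p, φ p ∂ν₂ =
      ∫ p, w p.1 * g p ∂((volume.withDensity fun d => ENNReal.ofReal (fD d)) ⊗ₘ K) := by
  have hlim : ∀ (ν : Measure (ℝ × β)) [IsFiniteMeasure ν], ν (S ×ˢ W)ᶜ = 0 →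
      Tendsto (fun n => ∫ p, W.indicator (fun b => φ (max (c n) (min p.1 (e n)), b)) p.2 ∂ν) atTop
        (𝓝 (∫ p, φ p ∂ν)) := by
    intro ν _ hν
    refine tendsto_integral_of_dominated_convergence (fun _ => 1) (fun n => ?_)
      (integrable_const _) (fun n => Eventually.of_forall fun p => ?_) ?_
    · have : Measurable fun p : ℝ × β => φ (max (c n) (min p.1 (e n)), p.2) := by fun_prop
      exact (this.indicator (measurable_snd hW)).aestronglyMeasurable
    · exact (norm_indicator_le_norm_self _ _).trans (hφ1 _)
    · have hmemν : ∀ᵐ p ∂ν, p ∈ S ×ˢ W := hν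
      filter_upwards [hmemν] with p hp
      simp only [indicator_of_mem hp.2]
      have hcl : ∀ n, max (c n) (min p.1 (e n)) ∈ S := fun n => hIS (hceI n
        ⟨le_max_left _ _, max_le (hce n) (min_le_right _ _)⟩)
      -- Clamped points stay in S, so continuity within S is enough, also at boundary points of the
      -- support.
      exact (hφS p.2 hp.2 p.1 hp.1).tendsto.comp
        (tendsto_nhdsWithin_iff.2 ⟨hclamp _ hp.1, Eventually.of_forall hcl⟩)
  have hrhs : Tendsto (fun n => ∫ p, (Ioc (c n) (e n)).indicator w p.1 *
      W.indicator (fun b => g (p.1, b)) p.2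
      ∂((volume.withDensity fun d => ENNReal.ofReal (fD d)) ⊗ₘ K)) atTop
      (𝓝 (∫ p, w p.1 * g p ∂((volume.withDensity fun d => ENNReal.ofReal (fD d)) ⊗ₘ K))) := by
    refine tendsto_integral_of_dominated_convergence (fun _ => A) (fun n => ?_)
      (integrable_const _) (fun n => ?_) ?_
    · exact (((hw.indicator measurableSet_Ioc).comp measurable_fst).mul
        (hg.indicator (measurable_snd hW))).aestronglyMeasurable
    · filter_upwards [hA] with p hp
      refine le_trans ?_ hp
      rw [← Real.norm_eq_abs, norm_mul, norm_mul]
      exact mul_le_mul (norm_indicator_le_norm_self _ _) (norm_indicator_le_norm_self _ _)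
        (norm_nonneg _) (norm_nonneg _)
    · filter_upwards [hmem] with p hp
      refine tendsto_const_nhds.congr' ?_
      filter_upwards [hcev p.1 hp.1] with n hn
      rw [indicator_of_mem hp.2, indicator_of_mem (show p.1 ∈ Ioc (c n) (e n) from ⟨hn.1, hn.2.le⟩)]
  refine tendsto_nhds_unique ((hlim ν₁ hν₁).sub (hlim ν₂ hν₂)) (hrhs.congr fun n => ?_)
  exact (hsl.integral_clamp hsnd hW hφ hφ1 hg (hce n) (fun b hb s hs => hφg b hb s (hceI n hs))
    (fun b hb => (hgc b hb).mono (hceI n)) hfD hw (fun s hs => haw s (hceI n hs)) hA).symm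

end Window

end PolicyEffect

namespace PolicyEffect

/-! ### The Hadamard derivative under the integral sign -/

section ContinuousMapValued

/-- A map into the space of continuous functions on a compact space is strongly measurable if its
evaluations are measurable. -/
lemma stronglyMeasurable_of_eval {α T : Type*} [MeasurableSpace α] [TopologicalSpace T]
    [CompactSpace T] [TopologicalSpace.SeparableSpace T] [SecondCountableTopology C(T, ℝ)]
    {Ψ : α → C(T, ℝ)} (h : ∀ t, Measurable fun p => Ψ p t) : StronglyMeasurable Ψ := by
  borelize C(T, ℝ)
  refine Measurable.stronglyMeasurable (measurable_of_isOpen fun s hs => ?_)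
  -- The supremum distance is tested on a countable dense set, so preimages of closed balls are
  -- countable intersections; by separability every open set is a countable union of such balls.
  have hball : ∀ (f : C(T, ℝ)) (r : ℝ), MeasurableSet (Ψ ⁻¹' Metric.closedBall f r) := by
    intro f r
    rcases lt_or_ge r 0 with hr | hr
    · simp [Metric.closedBall_eq_empty.2 hr]
    obtain ⟨c, hc, hd⟩ := TopologicalSpace.exists_countable_dense T
    have heq : Ψ ⁻¹' Metric.closedBall f r = ⋂ t ∈ c, {p | dist (Ψ p t) (f t) ≤ r} := by
      ext p
      simp only [mem_preimage, Metric.mem_closedBall, mem_iInter]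
      rw [ContinuousMap.dist_le hr]
      refine ⟨fun h t _ => h t, fun h t => ?_⟩
      have hcl : IsClosed {t | dist (Ψ p t) (f t) ≤ r} :=
        isClosed_le (by fun_prop) continuous_const
      exact (hcl.closure_subset_iff.2 fun t ht => h t ht) (hd t)
    rw [heq]
    refine MeasurableSet.biInter hc fun t _ => ?_
    have := (h t).dist measurable_const (g := fun _ => f t)
    exact measurableSet_le this measurable_const
  set e := TopologicalSpace.denseSeq C(T, ℝ)
  have hcov : s = ⋃ q : {q : ℕ × ℚ // Metric.closedBall (e q.1) (q.2 : ℝ) ⊆ s},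
      Metric.closedBall (e q.1.1) (q.1.2 : ℝ) := by
    refine Subset.antisymm (fun f hf => ?_) (iUnion_subset fun q => q.2)
    obtain ⟨r, hr, hrs⟩ := Metric.isOpen_iff.1 hs f hf
    obtain ⟨q, hq0, hq⟩ := exists_rat_btwn (half_pos hr)
    obtain ⟨n, hn⟩ := (TopologicalSpace.denseRange_denseSeq C(T, ℝ)).exists_dist_lt f hq0
    refine mem_iUnion.2 ⟨⟨(n, q), fun u hu => hrs ?_⟩, hn.le⟩
    have hu' : dist u (e n) ≤ q := hu
    have := dist_triangle u (e n) f
    rw [dist_comm (e n) f] at this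
    exact Metric.mem_ball.2 (by linarith)
  rw [hcov, preimage_iUnion]
  exact MeasurableSet.iUnion fun q => hball _ _

/-- The extension of a function on `ℝ` by `0` at `-∞` and by `1` at `+∞`. -/
noncomputable def extendEReal (u : ℝ → ℝ) (t : EReal) : ℝ :=
  if t = ⊥ then 0 else if t = ⊤ then 1 else u t.toReal

@[simp] lemma extendEReal_bot (u : ℝ → ℝ) : extendEReal u ⊥ = 0 := by simp [extendEReal]

@[simp] lemma extendEReal_top (u : ℝ → ℝ) : extendEReal u ⊤ = 1 := by simp [extendEReal]

@[simp] lemma extendEReal_coe (u : ℝ → ℝ) (y : ℝ) : extendEReal u y = u y := by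
  simp [extendEReal]

/-- A continuous distribution function extends continuously. -/
lemma continuous_extendEReal {u : ℝ → ℝ} (hc : Continuous u) (hm : Monotone u)
    (h0 : Tendsto u atBot (𝓝 0)) (h1 : Tendsto u atTop (𝓝 1)) : Continuous (extendEReal u) := by
  have hu0 : ∀ y, 0 ≤ u y := fun y => hm.le_of_tendsto h0 y
  have hu1 : ∀ y, u y ≤ 1 := fun y => hm.ge_of_tendsto h1 y
  have hmono : Monotone (extendEReal u) := by
    intro s t hst
    induction s with
    | bot =>
      induction t with
      | bot => exact le_rfl
      | coe y => simpa using hu0 y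
      | top => simp
    | coe x =>
      induction t with
      | bot => simp at hst
      | coe y => simpa using hm (EReal.coe_le_coe_iff.1 hst)
      | top => simpa using hu1 x
    | top => rw [top_le_iff.1 hst]
  refine continuous_iff_continuousAt.2 fun t => ?_
  induction t with
  | bot =>
    rw [ContinuousAt, extendEReal_bot]
    refine tendsto_order.2 ⟨fun a ha => ?_, fun a ha => ?_⟩
    · refine Eventually.of_forall fun s => ha.trans_le ?_
      simpa using hmono (bot_le : ⊥ ≤ s)
    · obtain ⟨y, hy⟩ := (h0.eventually (gt_mem_nhds ha)).exists
      filter_upwards [Iio_mem_nhds (EReal.bot_lt_coe y)] with s hs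
      refine (hmono (le_of_lt hs)).trans_lt ?_
      simpa using hy
  | coe y =>
    rw [← EReal.isOpenEmbedding_coe.continuousAt_iff]
    have : extendEReal u ∘ ((↑) : ℝ → EReal) = u := by ext y; simp
    rw [this]
    exact hc.continuousAt
  | top =>
    rw [ContinuousAt, extendEReal_top]
    refine tendsto_order.2 ⟨fun a ha => ?_, fun a ha => ?_⟩
    · obtain ⟨y, hy⟩ := (h1.eventually (lt_mem_nhds ha)).exists
      filter_upwards [Ioi_mem_nhds (EReal.coe_lt_top y)] with s hs
      refine lt_of_lt_of_le ?_ (hmono (le_of_lt hs))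
      simpa using hy
    · refine Eventually.of_forall fun s => lt_of_le_of_lt ?_ ha
      simpa using hmono (le_top : s ≤ ⊤)

variable {B : Type*} [NormedAddCommGroup B] [NormedSpace ℝ B] {Γ : (ℝ → ℝ) → B}
  {𝓓 : Set (ℝ → ℝ)} {F₀ : ℝ → ℝ} {dΓ : (ℝ → ℝ) → B}

lemma comp_coe_mem_boundedContinuous (φ : C(EReal, ℝ)) :
    (fun y : ℝ => φ y) ∈ boundedContinuous :=
  ⟨φ.continuous.comp continuous_coe_real_ereal, ‖φ‖, fun y => φ.norm_coe_le_norm y⟩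

/-- The Hadamard derivative as a continuous linear map on the functions on the extended line. -/
lemma HasHadamardDerivAt.exists_continuousLinearMap
    (hΓ : HasHadamardDerivAt Γ 𝓓 F₀ boundedContinuous dΓ) :
    ∃ L : C(EReal, ℝ) →L[ℝ] B, ∀ φ, L φ = dΓ fun y => φ y := by
  obtain ⟨C, hC⟩ := hΓ.continuous
  refine ⟨LinearMap.mkContinuous
    { toFun := fun φ => dΓ fun y => φ y
      map_add' := fun φ ψ => hΓ.map_add _ (comp_coe_mem_boundedContinuous φ) _
        (comp_coe_mem_boundedContinuous ψ)
      map_smul' := fun a φ => hΓ.map_smul a _ (comp_coe_mem_boundedContinuous φ) } C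
    fun φ => hC _ (comp_coe_mem_boundedContinuous φ) _ fun y => φ.norm_coe_le_norm y, fun φ => rfl⟩

/-- The Hadamard derivative commutes with the integration of continuous distribution functions
against a difference of finite measures. -/
lemma HasHadamardDerivAt.integral_sub_integral [CompleteSpace B]
    (hΓ : HasHadamardDerivAt Γ 𝓓 F₀ boundedContinuous dΓ) {α : Type*} [MeasurableSpace α]
    {ν₁ ν₂ : Measure α} [IsFiniteMeasure ν₁] [IsFiniteMeasure ν₂] {T : Set α}
    (hT : MeasurableSet T) (h₁ : ν₁ Tᶜ = 0) (h₂ : ν₂ Tᶜ = 0) {F : α → ℝ → ℝ}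
    (hF : ∀ y, Measurable fun p => F p y) (hFc : ∀ p ∈ T, Continuous (F p))
    (hFm : ∀ p ∈ T, Monotone (F p)) (hF0 : ∀ p ∈ T, Tendsto (F p) atBot (𝓝 0))
    (hF1 : ∀ p ∈ T, Tendsto (F p) atTop (𝓝 1)) {h : ℝ → ℝ}
    (hh : ∀ y, ∫ p, F p y ∂ν₁ - ∫ p, F p y ∂ν₂ = h y) :
    Integrable (fun p => dΓ (F p)) ν₁ ∧ Integrable (fun p => dΓ (F p)) ν₂ ∧
      ∫ p, dΓ (F p) ∂ν₁ - ∫ p, dΓ (F p) ∂ν₂ = dΓ h := by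
  classical
  obtain ⟨L, hL⟩ := hΓ.exists_continuousLinearMap
  have hext : ∀ p ∈ T, Continuous (extendEReal (F p)) := fun p hp =>
    continuous_extendEReal (hFc p hp) (hFm p hp) (hF0 p hp) (hF1 p hp)
  -- Under the supremum norm, bounded continuous functions on ℝ form a nonseparable space, where
  -- strong measurability could fail. The extended distribution functions live in the separable
  -- space `C(EReal, ℝ)`; the value 0 off the full set `T` is immaterial.
  set Ψ : α → C(EReal, ℝ) := fun p =>
    if p ∈ T then ContinuousMap.mkD (extendEReal (F p)) 0 else 0 with hΨ
  have hΨT : ∀ p ∈ T, ∀ t, Ψ p t = extendEReal (F p) t := by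
    intro p hp t
    simp only [hΨ, if_pos hp]
    exact ContinuousMap.mkD_apply_of_continuous (hext p hp)
  have hΨT' : ∀ p ∉ T, ∀ t, Ψ p t = 0 := by
    intro p hp t
    simp [hΨ, if_neg hp]
  have hΨm : StronglyMeasurable Ψ := by
    refine stronglyMeasurable_of_eval fun t => ?_
    have heq : (fun p => Ψ p t) = T.indicator fun p => extendEReal (F p) t := by
      ext p
      by_cases hp : p ∈ T
      · rw [hΨT p hp, indicator_of_mem hp]
      · rw [hΨT' p hp, indicator_of_notMem hp]
    rw [heq]
    refine Measurable.indicator ?_ hT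
    induction t with
    | bot => simp
    | coe y => simpa using hF y
    | top => simp
  have hΨb : ∀ p, ‖Ψ p‖ ≤ 1 := by
    intro p
    refine (ContinuousMap.norm_le _ zero_le_one).2 fun t => ?_
    by_cases hp : p ∈ T
    · rw [hΨT p hp, Real.norm_eq_abs, abs_le]
      induction t with
      | bot => simp
      | coe y =>
        rw [extendEReal_coe]
        exact ⟨by linarith [(hFm p hp).le_of_tendsto (hF0 p hp) y],
          (hFm p hp).ge_of_tendsto (hF1 p hp) y⟩
      | top => simp
    · simp [hΨT' p hp]
  have hΨi : ∀ (ν : Measure α) [IsFiniteMeasure ν], Integrable Ψ ν := fun ν _ =>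
    Integrable.of_bound hΨm.aestronglyMeasurable 1 (Eventually.of_forall hΨb)
  have hae : ∀ ν : Measure α, ν Tᶜ = 0 → ∀ᵐ p ∂ν, p ∈ T := fun ν hν => hν
  have hdΓ : ∀ p ∈ T, L (Ψ p) = dΓ (F p) := by
    intro p hp
    rw [hL]
    congr 1 with y
    rw [hΨT p hp, extendEReal_coe]
  have hcongr : ∀ ν : Measure α, ν Tᶜ = 0 → (fun p => L (Ψ p)) =ᵐ[ν] fun p => dΓ (F p) :=
    fun ν hν => (hae ν hν).mono hdΓ
  have heval : ∀ (ν : Measure α) [IsFiniteMeasure ν], ν Tᶜ = 0 → ∀ y : ℝ,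
      (∫ p, Ψ p ∂ν) (y : EReal) = ∫ p, F p y ∂ν := by
    intro ν _ hν y
    have := (ContinuousMap.evalCLM ℝ (y : EReal) : C(EReal, ℝ) →L[ℝ] ℝ).integral_comp_comm (hΨi ν)
    refine this.symm.trans (integral_congr_ae ((hae ν hν).mono fun p hp => ?_))
    show Ψ p (y : EReal) = F p y
    rw [hΨT p hp, extendEReal_coe]
  refine ⟨(L.integrable_comp (hΨi ν₁)).congr (hcongr ν₁ h₁),
    (L.integrable_comp (hΨi ν₂)).congr (hcongr ν₂ h₂), ?_⟩
  rw [← integral_congr_ae (hcongr ν₁ h₁), ← integral_congr_ae (hcongr ν₂ h₂),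
    L.integral_comp_comm (hΨi ν₁), L.integral_comp_comm (hΨi ν₂), ← map_sub, hL]
  congr 1 with y
  rw [ContinuousMap.sub_apply, heval ν₁ h₁, heval ν₂ h₂, hh]

end ContinuousMapValued

/-! ### Integrals against the Jordan parts -/

section SignedMeasure

variable {k : ℕ} {B : Type*} [NormedAddCommGroup B] [NormedSpace ℝ B]

/-- The integral against a signed measure by means of its Jordan decomposition. -/
lemma hasIntegral_of_jordan {Φ : ℝ → ℝ → (Fin k → ℝ) → B}
    {ν : SignedMeasure (ℝ × ℝ × (Fin k → ℝ))} {θ : B}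
    (h₁ : Integrable (fun p : ℝ × ℝ × (Fin k → ℝ) => Φ p.1 p.2.1 p.2.2)
      ν.toJordanDecomposition.posPart)
    (h₂ : Integrable (fun p : ℝ × ℝ × (Fin k → ℝ) => Φ p.1 p.2.1 p.2.2)
      ν.toJordanDecomposition.negPart)
    (hθ : ∫ p, Φ p.1 p.2.1 p.2.2 ∂ν.toJordanDecomposition.posPart -
      ∫ p, Φ p.1 p.2.1 p.2.2 ∂ν.toJordanDecomposition.negPart = θ) : HasIntegral Φ ν θ := by
  have hint : ∀ μ : Measure (ℝ × ℝ × (Fin k → ℝ)), ∀ [IsFiniteMeasure μ],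
      Integrable (fun p : ℝ × ℝ × (Fin k → ℝ) => Φ p.1 p.2.1 p.2.2) μ →
      μ.toSignedMeasure.Integrable fun p : ℝ × ℝ × (Fin k → ℝ) => Φ p.1 p.2.1 p.2.2 := by
    intro μ _ hμ
    simpa [VectorMeasure.Integrable] using hμ
  have hν : ν = ν.toJordanDecomposition.posPart.toSignedMeasure -
      ν.toJordanDecomposition.negPart.toSignedMeasure :=
    (ν.toSignedMeasure_toJordanDecomposition).symm
  refine ⟨?_, ?_⟩
  · rw [hν]
    exact (hint _ h₁).sub_vectorMeasure (hint _ h₂)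
  · rw [hν, VectorMeasure.integral_sub_vectorMeasure (hint _ h₁) (hint _ h₂)]
    simpa using hθ

end SignedMeasure

end PolicyEffect

namespace PolicyEffect

lemma continuous_cdf_of_nullSingletonClass {q : Measure ℝ} [IsProbabilityMeasure q]
    (h : ∀ y, q {y} = 0) : Continuous (cdf q) := by
  refine continuous_iff_continuousAt.2 fun y => ?_
  rw [(monotone_cdf q).continuousAt_iff_leftLim_eq_rightLim, (cdf q).rightLim_eq]
  have h1 := (cdf q).measure_singleton y
  rw [measure_cdf, h y] at h1
  have h2 : cdf q y - Function.leftLim (cdf q) y ≤ 0 := ENNReal.ofReal_eq_zero.1 h1.symm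
  exact le_antisymm ((monotone_cdf q).leftLim_le le_rfl) (by linarith)

/-! ### The Stieltjes integral of the conditional distribution functions -/

section CondCdf

variable {Ω 𝓔 : Type*} [MeasurableSpace Ω] [MeasurableSpace 𝓔] {P : Measure Ω}
  {k : ℕ} {D V : Ω → ℝ} {X : Ω → Fin k → ℝ}
  {m : ℝ → (Fin k → ℝ) → 𝓔 → ℝ} {κ : Kernel (ℝ × ℝ × (Fin k → ℝ)) 𝓔} [IsMarkovKernel κ]

lemma condCdf_eq_cdf (hm : Measurable fun p : ℝ × (Fin k → ℝ) × 𝓔 => m p.1 p.2.1 p.2.2)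
    (d v : ℝ) (x : Fin k → ℝ) : condCdf κ m d v x = cdf ((κ (d, v, x)).map (m d x)) := by
  have hU : Measurable (m d x) :=
    hm.comp (by fun_prop : Measurable fun e : 𝓔 => (d, x, e))
  have : IsProbabilityMeasure ((κ (d, v, x)).map (m d x)) :=
    Measure.isProbabilityMeasure_map hU.aemeasurable
  ext y
  rw [cdf_eq_real, map_measureReal_apply hU measurableSet_Iic]
  rfl

lemma abs_condCdf_le_one (d v : ℝ) (x : Fin k → ℝ) (y : ℝ) : |condCdf κ m d v x y| ≤ 1 := by
  rw [condCdf, abs_of_nonneg measureReal_nonneg]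
  exact measureReal_le_one

lemma measurable_condCdf (hm : Measurable fun p : ℝ × (Fin k → ℝ) × 𝓔 => m p.1 p.2.1 p.2.2)
    (y : ℝ) : Measurable fun p : ℝ × ℝ × (Fin k → ℝ) => condCdf κ m p.1 p.2.1 p.2.2 y := by
  have hset : MeasurableSet {q : (ℝ × ℝ × (Fin k → ℝ)) × 𝓔 | m q.1.1 q.1.2.2 q.2 ≤ y} := by
    have hq : Measurable fun q : (ℝ × ℝ × (Fin k → ℝ)) × 𝓔 => (q.1.1, q.1.2.2, q.2) := by fun_prop
    exact measurableSet_le (hm.comp hq) measurable_const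
  exact (Kernel.measurable_kernel_prodMk_left (κ := κ) hset).ennreal_toReal

/-- An atom of the law of m(d, x, ε) would give mass to a line {y} × ℝ, which is Lebesgue null and
hence null for a law with a density. -/
lemma ConditionalRegularity.continuous_condCdf
    (hm : Measurable fun p : ℝ × (Fin k → ℝ) × 𝓔 => m p.1 p.2.1 p.2.2)
    (hs : ∀ x e, ContDiff ℝ 1 fun d => m d x e) (hR : ConditionalRegularity P D V X m κ)
    {d v : ℝ} {x : Fin k → ℝ} (hd : d ∈ suppOf P D) (hv : v ∈ suppOf P V) (hx : x ∈ suppOf P X) :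
    Continuous (condCdf κ m d v x) := by
  have hme : Measurable fun e : 𝓔 => (d, x, e) := by fun_prop
  have hU : Measurable (m d x) := hm.comp hme
  have hM : Measurable fun e => structDeriv m d x e := (measurable_structDeriv hm hs).comp hme
  have : IsProbabilityMeasure ((κ (d, v, x)).map (m d x)) :=
    Measure.isProbabilityMeasure_map hU.aemeasurable
  rw [condCdf_eq_cdf hm]
  refine continuous_cdf_of_nullSingletonClass fun y => ?_
  obtain ⟨g, C, -, hdens⟩ := hR.density
  obtain ⟨f, hf, -⟩ := hdens d hd v hv x hx
  have h1 : (κ (d, v, x)).map (m d x) {y} =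
      (κ (d, v, x)).map (fun e => (m d x e, structDeriv m d x e)) ({y} ×ˢ univ) := by
    rw [Measure.map_apply hU (measurableSet_singleton y), Measure.map_apply (hU.prodMk hM)
      ((measurableSet_singleton y).prod MeasurableSet.univ)]
    congr 1 with e
    exact ⟨fun h => ⟨h, mem_univ _⟩, fun h => h.1⟩
  rw [h1, hf.density]
  refine withDensity_absolutelyContinuous _ _ ?_
  rw [Measure.volume_eq_prod, Measure.prod_prod, Real.volume_singleton, zero_mul]

lemma measurableSet_suppOf {α : Type*} [TopologicalSpace α] [MeasurableSpace α]
    [OpensMeasurableSpace α] {U : Ω → α} : MeasurableSet (suppOf P U) :=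
  Measure.isClosed_support.measurableSet

lemma ae_mem_suppOf {α : Type*} [TopologicalSpace α] [MeasurableSpace α]
    [HereditarilyLindelofSpace α] {U : Ω → α} (hU : Measurable U) : ∀ᵐ ω ∂P, U ω ∈ suppOf P U :=
  ae_of_ae_map hU.aemeasurable Measure.support_mem_ae

/-- On an open set `I` in the support of `D`, the derivative `∂_d F_{Y|D,V,X}` is measurable. -/
lemma measurable_indicator_condCdfDeriv
    (hm : Measurable fun p : ℝ × (Fin k → ℝ) × 𝓔 => m p.1 p.2.1 p.2.2)
    (hR : ConditionalRegularity P D V X m κ) {I : Set ℝ} (hI : IsOpen I)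
    (hID : ∀ d ∈ I, suppOf P D ∈ 𝓝 d) (y : ℝ) :
    (∀ p ∈ I ×ˢ suppOf P V ×ˢ suppOf P X,
      HasDerivAt (fun s => condCdf κ m s p.2.1 p.2.2 y)
        (condCdfDeriv (suppOf P D) κ m p.1 p.2.1 p.2.2 y) p.1) ∧
    (∀ v ∈ suppOf P V, ∀ x ∈ suppOf P X,
      ContinuousOn (fun s => condCdfDeriv (suppOf P D) κ m s v x y) I) ∧
    Measurable ((I ×ˢ suppOf P V ×ˢ suppOf P X).indicator fun p : ℝ × ℝ × (Fin k → ℝ) =>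
      condCdfDeriv (suppOf P D) κ m p.1 p.2.1 p.2.2 y) := by
  have hder : ∀ p ∈ I ×ˢ suppOf P V ×ˢ suppOf P X,
      HasDerivAt (fun s => condCdf κ m s p.2.1 p.2.2 y)
        (condCdfDeriv (suppOf P D) κ m p.1 p.2.1 p.2.2 y) p.1 := by
    intro p hp
    have hn := hID p.1 hp.1
    have hdiff := (hR.smooth p.2.1 hp.2.1 p.2.2 hp.2.2 y).differentiableOn one_ne_zero p.1
      (mem_of_mem_nhds hn)
    exact hdiff.hasDerivWithinAt.hasDerivAt hn
  have hIS : I ⊆ suppOf P D := fun d hd => mem_of_mem_nhds (hID d hd)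
  refine ⟨hder, fun v hv x hx => ?_, ?_⟩
  · have hcont := ((hR.smooth v hv x hx y).mono hIS).continuousOn_deriv_of_isOpen hI le_rfl
    refine hcont.congr fun s hs => ?_
    exact ((hder (s, v, x) ⟨hs, hv, hx⟩).deriv).symm
  · have hmeasW : MeasurableSet (I ×ˢ suppOf P V ×ˢ suppOf P X) :=
      hI.measurableSet.prod (measurableSet_suppOf.prod measurableSet_suppOf)
    have hshift : ∀ c : ℝ, Measurable fun p : ℝ × ℝ × (Fin k → ℝ) =>
        condCdf κ m (p.1 + c) p.2.1 p.2.2 y := fun c =>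
      (measurable_condCdf (κ := κ) hm y).comp
        (f := fun p : ℝ × ℝ × (Fin k → ℝ) => (p.1 + c, p.2.1, p.2.2)) (by fun_prop)
    set T := I ×ˢ suppOf P V ×ˢ suppOf P X with hT
    set q : ℕ → ℝ × ℝ × (Fin k → ℝ) → ℝ := fun n p => ((1 : ℝ) / (n + 1))⁻¹ *
      (condCdf κ m (p.1 + 1 / (n + 1)) p.2.1 p.2.2 y - condCdf κ m p.1 p.2.1 p.2.2 y) with hq
    have hqm : ∀ n, Measurable (T.indicator (q n)) := fun n =>
      (((hshift _).sub (measurable_condCdf hm y)).const_mul _).indicator hmeasW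
    refine measurable_of_tendsto_metrizable hqm (tendsto_pi_nhds.2 fun p => ?_)
    by_cases hp : p ∈ T
    · simp only [indicator_of_mem hp]
      exact tendsto_seq_slope (f := fun s => condCdf κ m s p.2.1 p.2.2 y) (hder p hp)
    · simp only [indicator_of_notMem hp]
      exact tendsto_const_nhds

variable {B : Type*} [NormedAddCommGroup B] [NormedSpace ℝ B] [CompleteSpace B]
  {Γ : (ℝ → ℝ) → B} {𝓓 : Set (ℝ → ℝ)} {F₀ : ℝ → ℝ} {dΓ : (ℝ → ℝ) → B}

/-- The Stieltjes integral of `Γ'(F_{Y|D,V,X})` against the signed measure with distribution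
function `F_{V,X|D} a`, where `a = - w f_D`. -/
theorem hasIntegral_condCdf [IsProbabilityMeasure P]
    (hm : Measurable fun p : ℝ × (Fin k → ℝ) × 𝓔 => m p.1 p.2.1 p.2.2)
    (hs : ∀ x e, ContDiff ℝ 1 fun d => m d x e)
    (hDm : Measurable D) (hVm : Measurable V) (hXm : Measurable X)
    (hR : ConditionalRegularity P D V X m κ) {A : ℝ}
    (hA : ∀ᵐ p ∂(P.map fun ω => (D ω, V ω, X ω)), ∀ y,
      |condCdfDeriv (suppOf P D) κ m p.1 p.2.1 p.2.2 y| ≤ A)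
    {K : Kernel ℝ (ℝ × (Fin k → ℝ))} [IsMarkovKernel K]
    (hK : HasCondDistrib (fun ω => (V ω, X ω)) D K P)
    (hc : Continuous (cdfOf P D)) (hSD : ∀ d ∈ interiorRange P D, suppOf P D ∈ 𝓝 d)
    {fD w a : ℝ → ℝ} (hfD : Measurable fD)
    (hdens : P.map D = volume.withDensity fun d => ENNReal.ofReal (fD d))
    (hpos : ∀ d ∈ suppOf P D, 0 < fD d) (hw : Measurable w) {M : ℝ}
    (hwM : ∀ᵐ ω ∂P, |w (D ω)| ≤ M) (haw : ∀ d ∈ interiorRange P D, a d = -(w d * fD d))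
    (ha0 : ∀ d ∉ interiorRange P D, a d = 0) (ha : Tendsto a atTop (𝓝 0))
    (hΓ : HasHadamardDerivAt Γ 𝓓 F₀ boundedContinuous dΓ)
    {ν : SignedMeasure (ℝ × ℝ × (Fin k → ℝ))}
    (hν : ∀ v x, ∀ᵐ d, ν (Iic d ×ˢ Iic v ×ˢ Iic x) = (K d).real (Iic v ×ˢ Iic x) * a d) :
    HasIntegral (fun d v x => dΓ (condCdf κ m d v x)) ν
      (dΓ fun y => ∫ ω, w (D ω) * condCdfDeriv (suppOf P D) κ m (D ω) (V ω) (X ω) y ∂P) := by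
  set S := suppOf P D
  set I := interiorRange P D
  set W := suppOf P V ×ˢ suppOf P X
  set ν₁ := ν.toJordanDecomposition.posPart with hν₁
  set ν₂ := ν.toJordanDecomposition.negPart with hν₂
  have hVX : Measurable fun ω => (V ω, X ω) := by fun_prop
  have hDVX : Measurable fun ω => (D ω, V ω, X ω) := by fun_prop
  have hlaw : P.map (fun ω => (D ω, V ω, X ω)) =
      (volume.withDensity fun d => ENNReal.ofReal (fD d)) ⊗ₘ K := by
    rw [← hdens]; exact hK.map_eq
  have : IsProbabilityMeasure (P.map D) := Measure.isProbabilityMeasure_map hDm.aemeasurable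
  have : IsFiniteMeasure (volume.withDensity fun d => ENNReal.ofReal (fD d)) := by
    rw [← hdens]; infer_instance
  have hIo : IsOpen I := isOpen_interiorRange hc
  have hIS : I ⊆ S := fun d hd => mem_of_mem_nhds (hSD d hd)
  have hWm : MeasurableSet W := measurableSet_suppOf.prod measurableSet_suppOf
  have hWae : ∀ᵐ ω ∂P, (V ω, X ω) ∈ W := by
    filter_upwards [ae_mem_suppOf (P := P) hVm, ae_mem_suppOf (P := P) hXm] with ω h1 h2
      using ⟨h1, h2⟩
  have hIae : ∀ᵐ ω ∂P, D ω ∈ I := ae_of_ae_map hDm.aemeasurable (ae_mem_interiorRange hDm hc)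
  have hmem : ∀ᵐ p ∂(P.map fun ω => (D ω, V ω, X ω)), p ∈ I ×ˢ W := by
    have hset : MeasurableSet {p : ℝ × ℝ × (Fin k → ℝ) | p ∈ I ×ˢ W} :=
      hIo.measurableSet.prod hWm
    rw [ae_map_iff hDVX.aemeasurable hset]
    filter_upwards [hIae, hWae] with ω h1 h2 using ⟨h1, h2⟩
  have hslice : HasLowerSlices ν₁ ν₂ K a := by
    refine hasLowerSlices_of_Iic fun v x => ?_
    filter_upwards [hν v x] with d hd
    rw [← hd, SignedMeasure.apply_eq_posPart_real_sub_negPart_real]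
    exact measurableSet_Iic.prod (measurableSet_Iic.prod measurableSet_Iic)
  -- What is known holds almost surely under the law of D. Where `a d ≠ 0` the density is positive,
  -- so it transfers to Lebesgue almost every such d.
  have hKW : ∀ᵐ d, a d ≠ 0 → K d Wᶜ = 0 := by
    have h1 : ∀ᵐ p ∂((volume.withDensity fun d => ENNReal.ofReal (fD d)) ⊗ₘ K), p ∈ I ×ˢ W := by
      rw [← hlaw]
      exact hmem
    have h2 := Measure.ae_ae_of_ae_compProd h1
    rw [ae_withDensity_iff (by fun_prop)] at h2
    filter_upwards [h2] with d hd had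
    have hdI : d ∈ I := by by_contra h; exact had (ha0 d h)
    have h3 : ∀ᵐ b ∂(K d), (d, b) ∈ I ×ˢ W := hd (by simpa using hpos d (hIS hdI))
    have h4 : ∀ᵐ b ∂(K d), b ∈ W := h3.mono fun b hb => hb.2
    exact h4
  obtain ⟨hT₁, hT₂⟩ := hslice.measure_compl_eq_zero ν.toJordanDecomposition.mutuallySingular
    (Measure.isClosed_support : IsClosed S) (fun d hd => ha0 d fun h => hd (hIS h)) hWm hKW
  have hsnd := hslice.map_snd_eq ha
  obtain ⟨c, e, hce, hceI, hcev, hclamp⟩ := exists_clamp hDm hc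
  -- The formula at each fixed threshold y; the vector-valued one follows because Γ' commutes with
  -- the integral.
  have hscalar : ∀ y, ∫ p, condCdf κ m p.1 p.2.1 p.2.2 y ∂ν₁ -
      ∫ p, condCdf κ m p.1 p.2.1 p.2.2 y ∂ν₂ =
      ∫ ω, w (D ω) * condCdfDeriv S κ m (D ω) (V ω) (X ω) y ∂P := by
    intro y
    obtain ⟨hder, hcont, hgm⟩ := measurable_indicator_condCdfDeriv hm hR hIo hSD y
    set g := (I ×ˢ W).indicator fun p : ℝ × ℝ × (Fin k → ℝ) =>
      condCdfDeriv S κ m p.1 p.2.1 p.2.2 y with hg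
    have hgeq : ∀ p ∈ I ×ˢ W, g p = condCdfDeriv S κ m p.1 p.2.1 p.2.2 y := fun p hp =>
      indicator_of_mem hp _
    have hwgm : Measurable fun p : ℝ × ℝ × (Fin k → ℝ) => w p.1 * g p :=
      (hw.comp measurable_fst).mul hgm
    have hwg : ∀ᵐ p ∂((volume.withDensity fun d => ENNReal.ofReal (fD d)) ⊗ₘ K),
        |w p.1 * g p| ≤ M * A := by
      have hset : MeasurableSet {p : ℝ × ℝ × (Fin k → ℝ) | |w p.1| ≤ M} :=
        measurableSet_le (hw.comp measurable_fst).abs measurable_const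
      have hwρ : ∀ᵐ p ∂(P.map fun ω => (D ω, V ω, X ω)), |w p.1| ≤ M := by
        rw [ae_map_iff hDVX.aemeasurable hset]
        exact hwM
      rw [← hlaw]
      filter_upwards [hmem, hA, hwρ] with p hp hpA hpw
      rw [hgeq p hp, abs_mul]
      exact mul_le_mul hpw (hpA y) (abs_nonneg _) ((abs_nonneg _).trans hpw)
    rw [hslice.integral_sub_integral_eq hsnd hWm hT₁ hT₂ (measurable_condCdf hm y)
      (fun p => abs_condCdf_le_one _ _ _ _) hgm
      (fun b hb => (hR.smooth b.1 hb.1 b.2 hb.2 y).continuousOn)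
      (fun b hb s hs => by rw [hgeq (s, b) ⟨hs, hb⟩]; exact hder (s, b) ⟨hs, hb⟩)
      (fun b hb => (hcont b.1 hb.1 b.2 hb.2).congr fun s hs => hgeq (s, b) ⟨hs, hb⟩)
      hIS hce hceI hcev hclamp hfD hw
      (fun s hs => ⟨(hpos s (hIS hs)).le, haw s hs⟩) hwg (by rw [← hlaw]; exact hmem),
      ← hlaw, integral_map hDVX.aemeasurable hwgm.aestronglyMeasurable]
    refine integral_congr_ae ?_
    filter_upwards [hIae, hWae] with ω h1 h2
    rw [hgeq (D ω, V ω, X ω) ⟨h1, h2⟩]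
  have hprob : ∀ p : ℝ × ℝ × (Fin k → ℝ), IsProbabilityMeasure ((κ p).map (m p.1 p.2.2)) :=
    fun p => Measure.isProbabilityMeasure_map
      (hm.comp (by fun_prop : Measurable fun e : 𝓔 => (p.1, p.2.2, e))).aemeasurable
  obtain ⟨hi₁, hi₂, hθ⟩ := hΓ.integral_sub_integral (T := S ×ˢ W)
    (measurableSet_suppOf.prod hWm) hT₁ hT₂
    (F := fun p : ℝ × ℝ × (Fin k → ℝ) => condCdf κ m p.1 p.2.1 p.2.2)
    (fun y => measurable_condCdf hm y)
    (fun p hp => hR.continuous_condCdf hm hs hp.1 hp.2.1 hp.2.2)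
    (fun p _ => by rw [condCdf_eq_cdf hm]; exact monotone_cdf _)
    (fun p _ => by rw [condCdf_eq_cdf hm]; exact tendsto_cdf_atBot _)
    (fun p _ => by rw [condCdf_eq_cdf hm]; exact tendsto_cdf_atTop _) hscalar
  exact hasIntegral_of_jordan hi₁ hi₂ hθ

end CondCdf

end PolicyEffect

namespace PolicyEffect

/-! ### Differentiating P[D ≤ s, U ∈ Q] in s -/

section JointDistribution

variable {Ω β : Type*} [MeasurableSpace Ω] [MeasurableSpace β] {P : Measure Ω}
  [IsProbabilityMeasure P] {D : Ω → ℝ} {U : Ω → β} {K : Kernel ℝ β} [IsMarkovKernel K]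

lemma integrable_kernel_real (τ : Measure ℝ) [IsFiniteMeasure τ] {Q : Set β}
    (hQ : MeasurableSet Q) : Integrable (fun u => (K u).real Q) τ := by
  refine Integrable.of_bound (K.measurable_coe hQ).ennreal_toReal.aestronglyMeasurable 1
    (Eventually.of_forall fun u => ?_)
  change ‖(K u).real Q‖ ≤ 1
  rw [Real.norm_of_nonneg measureReal_nonneg]
  exact measureReal_le_one

/-- Increments of `s ↦ P[D ≤ s, U ∈ Q]` are integrals of the conditional probability of `U ∈ Q`. -/
lemma measureReal_joint_sub (hD : Measurable D) (hU : Measurable U)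
    (hK : HasCondDistrib U D K P) {Q : Set β} (hQ : MeasurableSet Q) (d s : ℝ) :
    P.real {ω | D ω ≤ s ∧ U ω ∈ Q} - P.real {ω | D ω ≤ d ∧ U ω ∈ Q} =
      ∫ u in d..s, (K u).real Q ∂(P.map D) := by
  have : IsProbabilityMeasure (P.map D) := Measure.isProbabilityMeasure_map hD.aemeasurable
  have hJ : ∀ s, P.real {ω | D ω ≤ s ∧ U ω ∈ Q} = ∫ u in Iic s, (K u).real Q ∂(P.map D) := by
    intro s
    have h1 : P {ω | D ω ≤ s ∧ U ω ∈ Q} = (P.map D ⊗ₘ K) (Iic s ×ˢ Q) := by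
      rw [← hK.map_eq, Measure.map_apply (hD.prodMk hU) (measurableSet_Iic.prod hQ)]
      rfl
    rw [measureReal_def, h1, Measure.compProd_apply_prod measurableSet_Iic hQ]
    exact (integral_toReal (K.measurable_coe hQ).aemeasurable
      (Eventually.of_forall fun u => measure_lt_top _ _)).symm
  rw [hJ, hJ]
  exact intervalIntegral.integral_Iic_sub_Iic (integrable_kernel_real _ hQ).integrableOn
    (integrable_kernel_real _ hQ).integrableOn

/-- The joint probability is a constant plus the indefinite Lebesgue integral of f_D times the
conditional probability, so Lebesgue differentiation applies. -/
lemma ae_hasDerivAt_joint (hD : Measurable D) (hU : Measurable U)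
    (hK : HasCondDistrib U D K P) {fD : ℝ → ℝ} (hfD : Measurable fD)
    (hdens : P.map D = volume.withDensity (fun d => ENNReal.ofReal (fD d))) {Q : Set β}
    (hQ : MeasurableSet Q) : ∀ᵐ d, HasDerivAt (fun s => P.real {ω | D ω ≤ s ∧ U ω ∈ Q})
      (max (fD d) 0 * (K d).real Q) d := by
  have : IsProbabilityMeasure (P.map D) := Measure.isProbabilityMeasure_map hD.aemeasurable
  have hm : Measurable fun d => ENNReal.ofReal (fD d) := hfD.ennreal_ofReal
  have hint : Integrable fun u => (ENNReal.ofReal (fD u)).toReal • (K u).real Q := by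
    rw [← integrable_withDensity_iff_integrable_smul' hm
      (Eventually.of_forall fun _ => ENNReal.ofReal_lt_top), ← hdens]
    exact integrable_kernel_real _ hQ
  filter_upwards [LocallyIntegrable.ae_hasDerivAt_integral hint.locallyIntegrable] with d hd
  have hJ : (fun s => P.real {ω | D ω ≤ s ∧ U ω ∈ Q}) = fun s => P.real {ω | D ω ≤ 0 ∧ U ω ∈ Q} +
      ∫ u in (0 : ℝ)..s, (ENNReal.ofReal (fD u)).toReal • (K u).real Q := by
    ext s
    rw [← sub_eq_iff_eq_add', measureReal_joint_sub hD hU hK hQ, hdens, intervalIntegral,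
      intervalIntegral, setIntegral_withDensity_eq_setIntegral_toReal_smul hm
        (Eventually.of_forall fun _ => ENNReal.ofReal_lt_top) _ measurableSet_Ioc,
      setIntegral_withDensity_eq_setIntegral_toReal_smul hm
        (Eventually.of_forall fun _ => ENNReal.ofReal_lt_top) _ measurableSet_Ioc]
  rw [hJ]
  have := (hd 0).const_add (P.real {ω | D ω ≤ 0 ∧ U ω ∈ Q})
  rwa [ENNReal.toReal_ofReal', smul_eq_mul] at this

/-- If `P[D ≤ s, U ∈ Q] = c(F_D(s))`, then the derivative of `c` is the conditional probability
of `U ∈ Q`, at points where the latter is continuous from the right. -/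
lemma deriv_eq_of_tendsto (hD : Measurable D) (hU : Measurable U) (hK : HasCondDistrib U D K P)
    (hc : Continuous (cdfOf P D))
    (hq : ∀ d ∈ interiorRange P D, quantile (cdfOf P D) (cdfOf P D d) = d) {Q : Set β}
    (hQ : MeasurableSet Q) {c : ℝ → ℝ}
    (hcJ : ∀ s, c (cdfOf P D s) = P.real {ω | D ω ≤ s ∧ U ω ∈ Q}) {d : ℝ}
    (hd : d ∈ interiorRange P D) {c' : ℝ} (hc' : HasDerivAt c c' (cdfOf P D d))
    (hKd : Tendsto (fun u => (K u).real Q) (𝓝[>] d) (𝓝 ((K d).real Q))) :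
    c' = (K d).real Q := by
  have : IsProbabilityMeasure (P.map D) := Measure.isProbabilityMeasure_map hD.aemeasurable
  set F := cdfOf P D
  have hlt : ∀ᶠ s in 𝓝[>] d, F d < F s := by
    have hev : ∀ᶠ s in 𝓝[>] d, s ∈ interiorRange P D :=
      nhdsWithin_le_nhds ((isOpen_interiorRange hc).mem_nhds hd)
    filter_upwards [hev, self_mem_nhdsWithin] with s hs hds
    exact cdfOf_lt_of_lt hD hq hs hds
  -- Strict increase keeps F(s) ≠ F(d), so the slope of c at F(d) can be sampled along F(s): it is
  -- the mean of the conditional probability over (d, s].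
  have hF : Tendsto F (𝓝[>] d) (𝓝[≠] (F d)) :=
    tendsto_nhdsWithin_iff.2 ⟨(hc.tendsto d).mono_left nhdsWithin_le_nhds,
      hlt.mono fun s hs => hs.ne'⟩
  have h1 := (hasDerivAt_iff_tendsto_slope.1 hc').comp hF
  refine tendsto_nhds_unique h1 ?_
  rw [Metric.tendsto_nhds]
  intro r hr
  obtain ⟨e, he, hsub⟩ := mem_nhdsGT_iff_exists_Ioo_subset.1
    (Metric.tendsto_nhds.1 hKd (r / 2) (half_pos hr))
  have hde : ∀ᶠ s in 𝓝[>] d, s ∈ Ioo d e := Ioo_mem_nhdsGT he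
  filter_upwards [hlt, hde] with s hs hse
  have hpos : 0 < F s - F d := sub_pos.2 hs
  have hb : |(P.real {ω | D ω ≤ s ∧ U ω ∈ Q} - P.real {ω | D ω ≤ d ∧ U ω ∈ Q}) -
      (K d).real Q * (F s - F d)| ≤ r / 2 * (F s - F d) := by
    rw [measureReal_joint_sub hD hU hK hQ, intervalIntegral.integral_of_le hse.1.le,
      ← measureReal_Ioc_eq hD hse.1.le]
    have hconst : (K d).real Q * (P.map D).real (Ioc d s) =
        ∫ _ in Ioc d s, (K d).real Q ∂(P.map D) := by
      rw [setIntegral_const, smul_eq_mul, mul_comm]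
    rw [hconst, ← integral_sub (integrable_kernel_real _ hQ).integrableOn (integrable_const _),
      ← Real.norm_eq_abs]
    refine norm_setIntegral_le_of_norm_le_const (measure_lt_top _ _) fun u hu => ?_
    exact (show dist ((K u).real Q) ((K d).real Q) < r / 2 from
      hsub ⟨hu.1, hu.2.trans_lt hse.2⟩).le
  rw [Function.comp_apply, slope_def_field, hcJ, hcJ, Real.dist_eq]
  have heq : (P.real {ω | D ω ≤ s ∧ U ω ∈ Q} - P.real {ω | D ω ≤ d ∧ U ω ∈ Q}) / (F s - F d) -
      (K d).real Q = ((P.real {ω | D ω ≤ s ∧ U ω ∈ Q} - P.real {ω | D ω ≤ d ∧ U ω ∈ Q}) -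
      (K d).real Q * (F s - F d)) / (F s - F d) := by
    field_simp
  rw [heq, abs_div, abs_of_pos hpos, div_lt_iff₀ hpos]
  nlinarith

end JointDistribution

/-! ### The copula integrator -/

section Copula

variable {Ω : Type*} [MeasurableSpace Ω] {P : Measure Ω} [IsProbabilityMeasure P] {k : ℕ}
  {D V : Ω → ℝ} {X : Ω → Fin k → ℝ} {C : ℝ → ℝ → (Fin k → ℝ) → ℝ} {H : ℝ → ℝ → ℝ} {G : ℝ → ℝ}

/-- The partial derivative of the copula in its first component, at the point
`(F_D(d), F_V(v), F_X(x))`. -/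
noncomputable def copulaDeriv (P : Measure Ω) (C : ℝ → ℝ → (Fin k → ℝ) → ℝ) (D V : Ω → ℝ)
    (X : Ω → Fin k → ℝ) (d v : ℝ) (x : Fin k → ℝ) : ℝ :=
  deriv (fun s => C s (cdfOf P V v) fun j => cdfOf P (fun ω => X ω j) (x j)) (cdfOf P D d)

lemma hasDerivAt_copula (hC : PartiallyDifferentiable C) {d : ℝ} (hd : d ∈ interiorRange P D)
    (v : ℝ) (x : Fin k → ℝ) :
    HasDerivAt (fun s => C s (cdfOf P V v) fun j => cdfOf P (fun ω => X ω j) (x j))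
      (copulaDeriv P C D V X d v x) (cdfOf P D d) :=
  (hC _ hd _ ⟨cdfOf_nonneg _, cdfOf_le_one _⟩ _
    fun _ => ⟨cdfOf_nonneg _, cdfOf_le_one _⟩).hasDerivAt

/-- Along `H_t = F_D + t (G - F_D)` the copula is differentiable in `t` at `t = 0`. -/
lemma hasDerivWithinAt_copulaPath (hC : PartiallyDifferentiable C)
    (hH : ∀ t ∈ Icc (0 : ℝ) 1, ∀ d, H t d = cdfOf P D d + t * (G d - cdfOf P D d))
    (hG : ∀ d ∉ interiorRange P D, G d = cdfOf P D d) (d v : ℝ) (x : Fin k → ℝ) :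
    HasDerivWithinAt (copulaPath P C H V X d v x)
      (copulaDeriv P C D V X d v x * (G d - cdfOf P D d)) (Icc 0 1) 0 := by
  have hlin : HasDerivAt (fun t : ℝ => cdfOf P D d + t * (G d - cdfOf P D d))
      (G d - cdfOf P D d) 0 := by
    simpa using ((hasDerivAt_id (0 : ℝ)).mul_const (G d - cdfOf P D d)).const_add (cdfOf P D d)
  by_cases hd : d ∈ interiorRange P D
  · have hcop := hasDerivAt_copula (V := V) (X := X) hC hd v x
    have hcop' : HasDerivAt (fun s => C s (cdfOf P V v) fun j => cdfOf P (fun ω => X ω j) (x j))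
        (copulaDeriv P C D V X d v x) (cdfOf P D d + 0 * (G d - cdfOf P D d)) := by
      simpa using hcop
    refine (hcop'.comp (0 : ℝ) hlin).hasDerivWithinAt.congr (fun t ht => ?_) ?_
    · simp [copulaPath, hH t ht]
    · simp [copulaPath, hH 0 (by simp)]
  -- Where F_D is 0 or 1, G_D agrees with it and the path is constant; no derivative of C at the
  -- ends of [0, 1] is needed.
  · rw [hG d hd, sub_self, mul_zero]
    have hcst : ∀ t ∈ Icc (0 : ℝ) 1, copulaPath P C H V X d v x t =
        C (cdfOf P D d) (cdfOf P V v) fun j => cdfOf P (fun ω => X ω j) (x j) := by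
      intro t ht
      simp [copulaPath, hH t ht, hG d hd]
    exact (hasDerivWithinAt_const (0 : ℝ) _ _).congr hcst (hcst 0 (by simp))

lemma copulaIntegrator_eq (hC : PartiallyDifferentiable C)
    (hH : ∀ t ∈ Icc (0 : ℝ) 1, ∀ d, H t d = cdfOf P D d + t * (G d - cdfOf P D d))
    (hG : ∀ d ∉ interiorRange P D, G d = cdfOf P D d) (d v : ℝ) (x : Fin k → ℝ) :
    copulaIntegrator P C H V X d v x = copulaDeriv P C D V X d v x * (G d - cdfOf P D d) :=
  (hasDerivWithinAt_copulaPath hC hH hG d v x).derivWithin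
    (uniqueDiffOn_Icc zero_lt_one 0 (by simp))

variable {K : Kernel ℝ (ℝ × (Fin k → ℝ))} [IsMarkovKernel K]

/-- Continuity from above of both Jordan parts; this is where being the distribution function of a
signed measure yields regularity of the integrator. -/
lemma tendsto_signedMeasure_Iic (ν : SignedMeasure (ℝ × ℝ × (Fin k → ℝ)))
    {Q : Set (ℝ × (Fin k → ℝ))} (hQ : MeasurableSet Q) (d : ℝ) :
    Tendsto (fun s => ν (Iic s ×ˢ Q)) (𝓝[>] d) (𝓝 (ν (Iic d ×ˢ Q))) := by
  have hright : ∀ (τ : Measure (ℝ × ℝ × (Fin k → ℝ))) [IsFiniteMeasure τ],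
      Tendsto (fun s => τ.real (Iic s ×ˢ Q)) (𝓝[>] d) (𝓝 (τ.real (Iic d ×ˢ Q))) := by
    intro τ _
    have := tendsto_measure_biInter_gt (μ := τ) (s := fun s : ℝ => Iic s ×ˢ Q) (a := d)
      (fun r _ => (measurableSet_Iic.prod hQ).nullMeasurableSet)
      (fun i j _ hij => prod_mono (Iic_subset_Iic.2 hij) le_rfl) ⟨d + 1, by simp, measure_ne_top _ _⟩
    have hI : ⋂ r > d, Iic r ×ˢ Q = Iic d ×ˢ Q := by
      ext p
      simp only [mem_iInter]
      refine ⟨fun hp => ⟨?_, (hp (d + 1) (by simp)).2⟩, fun hp r hr =>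
        ⟨(mem_Iic.1 hp.1).trans (le_of_lt hr), hp.2⟩⟩
      exact mem_Iic.2 (le_of_forall_gt_imp_ge_of_dense fun r hr => (hp r hr).1)
    rw [hI] at this
    exact (ENNReal.tendsto_toReal (measure_ne_top _ _)).comp this
  have hν : ∀ s, ν (Iic s ×ˢ Q) = ν.toJordanDecomposition.posPart.real (Iic s ×ˢ Q) -
      ν.toJordanDecomposition.negPart.real (Iic s ×ˢ Q) := fun s =>
    SignedMeasure.apply_eq_posPart_real_sub_negPart_real ν (measurableSet_Iic.prod hQ)
  simp only [hν]
  exact (hright _).sub (hright _)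

/-- If the integrator `F_{V,X|D} (G - F_D)` is a distribution function, then it coincides with the
copula integrator. -/
lemma copulaIntegrator_eq_marginalIntegrator (hD : Measurable D) (hV : Measurable V)
    (hX : Measurable X) (hK : HasCondDistrib (fun ω => (V ω, X ω)) D K P)
    (hc : Continuous (cdfOf P D)) (hGc : Continuous G)
    (hq : ∀ d ∈ interiorRange P D, quantile (cdfOf P D) (cdfOf P D d) = d)
    (hC : PartiallyDifferentiable C)
    (hJ : ∀ d v x, C (cdfOf P D d) (cdfOf P V v) (fun j => cdfOf P (fun ω => X ω j) (x j)) =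
      P.real {ω | D ω ≤ d ∧ V ω ≤ v ∧ X ω ≤ x})
    (hH : ∀ t ∈ Icc (0 : ℝ) 1, ∀ d, H t d = cdfOf P D d + t * (G d - cdfOf P D d))
    (hG : ∀ d ∉ interiorRange P D, G d = cdfOf P D d)
    {ν : SignedMeasure (ℝ × ℝ × (Fin k → ℝ))}
    (hν : IsDistributionFunction (marginalIntegrator K (cdfOf P D) G) ν) (d v : ℝ)
    (x : Fin k → ℝ) :
    copulaIntegrator P C H V X d v x = marginalIntegrator K (cdfOf P D) G d v x := by
  rw [copulaIntegrator_eq hC hH hG, marginalIntegrator]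
  by_cases h0 : G d - cdfOf P D d = 0
  · rw [h0, mul_zero, mul_zero]
  have hd : d ∈ interiorRange P D := by
    by_contra h
    exact h0 (sub_eq_zero.2 (hG d h))
  have hQ : MeasurableSet (Iic v ×ˢ Iic x) := measurableSet_Iic.prod measurableSet_Iic
  have hcont : Tendsto (fun s => G s - cdfOf P D s) (𝓝[>] d) (𝓝 (G d - cdfOf P D d)) :=
    ((hGc.sub hc).tendsto d).mono_left nhdsWithin_le_nhds
  -- The product F_{V,X|D} (G - F_D) is right continuous in d; division by the continuous factor,
  -- nonzero at d, passes this to the chosen version of F_{V,X|D}.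
  have hKd : Tendsto (fun u => (K u).real (Iic v ×ˢ Iic x)) (𝓝[>] d)
      (𝓝 ((K d).real (Iic v ×ˢ Iic x))) := by
    have h1 := (tendsto_signedMeasure_Iic ν hQ d).div hcont h0
    simp only [hν _ v x, marginalIntegrator] at h1
    rw [mul_div_assoc, div_self h0, mul_one] at h1
    refine h1.congr' ?_
    filter_upwards [hcont.eventually_ne h0] with s hs
    exact mul_div_cancel_right₀ _ hs
  congr 1
  exact deriv_eq_of_tendsto hD (hV.prodMk hX) hK hc hq hQ (fun s => hJ s v x) hd
    (hasDerivAt_copula hC hd v x) hKd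

/-- The copula integrator coincides with `F_{V,X|D} (G - F_D)` at almost every `d`. -/
lemma ae_copulaIntegrator_eq (hD : Measurable D) (hV : Measurable V)
    (hX : Measurable X) (hK : HasCondDistrib (fun ω => (V ω, X ω)) D K P)
    {fD : ℝ → ℝ} (hfD : Measurable fD)
    (hdens : P.map D = volume.withDensity (fun d => ENNReal.ofReal (fD d)))
    (hpos : ∀ d ∈ interiorRange P D, 0 < fD d) (hC : PartiallyDifferentiable C)
    (hJ : ∀ d v x, C (cdfOf P D d) (cdfOf P V v) (fun j => cdfOf P (fun ω => X ω j) (x j)) =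
      P.real {ω | D ω ≤ d ∧ V ω ≤ v ∧ X ω ≤ x})
    (hH : ∀ t ∈ Icc (0 : ℝ) 1, ∀ d, H t d = cdfOf P D d + t * (G d - cdfOf P D d))
    (hG : ∀ d ∉ interiorRange P D, G d = cdfOf P D d) (v : ℝ) (x : Fin k → ℝ) :
    ∀ᵐ d, copulaIntegrator P C H V X d v x = marginalIntegrator K (cdfOf P D) G d v x := by
  have hQ : MeasurableSet (Iic v ×ˢ Iic x) := measurableSet_Iic.prod measurableSet_Iic
  filter_upwards [ae_hasDerivAt_cdfOf hD hfD hdens,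
    ae_hasDerivAt_joint hD (hV.prodMk hX) hK hfD hdens hQ] with d h1 h2
  rw [copulaIntegrator_eq hC hH hG, marginalIntegrator]
  by_cases hd : d ∈ interiorRange P D
  · congr 1
    -- The joint distribution function has derivative ∂_1 C · f_D by the chain rule and f_D ·
    -- F_{V,X|D} by Lebesgue differentiation; f_D > 0 cancels.
    have h3 := (hasDerivAt_copula (V := V) (X := X) hC hd v x).comp d h1
    have h4 : ((fun s => C s (cdfOf P V v) fun j => cdfOf P (fun ω => X ω j) (x j)) ∘
        cdfOf P D) = fun s => P.real {ω | D ω ≤ s ∧ (V ω, X ω) ∈ Iic v ×ˢ Iic x} :=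
      funext fun s => hJ s v x
    rw [h4] at h3
    have h5 := h3.unique h2
    rw [max_eq_left (hpos d hd).le, mul_comm] at h5
    exact mul_left_cancel₀ (hpos d hd).ne' h5
  · rw [hG d hd, sub_self, mul_zero, mul_zero]

end Copula

end PolicyEffect

/-! ### The two claims -/

theorem corollary5 {Ω : Type*} [MeasurableSpace Ω] (P : Measure Ω) [IsProbabilityMeasure P]
    {𝓔 : Type*} [MeasurableSpace 𝓔] [StandardBorelSpace 𝓔] {k : ℕ}
    -- the triangular system and the control variable
    (Y D Z η V : Ω → ℝ) (X : Ω → Fin k → ℝ) (ε : Ω → 𝓔)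
    (m : ℝ → (Fin k → ℝ) → 𝓔 → ℝ) (h : ℝ → (Fin k → ℝ) → ℝ → ℝ)
    (hS : PolicyEffect.IsTriangularSystem P Y D Z η X ε m h)
    (hC : PolicyEffect.ControlConditions P Z η X ε h)
    (hV : V = PolicyEffect.controlVar P D Z X)
    -- the policy
    (H : ℝ → ℝ → ℝ) (π : ℝ → ℝ → ℝ)
    (hπ : π = PolicyEffect.policy (PolicyEffect.cdfOf P D) H)
    (hH : PolicyEffect.PolicyConditions P D H)
    -- regularity
    (hR : PolicyEffect.UnconditionalRegularity P Y D X ε m π)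
    (hac : P.map (fun ω => (D ω, V ω, X ω)) ≪ volume.prod (P.map (fun ω => (V ω, X ω))))
    (κ : Kernel (ℝ × ℝ × (Fin k → ℝ)) 𝓔) [IsMarkovKernel κ]
    (hκ : HasCondDistrib ε (fun ω => (D ω, V ω, X ω)) κ P)
    (hκR : PolicyEffect.ConditionalRegularity P D V X m κ)
    -- the functional
    {B : Type*} [NormedAddCommGroup B] [NormedSpace ℝ B] [CompleteSpace B]
    (Γ : (ℝ → ℝ) → B) (𝓓 : Set (ℝ → ℝ)) (dΓ : (ℝ → ℝ) → B)
    (h𝓓 : ∀ t ∈ Icc (0 : ℝ) 1, PolicyEffect.counterfactualCdf P D X ε m π t ∈ 𝓓)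
    (hΓ : PolicyEffect.HasHadamardDerivAt Γ 𝓓 (PolicyEffect.cdfOf P Y)
      PolicyEffect.boundedContinuous dΓ) :
    -- (i) marginal perturbation in the direction of a distribution function
    (∀ (γ : Measure ℝ) [IsProbabilityMeasure γ] (K : Kernel ℝ (ℝ × (Fin k → ℝ)))
        [IsMarkovKernel K],
      (∀ t ∈ Icc (0 : ℝ) 1, ∀ d,
        H t d = PolicyEffect.cdfOf P D d + t * (cdf γ d - PolicyEffect.cdfOf P D d)) →
      HasCondDistrib (fun ω => (V ω, X ω)) D K P →
      ∃ θ : B,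
        PolicyEffect.IsMarginalPolicyEffect Γ (PolicyEffect.cdfOf P Y)
          (PolicyEffect.counterfactualCdf P D X ε m π) θ ∧
        (∀ ν, PolicyEffect.IsDistributionFunction
            (PolicyEffect.marginalIntegrator K (PolicyEffect.cdfOf P D) (cdf γ)) ν →
          PolicyEffect.HasIntegral (fun d v x => dΓ (PolicyEffect.condCdf κ m d v x)) ν θ) ∧
        ∀ C : ℝ → ℝ → (Fin k → ℝ) → ℝ,
          PolicyEffect.IsCopula C →
          (∀ t ∈ Icc (0 : ℝ) 1,
            PolicyEffect.IsCopulaOf P C (H t) (fun ω => π t (D ω)) V X) →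
          PolicyEffect.PartiallyDifferentiable C →
          (∀ d v x, DifferentiableWithinAt ℝ
            (PolicyEffect.copulaPath P C H V X d v x) (Icc 0 1) 0) ∧
          (∀ ν, PolicyEffect.IsDistributionFunction
              (PolicyEffect.marginalIntegrator K (PolicyEffect.cdfOf P D) (cdf γ)) ν →
            PolicyEffect.IsDistributionFunction (PolicyEffect.copulaIntegrator P C H V X) ν) ∧
          ∀ ν, PolicyEffect.IsDistributionFunction
              (PolicyEffect.copulaIntegrator P C H V X) ν →
            PolicyEffect.HasIntegral (fun d v x => dΓ (PolicyEffect.condCdf κ m d v x)) ν θ) ∧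
    -- (ii) location shift
    ((∀ t ∈ Icc (0 : ℝ) 1, ∀ d, H t d = PolicyEffect.cdfOf P D (d - t)) →
      (∀ y, Integrable (fun ω => PolicyEffect.condCdfDeriv (PolicyEffect.suppOf P D) κ m
        (D ω) (V ω) (X ω) y) P) ∧
      PolicyEffect.IsMarginalPolicyEffect Γ (PolicyEffect.cdfOf P Y)
        (PolicyEffect.counterfactualCdf P D X ε m π)
        (dΓ fun y => ∫ ω, PolicyEffect.condCdfDeriv (PolicyEffect.suppOf P D) κ m
          (D ω) (V ω) (X ω) y ∂P)) := by
  subst hπ hV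
  have hDm := hS.meas_D
  have hXm := hS.meas_X
  have hVm := PolicyEffect.measurable_controlVar hS
  set V := PolicyEffect.controlVar P D Z X
  set F := PolicyEffect.cdfOf P D with hF
  set S := PolicyEffect.suppOf P D
  obtain ⟨κ', hκ'⟩ := PolicyEffect.exists_kernel_control hS hC κ hκ
  obtain ⟨f, g, Cf, -, hg, hf, hfc⟩ := hR.density
  obtain ⟨fD, hfD, hdens, hfDpos⟩ := hH.pos_density
  obtain ⟨M, hM⟩ := hH.bounded
  have hYo : Y = PolicyEffect.outcome m D X ε := funext hS.outcome_eq
  have hYm : Measurable Y := by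
    rw [hYo]
    exact hS.meas_m.comp (f := fun ω => (D ω, X ω, ε ω))
      (hDm.prodMk (hXm.prodMk hS.meas_ε))
  have hmDot : Measurable fun ω =>
      PolicyEffect.mDot m (PolicyEffect.policy F H) (D ω) (X ω) (ε ω) :=
    hR.meas_mDot.comp (f := fun ω => (D ω, X ω, ε ω)) (hDm.prodMk (hXm.prodMk hS.meas_ε))
  have hθ := PolicyEffect.isMarginalPolicyEffect_density hYm hS.outcome_eq hmDot hR.linearization
    hg hf hfc h𝓓 hΓ
  -- what the two parts have in common, under `H 0 = F`
  have common : H 0 = F → Continuous F ∧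
      (∀ d ∈ PolicyEffect.interiorRange P D, PolicyEffect.quantile F (F d) = d) ∧
      (∀ d ∈ PolicyEffect.interiorRange P D, S ∈ 𝓝 d) ∧
      (∀ᵐ ω ∂P, D ω ∈ PolicyEffect.interiorRange P D) ∧
      ∃ A, ∀ᵐ p ∂(P.map fun ω => (D ω, V ω, X ω)), ∀ y,
        (∀ n, |PolicyEffect.condStrip κ m y n p| ≤ A) ∧
        |PolicyEffect.condCdfDeriv S κ m p.1 p.2.1 p.2.2 y| ≤ A ∧
        Tendsto (fun n => PolicyEffect.condStrip κ m y n p) atTop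
          (𝓝 (-PolicyEffect.condCdfDeriv S κ m p.1 p.2.1 p.2.2 y)) := by
    intro hH0
    have hc : Continuous F := hH0 ▸ hH.continuous_H 0 (by simp)
    have hq : ∀ d ∈ PolicyEffect.interiorRange P D, PolicyEffect.quantile F (F d) = d := by
      intro d hd
      have := hH.at_zero d hd.1 hd.2
      rwa [PolicyEffect.policy, hH0] at this
    have hSn : ∀ d ∈ PolicyEffect.interiorRange P D, S ∈ 𝓝 d := fun d hd =>
      PolicyEffect.suppOf_mem_nhds hDm hc hq hd
    have hI : ∀ᵐ ω ∂P, D ω ∈ PolicyEffect.interiorRange P D :=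
      ae_of_ae_map hDm.aemeasurable (PolicyEffect.ae_mem_interiorRange hDm hc)
    exact ⟨hc, hq, hSn, hI, PolicyEffect.ae_condCdfDeriv hS.meas_m hS.smooth_m hDm hVm hXm hκR hac
      hκ' (hI.mono fun ω hω => hSn _ hω)⟩
  rw [hYo] at hf
  refine ⟨fun γ _ K _ hHγ hK => ⟨_, hθ, ?_⟩, fun hHs => ?_⟩
  · have hH0 : H 0 = F := funext fun d => by simpa using hHγ 0 (by simp) d
    have hH1 : H 1 = cdf γ := funext fun d => by simpa using hHγ 1 (by simp) d
    obtain ⟨hc, hq, hSn, hI, A, hA⟩ := common hH0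
    have hγc : Continuous (cdf γ) := hH1 ▸ hH.continuous_H 1 (by simp)
    have hG : ∀ d ∉ PolicyEffect.interiorRange P D, cdf γ d = F d := fun d hd =>
      PolicyEffect.cdf_eq_of_notMem hDm hc hH1 hγc (hH.supp_subset 1 (by simp)) hd
    have hpos : ∀ d ∈ PolicyEffect.interiorRange P D, 0 < fD d := fun d hd =>
      hfDpos d (mem_of_mem_nhds (hSn d hd))
    -- the derivative of the policy
    set w : ℝ → ℝ := fun d => (F d - cdf γ d) / fD d with hw_def
    have hw : Measurable w := (hc.measurable.sub hγc.measurable).div hfD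
    have hwπ : ∀ᵐ ω ∂P, PolicyEffect.policyDeriv (PolicyEffect.policy F H) (D ω) = w (D ω) ∧
        |w (D ω)| ≤ M := by
      have h1 : ∀ᵐ d ∂(P.map D), HasDerivAt F (max (fD d) 0) d := by
        rw [hdens]
        exact (withDensity_absolutelyContinuous _ _).ae_le
          (PolicyEffect.ae_hasDerivAt_cdfOf hDm hfD hdens)
      filter_upwards [ae_of_ae_map hDm.aemeasurable h1, hI] with ω h1 h2
      have h3 := PolicyEffect.policyDeriv_perturbation hDm hc hγc hHγ h2
        (hH.at_zero _ h2.1 h2.2) (hH.differentiable _ h2.1 h2.2) h1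
      rw [max_eq_left (hpos _ h2).le] at h3
      have h4 : PolicyEffect.policyDeriv (PolicyEffect.policy F H) (D ω) = w (D ω) := by
        rw [hw_def, eq_div_iff (hpos _ h2).ne', mul_comm]
        exact h3
      exact ⟨h4, h4 ▸ hM _ h2.1 h2.2⟩
    have hθeq : (fun y => -∫ z, z * f y z) = fun y => ∫ ω, w (D ω) *
        PolicyEffect.condCdfDeriv S κ m (D ω) (V ω) (X ω) y ∂P := funext fun y =>
      (PolicyEffect.integral_condCdfDeriv hS.meas_m hS.smooth_m hDm hVm hXm hS.meas_ε hκ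
        (hA.mono fun p hp => hp y) hR.meas_mDot hw hwπ hg hf fun z => (hfc z).continuous).2
    have hlim : Tendsto (fun d => cdf γ d - F d) atTop (𝓝 0) := by
      simpa using (tendsto_cdf_atTop γ).sub (PolicyEffect.tendsto_cdfOf_atTop (P := P) hDm)
    -- Equality with the integrator is demanded only for almost every d, so that the same statement
    -- also serves the copula integrator.
    have main : ∀ ν : SignedMeasure (ℝ × ℝ × (Fin k → ℝ)),
        (∀ v x, ∀ᵐ d, ν (Iic d ×ˢ Iic v ×ˢ Iic x) =
          PolicyEffect.marginalIntegrator K F (cdf γ) d v x) →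
        PolicyEffect.HasIntegral (fun d v x => dΓ (PolicyEffect.condCdf κ m d v x)) ν
          (dΓ fun y => -∫ z, z * f y z) := by
      intro ν hν
      rw [hθeq]
      exact PolicyEffect.hasIntegral_condCdf hS.meas_m hS.smooth_m hDm hVm hXm hκR
        (hA.mono fun p hp y => (hp y).2.1) hK hc hSn hfD hdens hfDpos hw
        (hwπ.mono fun ω hω => hω.2)
        (fun d hd => by
          rw [hw_def, div_mul_cancel₀ _ (hpos d hd).ne', neg_sub])
        (fun d hd => sub_eq_zero.2 (hG d hd)) hlim hΓ hν
    refine ⟨fun ν hν => main ν fun v x => Eventually.of_forall fun d => hν d v x,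
      fun C _ hcop hCd => ?_⟩
    -- The copula condition at t = 0, where π_0(D) = D almost surely.
    have hJ : ∀ d v x, C (F d) (PolicyEffect.cdfOf P V v)
        (fun j => PolicyEffect.cdfOf P (fun ω => X ω j) (x j)) =
        P.real {ω | D ω ≤ d ∧ V ω ≤ v ∧ X ω ≤ x} := by
      intro d v x
      rw [← hH0, hcop 0 (by simp) d v x]
      refine measureReal_congr ?_
      filter_upwards [hI] with ω hω
      have h1 : PolicyEffect.policy F H 0 (D ω) = D ω := hH.at_zero _ hω.1 hω.2
      change (PolicyEffect.policy F H 0 (D ω) ≤ d ∧ _) = (D ω ≤ d ∧ _)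
      rw [h1]
    refine ⟨fun d v x => (PolicyEffect.hasDerivWithinAt_copulaPath hCd hHγ hG d v
      x).differentiableWithinAt, fun ν hν d v x => ?_, fun ν hν => main ν fun v x => ?_⟩
    · rw [hν d v x]
      exact (PolicyEffect.copulaIntegrator_eq_marginalIntegrator hDm hVm hXm hK hc hγc hq hCd hJ
        hHγ hG hν d v x).symm
    · filter_upwards [PolicyEffect.ae_copulaIntegrator_eq hDm hVm hXm hK hfD hdens hpos hCd hJ hHγ
        hG v x] with d hd
      rw [hν d v x, hd]
  · have hH0 : H 0 = F := funext fun d => by simpa using hHs 0 (by simp) d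
    obtain ⟨hc, hq, hSn, hI, A, hA⟩ := common hH0
    have hwπ : ∀ᵐ ω ∂P, PolicyEffect.policyDeriv (PolicyEffect.policy F H) (D ω) = 1 ∧
        |(1 : ℝ)| ≤ 1 := by
      filter_upwards [hI] with ω hω
      exact ⟨PolicyEffect.policyDeriv_shift hDm hq hHs hω, by simp⟩
    have hrep := fun y => PolicyEffect.integral_condCdfDeriv hS.meas_m hS.smooth_m hDm hVm hXm
      hS.meas_ε hκ (hA.mono fun p hp => hp y) hR.meas_mDot (w := fun _ => 1) measurable_const hwπ
      hg hf fun z => (hfc z).continuous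
    have hDVX : Measurable fun ω => (D ω, V ω, X ω) := hDm.prodMk (hVm.prodMk hXm)
    refine ⟨fun y => ?_, ?_⟩
    · have hbd : ∀ᵐ ω ∂P, ‖PolicyEffect.condCdfDeriv S κ m (D ω) (V ω) (X ω) y‖ ≤ A := by
        filter_upwards [ae_of_ae_map hDVX.aemeasurable hA] with ω hω using (hω y).2.1
      exact Integrable.of_bound ((hrep y).1.comp_aemeasurable hDVX.aemeasurable) A hbd
    · have hθeq : (fun y => -∫ z, z * f y z) = fun y => ∫ ω,
          PolicyEffect.condCdfDeriv S κ m (D ω) (V ω) (X ω) y ∂P := funext fun y => by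
        rw [(hrep y).2]
        simp only [one_mul]
      rw [← hθeq]
      exact hθ
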